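/- Let $k$ be a field of characteristic $0$ and let $G$ be a group. For $x\in G$ let $G_x$ be the centralizer of $x$ in $G$ and $\overline{G}_x=G_x/\langle x\rangle$. Let $t(G)\subseteq G$ be a set of representatives of the conjugacy classes of $G$, and $t_f(G)\subseteq t(G)$ the subset of the elements of finite order. All algebras are associative and unital. For an algebra $A$ over $k$ with a subalgebra $B$, let $HC_*(A/B)$ denote the cyclic homology of the extension $A/B$, that is, the homology of the total complex of the Tsygan double complex of the cyclic object $Z_n(A/B)=A^{\otimes_B(n+1)}/[A^{\otimes_B(n+1)},B]$ with the usual faces $a^0\otimes\cdots\otimes a^n\mapsto a^0\otimes\cdots\otimes a^ia^{i+1}\otimes\cdots\otimes a^n$ $(0\le i<n)$, $a^0\otimes\cdots\otimes a^n\mapsto a^na^0\otimes a^1\otimes\cdots\otimes a^{n-1}$, and the cyclic operator $a^0\otimes\cdots\otimes a^n\mapsto a^n\otimes a^0\otimes\cdots\otimes a^{n-1}$; and let $HC_*(A)=HC_*(A/k)$ (the tensor powers being taken over $k$) be the usual cyclic homology. $H_*$ denotes group homology, and direct sums over $i$ run over $0\le 2i\le *$. A $k$-algebra $B$ is called separable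 if the multiplication $B\otimes_kB\to B$ has a section of $(B,B)$-bimodules. (1) Let $A=\bigoplus_{x\in G}A_x$ be a $G$-strongly graded $k$-algebra, i.e. $A_xA_y=A_{xy}$ for all $x,y\in G$. Put $B:=A_1$ and $\overline{A}_x:=A_x/[A_x,B]$, where $[A_x,B]$ is the subspace spanned by all $ab-ba$ with $a\in A_x$, $b\in B$. The group $G_x$ acts on $\overline{A}_x$ by $g\cdot\overline{m}=\sum_i\overline{b_ima_i}$, where $a_i\in A_{g^{-1}}$ and $b_i\in A_g$ are any finitely many elements with $\sum_ia_ib_i=1$; the element $x$ acts trivially, so $\overline{A}_x$ is a $\overline{G}_x$-module. Then, in each degree, there is an isomorphism of $k$-vector spaces $$HC_*(A/B)\simeq\Bigl(\bigoplus_{x\in t_f(G)}\bigoplus_{i\ge0}H_{*-2i}(\overline{G}_x,\overline{A}_x)\Bigr)\oplus\Bigl(\bigoplus_{x\in t(G)\setminus t_f(G)}H_*(\overline{G}_x,\overline{A}_x)\Bigr).$$ If $B$ is a separable $k$-algebra, then $HC_*(A)$ is isomorphic to the same direct sum. (2) Let $B$ be a $k$-algebra on which $G$ acts by $k$-algebra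 automorphisms, and let $B\#kG$ be the smash product, i.e. the free left $B$-module with basis $\{e_x\mid x\in G\}$ and the multiplication $(be_x)(b'e_y)=b(x.b')e_{xy}$. For $x\in G$ let $\overline{B}_x=B/[B,B]_x$, where $[B,B]_x$ is the subspace spanned by all $bb'-b'(x.b)$ with $b,b'\in B$; the action of $G$ on $B$ makes $\overline{B}_x$ a $\overline{G}_x$-module. Then, in each degree, $$HC_*(B\#kG/B)\simeq\Bigl(\bigoplus_{x\in t_f(G)}\bigoplus_{i\ge0}H_{*-2i}(\overline{G}_x,\overline{B}_x)\Bigr)\oplus\Bigl(\bigoplus_{x\in t(G)\setminus t_f(G)}H_*(\overline{G}_x,\overline{B}_x)\Bigr).$$ If $B$ is a separable $k$-algebra, then $HC_*(B\#kG)$ is isomorphic to the same direct sum. -/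

import Mathlib

universe u v

noncomputable section

namespace RelCyclic

open CategoryTheory
open scoped TensorProduct

/-- A cyclic `k`-module, with its face maps `d` and cyclic operators `t`. The degeneracies are not
recorded, as they do not enter the Tsygan double complex. -/
structure CyclicModule (k : Type u) [CommRing k] where
  X : ℕ → Type v
  [addCommGroup : ∀ n, AddCommGroup (X n)]
  [module : ∀ n, Module k (X n)]
  d : ∀ n, Fin (n + 2) → X (n + 1) →ₗ[k] X n
  t : ∀ n, X n →ₗ[k] X n
  d_comp_d : ∀ n (i j : Fin (n + 2)), i ≤ j →
    d n i ∘ₗ d (n + 1) j.succ = d n j ∘ₗ d (n + 1) i.castSucc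
  d_zero_comp_t : ∀ n, d n 0 ∘ₗ t (n + 1) = d n (Fin.last (n + 1))
  d_succ_comp_t : ∀ n (i : Fin (n + 1)), d n i.succ ∘ₗ t (n + 1) = t n ∘ₗ d n i.castSucc
  t_pow : ∀ n, t n ^ (n + 1) = 1

namespace CyclicModule

attribute [instance] CyclicModule.addCommGroup CyclicModule.module

variable {k : Type u} [CommRing k] (Z : CyclicModule.{u, v} k)

/-- The signed cyclic operator `(-1)^n t_n`. -/
def T (n : ℕ) : Module.End k (Z.X n) := (-1 : k) ^ n • Z.t n

/-- The Hochschild differential, the alternating sum of all faces. -/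
def b (n : ℕ) : Z.X (n + 1) →ₗ[k] Z.X n := ∑ i : Fin (n + 2), (-1 : k) ^ (i : ℕ) • Z.d n i

/-- The differential of the acyclic column, the alternating sum of all faces but the last. -/
def b' (n : ℕ) : Z.X (n + 1) →ₗ[k] Z.X n :=
  ∑ i : Fin (n + 1), (-1 : k) ^ (i : ℕ) • Z.d n i.castSucc

/-- The norm operator of the cyclic group of order `n + 1` acting through `(-1)^n t_n`. -/
def N (n : ℕ) : Module.End k (Z.X n) := ∑ j ∈ Finset.range (n + 1), Z.T n ^ j

theorem finSum_comp {ι : Type} (s : Finset ι) {X₀ X₁ X₂ : Type v} [AddCommGroup X₀]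
    [AddCommGroup X₁] [AddCommGroup X₂] [Module k X₀] [Module k X₁] [Module k X₂]
    (f : ι → X₁ →ₗ[k] X₀) (g : X₂ →ₗ[k] X₁) : (∑ i ∈ s, f i) ∘ₗ g = ∑ i ∈ s, f i ∘ₗ g := by
  ext x; simp

theorem comp_finSum {ι : Type} (s : Finset ι) {X₀ X₁ X₂ : Type v} [AddCommGroup X₀]
    [AddCommGroup X₁] [AddCommGroup X₂] [Module k X₀] [Module k X₁] [Module k X₂]
    (f : X₁ →ₗ[k] X₀) (g : ι → X₂ →ₗ[k] X₁) : f ∘ₗ (∑ i ∈ s, g i) = ∑ i ∈ s, f ∘ₗ g i := by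
  ext x; simp

theorem alternating_comp {m : ℕ} {X₀ X₁ X₂ : Type v} [AddCommGroup X₀] [AddCommGroup X₁]
    [AddCommGroup X₂] [Module k X₀] [Module k X₁] [Module k X₂]
    (f : Fin (m + 1) → X₁ →ₗ[k] X₀) (g : Fin (m + 2) → X₂ →ₗ[k] X₁)
    (h : ∀ i j : Fin (m + 1), i ≤ j → f i ∘ₗ g j.succ = f j ∘ₗ g i.castSucc) :
    (∑ i : Fin (m + 1), (-1 : k) ^ (i : ℕ) • f i) ∘ₗ
      (∑ j : Fin (m + 2), (-1 : k) ^ (j : ℕ) • g j) = 0 := by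
  classical
  let F : Fin (m + 1) → Fin (m + 2) → X₂ →ₗ[k] X₀ := fun i j =>
    ((-1 : k) ^ (i : ℕ) * (-1 : k) ^ (j : ℕ)) • (f i ∘ₗ g j)
  have e : (∑ i : Fin (m + 1), (-1 : k) ^ (i : ℕ) • f i) ∘ₗ
      (∑ j : Fin (m + 2), (-1 : k) ^ (j : ℕ) • g j)
      = ∑ i, ∑ j, F i j := by
    rw [finSum_comp]
    refine Finset.sum_congr rfl fun i _ => ?_
    rw [comp_finSum]
    refine Finset.sum_congr rfl fun j _ => ?_
    simp only [F, LinearMap.smul_comp, LinearMap.comp_smul, smul_smul]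
    rw [mul_comm]
  have e1 : ∀ i, ∑ j, F i j = ∑ j : Fin (m + 1), (if i ≤ j then F i j.succ else 0)
      + ∑ j : Fin (m + 1), (if j ≤ i then F i j.castSucc else 0) := by
    intro i
    rw [Fin.sum_univ_succAbove _ i.castSucc]
    have a1 : ∑ j : Fin (m + 1), F i (i.castSucc.succAbove j)
        = ∑ j : Fin (m + 1), ((if i ≤ j then F i j.succ else 0)
          + (if j < i then F i j.castSucc else 0)) := by
      refine Finset.sum_congr rfl fun j _ => ?_
      by_cases hij : i ≤ j
      · rw [Fin.succAbove_of_le_castSucc _ _ (by simpa using hij), if_pos hij,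
          if_neg (not_lt.2 hij), add_zero]
      · rw [Fin.succAbove_of_castSucc_lt _ _ (by simpa using hij), if_neg hij,
          if_pos (not_le.1 hij), zero_add]
    have a2 : ∑ j : Fin (m + 1), (if j ≤ i then F i j.castSucc else 0)
        = F i i.castSucc + ∑ j : Fin (m + 1), (if j < i then F i j.castSucc else 0) := by
      rw [← Finset.sum_filter, ← Finset.sum_filter]
      have : (Finset.univ.filter fun j => j ≤ i) = insert i (Finset.univ.filter fun j => j < i) := by
        ext j; simp [le_iff_eq_or_lt]
      rw [this, Finset.sum_insert (by simp)]
    rw [a1, a2, Finset.sum_add_distrib]; abel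
  rw [e, Finset.sum_congr rfl fun i _ => e1 i, Finset.sum_add_distrib]
  rw [Finset.sum_comm (f := fun i j => if j ≤ i then F i j.castSucc else 0),
    ← Finset.sum_add_distrib]
  refine Finset.sum_eq_zero fun i _ => ?_
  rw [← Finset.sum_add_distrib]
  refine Finset.sum_eq_zero fun j _ => ?_
  by_cases hij : i ≤ j
  · simp only [if_pos hij, F, h i j hij, Fin.val_succ, Fin.val_castSucc, ← add_smul]
    rw [pow_succ]
    convert! zero_smul k _
    ring
  · simp [if_neg hij]

theorem b_comp_b (n : ℕ) : Z.b n ∘ₗ Z.b (n + 1) = 0 :=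
  alternating_comp _ _ (Z.d_comp_d n)

theorem b'_comp_b' (n : ℕ) : Z.b' n ∘ₗ Z.b' (n + 1) = 0 := by
  refine alternating_comp (fun i : Fin (n + 1) => Z.d n i.castSucc)
    (fun i : Fin (n + 2) => Z.d (n + 1) i.castSucc) fun i j hij => ?_
  have := Z.d_comp_d n i.castSucc j.castSucc (by simpa using hij)
  rwa [Fin.succ_castSucc] at this

theorem T_pow (n : ℕ) : Z.T n ^ (n + 1) = 1 := by
  rw [T, smul_pow, Z.t_pow, ← pow_mul, Even.neg_one_pow (Nat.even_mul_succ_self n), one_smul]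

theorem N_mul_T (n : ℕ) : Z.N n * Z.T n = Z.N n := by
  have h := geom_sum_mul (Z.T n) (n + 1)
  rw [Z.T_pow, sub_self, mul_sub, mul_one, sub_eq_zero] at h
  exact h

theorem T_mul_N (n : ℕ) : Z.T n * Z.N n = Z.N n := by
  have h := mul_geom_sum (Z.T n) (n + 1)
  rw [Z.T_pow, sub_self, sub_mul, one_mul, sub_eq_zero] at h
  exact h

theorem b_comp_one_sub_T (n : ℕ) :
    Z.b n ∘ₗ (1 - Z.T (n + 1)) = (1 - Z.T n) ∘ₗ Z.b' n := by
  have h1 : Z.b n ∘ₗ Z.T (n + 1) = (-1 : k) ^ (n + 1) • Z.d n (Fin.last (n + 1))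
      + Z.T n ∘ₗ Z.b' n := by
    rw [b, Fin.sum_univ_succ, LinearMap.add_comp, finSum_comp, b', comp_finSum]
    congr 1
    · simp [T, LinearMap.comp_smul, Z.d_zero_comp_t]
    · refine Finset.sum_congr rfl fun i _ => ?_
      simp only [T, LinearMap.comp_smul, LinearMap.smul_comp, Z.d_succ_comp_t, smul_smul,
        Fin.val_succ]
      congr 1
      ring
  have h2 : Z.b n = Z.b' n + (-1 : k) ^ (n + 1) • Z.d n (Fin.last (n + 1)) := by
    rw [b, Fin.sum_univ_castSucc, b']; simp
  rw [LinearMap.comp_sub, h1, LinearMap.sub_comp, h2]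
  change (_ + _) ∘ₗ LinearMap.id - _ = LinearMap.id ∘ₗ _ - _
  rw [LinearMap.comp_id, LinearMap.id_comp]
  abel

theorem sd_comp_T_pow (n : ℕ) (i : ℕ) (hi : i < n + 1) :
    ((-1 : k) ^ i • Z.d n ⟨i, by omega⟩) ∘ₗ (Z.T (n + 1) ^ i)
      = (Z.T n ^ i) ∘ₗ Z.d n 0 := by
  induction i with
  | zero => simp; rfl
  | succ i ih =>
    have h1 : ((-1 : k) ^ (i + 1) • Z.d n ⟨i + 1, by omega⟩) ∘ₗ Z.T (n + 1)
        = Z.T n ∘ₗ ((-1 : k) ^ i • Z.d n ⟨i, by omega⟩) := by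
      have := Z.d_succ_comp_t n ⟨i, by omega⟩
      simp only [Fin.succ_mk, Fin.castSucc_mk] at this
      simp only [T, LinearMap.comp_smul, LinearMap.smul_comp, this, smul_smul]
      congr 1
      ring
    rw [pow_succ' (Z.T (n + 1)), Module.End.mul_eq_comp, ← LinearMap.comp_assoc, h1,
      LinearMap.comp_assoc, ih (by omega), pow_succ', Module.End.mul_eq_comp, LinearMap.comp_assoc]

theorem T_pow_comp_N (n i : ℕ) : Z.T n ^ i * Z.N n = Z.N n := by
  induction i with
  | zero => simp
  | succ i ih => rw [pow_succ, mul_assoc, T_mul_N, ih]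

theorem N_comp_T_pow (n i : ℕ) : Z.N n * Z.T n ^ i = Z.N n := by
  induction i with
  | zero => simp
  | succ i ih => rw [pow_succ', ← mul_assoc, N_mul_T, ih]

theorem b'_comp_N (n : ℕ) : Z.b' n ∘ₗ Z.N (n + 1) = Z.N n ∘ₗ Z.b n := by
  have h1 : Z.b' n ∘ₗ Z.N (n + 1) = Z.N n ∘ₗ Z.d n 0 ∘ₗ Z.N (n + 1) := by
    rw [b', finSum_comp]
    conv_rhs => rw [N, finSum_comp, Finset.sum_range]
    refine Finset.sum_congr rfl fun i _ => ?_
    have h := Z.sd_comp_T_pow n i i.2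
    calc _ = ((-1 : k) ^ (i : ℕ) • Z.d n i.castSucc) ∘ₗ (Z.T (n + 1) ^ (i : ℕ) * Z.N (n + 1)) := by
            rw [Z.T_pow_comp_N]
      _ = (((-1 : k) ^ (i : ℕ) • Z.d n i.castSucc) ∘ₗ Z.T (n + 1) ^ (i : ℕ)) ∘ₗ Z.N (n + 1) := rfl
      _ = _ := by
            rw [← LinearMap.comp_assoc, ← h]; rfl
  have h2 : Z.N n ∘ₗ Z.b n = Z.N n ∘ₗ Z.d n 0 ∘ₗ Z.N (n + 1) := by
    have key : ∀ i (hi : i < n + 2), Z.N n ∘ₗ ((-1 : k) ^ i • Z.d n ⟨i, hi⟩)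
        = Z.N n ∘ₗ Z.d n 0 ∘ₗ Z.T (n + 1) ^ (n + 1 + 1 - i) := by
      intro i hi
      rcases Nat.lt_or_ge i (n + 1) with h | h
      · have h3 := Z.sd_comp_T_pow n i h
        have h4 : ((-1 : k) ^ i • Z.d n ⟨i, hi⟩) =
            (Z.T n ^ i) ∘ₗ Z.d n 0 ∘ₗ Z.T (n + 1) ^ (n + 1 + 1 - i) := by
          rw [← LinearMap.comp_assoc, ← h3, LinearMap.comp_assoc, ← Module.End.mul_eq_comp,
            ← pow_add, show i + (n + 1 + 1 - i) = n + 1 + 1 by omega, Z.T_pow]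
          rfl
        rw [h4, ← LinearMap.comp_assoc, ← Module.End.mul_eq_comp, N_comp_T_pow]
      · obtain rfl : i = n + 1 := by omega
        have : n + 1 + 1 - (n + 1) = 1 := by omega
        rw [this, pow_one, T, LinearMap.comp_smul, LinearMap.comp_smul, LinearMap.comp_smul,
          Z.d_zero_comp_t]
        rfl
    rw [b, comp_finSum]
    rw [Finset.sum_congr rfl fun (i : Fin (n + 2)) _ => key (i : ℕ) i.2]
    have h5 : Z.N (n + 1) = ∑ i : Fin (n + 2), Z.T (n + 1) ^ (n + 1 + 1 - (i : ℕ)) := by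
      conv_lhs => rw [← Z.N_mul_T (n + 1), N, Finset.sum_mul]
      rw [← Finset.sum_range_reflect, Finset.sum_range]
      refine Finset.sum_congr rfl fun i _ => ?_
      rw [← pow_succ]
      congr 1
      omega
    rw [h5, comp_finSum, comp_finSum]
  rw [h1, h2]

/-- The degree `m` part of the total complex of the Tsygan double complex, whose entry in column `p`
and row `q` is `X q`. The component with index `q` sits in column `p = m - q`. -/
abbrev Tot (m : ℕ) : Type v := (q : Fin (m + 1)) → Z.X q

/-- The differential of the total complex. The column `p` has the vertical differential `b` if `p` is
even and `-b'` if `p` is odd; the horizontal map from column `p + 1` to column `p` is `1 - T` if `p`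
is even and `N` if `p` is odd. -/
def D (m : ℕ) : Z.Tot (m + 1) →ₗ[k] Z.Tot m := LinearMap.pi fun q =>
  if Even (m - (q : ℕ)) then
    Z.b q ∘ₗ LinearMap.proj q.succ + (1 - Z.T q) ∘ₗ LinearMap.proj q.castSucc
  else
    Z.N q ∘ₗ LinearMap.proj q.castSucc - Z.b' q ∘ₗ LinearMap.proj q.succ

theorem D_comp_D (m : ℕ) : Z.D m ∘ₗ Z.D (m + 1) = 0 := by
  refine LinearMap.ext fun f => funext fun q => ?_
  have hq := q.2
  have hb := fun x => LinearMap.congr_fun (Z.b_comp_b q) x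
  have hb' := fun x => LinearMap.congr_fun (Z.b'_comp_b' q) x
  have h1 := fun x => LinearMap.congr_fun (Z.b_comp_one_sub_T q) x
  have h2 := fun x => LinearMap.congr_fun (Z.b'_comp_N q) x
  have h3 := fun x => LinearMap.congr_fun (Z.N_mul_T q) x
  have h4 := fun x => LinearMap.congr_fun (Z.T_mul_N q) x
  have e1 : m + 1 - ((q.succ : Fin (m + 2)) : ℕ) = m - q := by simp
  have e2 : m + 1 - ((q.castSucc : Fin (m + 2)) : ℕ) = m - q + 1 := by
    rw [Fin.val_castSucc]; omega
  by_cases hp : Even (m - (q : ℕ))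
  · have hp' : ¬ Even (m - (q : ℕ) + 1) := by simpa [Nat.even_add_one] using hp
    have g1 : Z.D m (Z.D (m + 1) f) q
        = Z.b q (Z.D (m + 1) f q.succ) + (1 - Z.T q) (Z.D (m + 1) f q.castSucc) := by
      simp only [D, LinearMap.pi_apply, if_pos hp]; rfl
    have g2 : Z.D (m + 1) f q.succ
        = Z.b (q + 1) (f q.succ.succ) + (1 - Z.T (q + 1)) (f q.succ.castSucc) := by
      simp only [D, LinearMap.pi_apply, e1, if_pos hp]; rfl
    have g3 : Z.D (m + 1) f q.castSucc
        = Z.N q (f q.castSucc.castSucc) - Z.b' q (f q.castSucc.succ) := by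
      simp only [D, LinearMap.pi_apply, e2, if_neg hp']; rfl
    have k1 : Z.b q (Z.b (q + 1) (f q.succ.succ)) = 0 := hb _
    have k2 : Z.b q ((1 - Z.T (q + 1)) (f q.succ.castSucc))
        = (1 - Z.T q) (Z.b' q (f q.castSucc.succ)) := h1 _
    have k3 : (1 - Z.T q) (Z.N q (f q.castSucc.castSucc)) = 0 := by
      have : Z.T q (Z.N q (f q.castSucc.castSucc)) = Z.N q (f q.castSucc.castSucc) := h4 _
      rw [LinearMap.sub_apply, this, Module.End.one_apply, sub_self]
    change Z.D m (Z.D (m + 1) f) q = 0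
    rw [g1, g2, g3, map_add, map_sub, k1, k2, k3]
    abel
  · have hp' : Even (m - (q : ℕ) + 1) := by simpa [Nat.even_add_one] using hp
    have g1 : Z.D m (Z.D (m + 1) f) q
        = Z.N q (Z.D (m + 1) f q.castSucc) - Z.b' q (Z.D (m + 1) f q.succ) := by
      simp only [D, LinearMap.pi_apply, if_neg hp]; rfl
    have g2 : Z.D (m + 1) f q.succ
        = Z.N (q + 1) (f q.succ.castSucc) - Z.b' (q + 1) (f q.succ.succ) := by
      simp only [D, LinearMap.pi_apply, e1, if_neg hp]; rfl
    have g3 : Z.D (m + 1) f q.castSucc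
        = Z.b q (f q.castSucc.succ) + (1 - Z.T q) (f q.castSucc.castSucc) := by
      simp only [D, LinearMap.pi_apply, e2, if_pos hp']; rfl
    have k1 : Z.b' q (Z.b' (q + 1) (f q.succ.succ)) = 0 := hb' _
    have k2 : Z.b' q (Z.N (q + 1) (f q.succ.castSucc)) = Z.N q (Z.b q (f q.castSucc.succ)) := h2 _
    have k3 : Z.N q ((1 - Z.T q) (f q.castSucc.castSucc)) = 0 := by
      have : Z.N q (Z.T q (f q.castSucc.castSucc)) = Z.N q (f q.castSucc.castSucc) := h3 _
      rw [LinearMap.sub_apply, map_sub, this, Module.End.one_apply, sub_self]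
    change Z.D m (Z.D (m + 1) f) q = 0
    rw [g1, g2, g3, map_add, map_sub, k1, k2, k3]
    abel

/-- The total complex of the Tsygan double complex. -/
def totalComplex : ChainComplex (ModuleCat.{v} k) ℕ :=
  ChainComplex.of (fun m => ModuleCat.of k (Z.Tot m)) (fun m => ModuleCat.ofHom (Z.D m))
    fun m => by rw [← ModuleCat.ofHom_comp, D_comp_D]; rfl

/-- Cyclic homology of a cyclic module: the homology of the total complex. -/
def HC (n : ℕ) : ModuleCat.{v} k := Z.totalComplex.homology n

end CyclicModule

section RelativeCyclic

theorem fin_succ_sub_one {n : ℕ} (j : Fin n) : j.succ - 1 = j.castSucc := by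
  rw [sub_eq_iff_eq_add, Fin.coeSucc_eq_succ]

theorem fin_zero_sub_one (n : ℕ) : (0 : Fin (n + 1)) - 1 = Fin.last n := by
  rw [sub_eq_iff_eq_add, Fin.last_add_one]
variable {A : Type*} [Ring A]

variable {k : Type u} [CommRing k] {A : Type v} [Ring A] [Algebra k A]

/-- The tensor power `A ⊗ ⋯ ⊗ A` over `k` with `n + 1` factors. -/
abbrev TPow (k : Type u) [CommRing k] (A : Type v) [Ring A] [Algebra k A] (n : ℕ) : Type (max u v) :=
  ⨂[k] _ : Fin (n + 1), A

/-- Multiply the entries `i` and `i + 1` of a tuple. -/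
def mergeAt {n : ℕ} (i : Fin (n + 1)) (a : Fin (n + 2) → A) : Fin (n + 1) → A := fun j =>
  if j < i then a j.castSucc else if j = i then a j.castSucc * a j.succ else a j.succ

theorem mergeAt_update {n : ℕ} (i : Fin (n + 1)) (a : Fin (n + 2) → A) (l : Fin (n + 2)) :
    ∃ (l' : Fin (n + 1)) (φ : A →ₗ[k] A), ∀ x : A,
      mergeAt i (Function.update a l x) = Function.update (mergeAt i a) l' (φ x) := by
  have hl := l.2
  have hi := i.2
  rcases lt_trichotomy (l : ℕ) i with h | h | h
  · refine ⟨⟨l, by omega⟩, LinearMap.id, fun x => funext fun j => ?_⟩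
    simp only [mergeAt, Function.update_apply, Fin.lt_def, Fin.ext_iff, Fin.val_castSucc, Fin.val_succ]
    split_ifs <;> first | rfl | omega
  · refine ⟨i, LinearMap.mulRight k (a i.succ), fun x => funext fun j => ?_⟩
    simp only [mergeAt, Function.update_apply, Fin.lt_def, Fin.ext_iff, Fin.val_castSucc, Fin.val_succ]
    split_ifs with h1 h2 h3 h4 <;> first | rfl | omega | skip
    obtain rfl : j = i := Fin.ext (by assumption)
    rfl
  · by_cases h' : (l : ℕ) = i + 1
    · refine ⟨i, LinearMap.mulLeft k (a i.castSucc), fun x => funext fun j => ?_⟩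
      simp only [mergeAt, Function.update_apply, Fin.lt_def, Fin.ext_iff, Fin.val_castSucc, Fin.val_succ]
      split_ifs with h1 h2 h3 h4 <;> first | rfl | omega | skip
      obtain rfl : j = i := Fin.ext (by assumption)
      rfl
    · refine ⟨⟨l - 1, by omega⟩, LinearMap.id, fun x => funext fun j => ?_⟩
      simp only [mergeAt, Function.update_apply, Fin.lt_def, Fin.ext_iff, Fin.val_castSucc, Fin.val_succ]
      split_ifs <;> first | rfl | omega

/-- `mergeAt i`, followed by the canonical map to the tensor power, as a multilinear map. -/
def mergeMul {n : ℕ} (i : Fin (n + 1)) : MultilinearMap k (fun _ : Fin (n + 2) => A) (TPow k A n) where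
  toFun a := PiTensorProduct.tprod k (mergeAt i a)
  map_update_add' := by
    intro inst a l x y
    obtain rfl : inst = instDecidableEqFin _ := Subsingleton.elim _ _
    obtain ⟨l', φ, h⟩ := mergeAt_update (k := k) i a l
    rw [h, h, h, map_add, MultilinearMap.map_update_add]
  map_update_smul' := by
    intro inst a l c x
    obtain rfl : inst = instDecidableEqFin _ := Subsingleton.elim _ _
    obtain ⟨l', φ, h⟩ := mergeAt_update (k := k) i a l
    rw [h, h, map_smul, MultilinearMap.map_update_smul]

/-- `a₀ ⊗ ⋯ ⊗ aₙ₊₁ ↦ a₀ ⊗ ⋯ ⊗ aᵢ aᵢ₊₁ ⊗ ⋯ ⊗ aₙ₊₁`. -/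
def tensorMerge {n : ℕ} (i : Fin (n + 1)) : TPow k A (n + 1) →ₗ[k] TPow k A n :=
  PiTensorProduct.lift (mergeMul i)

/-- `a₀ ⊗ ⋯ ⊗ aₙ ↦ aₙ ⊗ a₀ ⊗ ⋯ ⊗ aₙ₋₁`. -/
def tensorRot (n : ℕ) : TPow k A n →ₗ[k] TPow k A n :=
  (PiTensorProduct.reindex k (fun _ => A) (Equiv.addRight (1 : Fin (n + 1)))).toLinearMap

@[simp] theorem tensorMerge_tprod {n : ℕ} (i : Fin (n + 1)) (a : Fin (n + 2) → A) :
    tensorMerge i (PiTensorProduct.tprod k a) = PiTensorProduct.tprod k (mergeAt i a) :=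
  PiTensorProduct.lift.tprod _

@[simp] theorem tensorRot_tprod {n : ℕ} (a : Fin (n + 1) → A) :
    tensorRot n (PiTensorProduct.tprod k a) = PiTensorProduct.tprod k (fun j => a (j - 1)) := by
  simp only [tensorRot, LinearEquiv.coe_coe]
  rw [PiTensorProduct.reindex_tprod]
  simp only [Equiv.addRight_symm, Equiv.coe_addRight, sub_eq_add_neg]

variable (B : Subalgebra k A)

/-- The relations of the cyclic tensor power over `B`: for `b : B` and a slot `i`, the element `b` may
be moved from the right end of the slot before `i` to the left end of slot `i`, where the slot before
the first one is the last one. (Indices are taken in `Fin (n + 1)`, so `j + 1` is cyclic, and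
`Pi.mulSingle i b` is the tuple with `b` at `i` and `1` elsewhere.) The relations with `i ≠ 0` define
`A ⊗_B ⋯ ⊗_B A`, those with `i = 0` its quotient by the commutators with `B`. -/
def cyclicRel (n : ℕ) : Submodule k (TPow k A n) :=
  Submodule.span k {z | ∃ (a : Fin (n + 1) → A) (i : Fin (n + 1)) (b : B),
    z = PiTensorProduct.tprod k (fun j => a j * Pi.mulSingle (M := fun _ => A) i (b : A) (j + 1))
      - PiTensorProduct.tprod k (fun j => Pi.mulSingle (M := fun _ => A) i (b : A) j * a j)}

/-- The cyclic tensor power of `A` over `B` with `n + 1` factors,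
`(A ⊗_B ⋯ ⊗_B A) / [A ⊗_B ⋯ ⊗_B A, B]`. -/
abbrev CyclicTensor (n : ℕ) : Type (max u v) := TPow k A n ⧸ cyclicRel B n

theorem cyclicRel_move (n : ℕ) (a : Fin (n + 1) → A) (β : Fin (n + 1) → B) :
    PiTensorProduct.tprod k (fun j => a j * (β (j + 1) : A))
      - PiTensorProduct.tprod k (fun j => (β j : A) * a j) ∈ cyclicRel B n := by
  classical
  have key : ∀ S : Finset (Fin (n + 1)), ∀ a : Fin (n + 1) → A,
      PiTensorProduct.tprod k (fun j => a j * (if j + 1 ∈ S then (β (j + 1) : A) else 1))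
      - PiTensorProduct.tprod k (fun j => (if j ∈ S then (β j : A) else 1) * a j)
        ∈ cyclicRel B n := by
    intro S
    induction S using Finset.induction_on with
    | empty => intro a; simp
    | insert i S hi ih =>
      intro a
      have e : ∀ j, (if j ∈ insert i S then (β j : A) else 1)
          = (if j ∈ S then (β j : A) else 1) * Pi.mulSingle (M := fun _ => A) i (β i : A) j := by
        intro j
        by_cases hj : j = i
        · subst hj; simp [hi]
        · simp [hj]
      have e' : ∀ j, (if j ∈ insert i S then (β j : A) else 1)
          = Pi.mulSingle (M := fun _ => A) i (β i : A) j * (if j ∈ S then (β j : A) else 1) := by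
        intro j
        by_cases hj : j = i
        · subst hj; simp [hi]
        · simp [hj]
      have r1 : PiTensorProduct.tprod k (fun j =>
            (a j * (if j + 1 ∈ S then (β (j + 1) : A) else 1)) *
              Pi.mulSingle (M := fun _ => A) i (β i : A) (j + 1))
          - PiTensorProduct.tprod k (fun j => Pi.mulSingle (M := fun _ => A) i (β i : A) j *
            (a j * (if j + 1 ∈ S then (β (j + 1) : A) else 1))) ∈ cyclicRel B n :=
        Submodule.subset_span ⟨_, i, β i, rfl⟩
      have r2 := ih (fun j => Pi.mulSingle (M := fun _ => A) i (β i : A) j * a j)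
      have r3 := Submodule.add_mem _ r1 r2
      convert! r3 using 1
      simp only [e]
      simp only [mul_assoc, sub_add_sub_cancel]
      
  simpa using key Finset.univ a

theorem mergeAt_move {n : ℕ} (i : Fin (n + 1)) (a : Fin (n + 2) → A) (β : Fin (n + 2) → B) :
    ∃ (a' : Fin (n + 1) → A) (β' : Fin (n + 1) → B),
      mergeAt i (fun j => a j * (β (j + 1) : A)) = (fun j => a' j * (β' (j + 1) : A)) ∧
      mergeAt i (fun j => (β j : A) * a j) = (fun j => (β' j : A) * a' j) := by
  refine ⟨mergeAt i (fun j => if j = i.succ then (β j : A) * a j else a j),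
    fun j => if j ≤ i then β j.castSucc else β j.succ, funext fun j => ?_, funext fun j => ?_⟩
  · have e1 : j.succ + 1 = if j = Fin.last n then (0 : Fin (n + 2)) else (j + 1).succ := by
      split_ifs with h
      · subst h; rw [Fin.succ_last, Fin.last_add_one]
      · apply Fin.ext
        rw [Fin.val_add_one_of_lt (by simpa [Fin.lt_def] using Fin.val_lt_last h), Fin.val_succ, Fin.val_succ,
          Fin.val_add_one_of_lt (Fin.val_lt_last h)]
    have e2 : ((j + 1 : Fin (n + 1)) : ℕ) = if j = Fin.last n then 0 else (j : ℕ) + 1 := Fin.val_add_one j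
    have hj := j.2
    by_cases hl : j = Fin.last n
    · rw [if_pos hl] at e1 e2
      have e3 : j + 1 = 0 := Fin.ext e2
      have hi := i.2
      have hlv : (j : ℕ) = n := by rw [hl]; rfl
      simp only [mergeAt, Fin.coeSucc_eq_succ, e1, e3, Fin.zero_le, if_true, Fin.castSucc_zero]
      simp only [Fin.lt_def, Fin.ext_iff, Fin.val_castSucc, Fin.val_succ]
      split_ifs <;> first | omega | simp [mul_assoc]
    · rw [if_neg hl] at e1 e2
      have e3 : (j + 1).castSucc = j.succ := Fin.ext (by simp [e2])
      simp only [mergeAt, Fin.coeSucc_eq_succ, e1, e3]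
      simp only [Fin.lt_def, Fin.le_def, Fin.ext_iff, Fin.val_castSucc, Fin.val_succ, e2]
      split_ifs <;> first | omega | simp [mul_assoc]
  · simp only [mergeAt]
    simp only [Fin.lt_def, Fin.le_def, Fin.ext_iff, Fin.val_castSucc, Fin.val_succ]
    split_ifs <;> first | omega | simp [mul_assoc]

theorem tensorMerge_rel {n : ℕ} (i : Fin (n + 1)) :
    cyclicRel B (n + 1) ≤ (cyclicRel B n).comap (tensorMerge i) := by
  refine Submodule.span_le.2 ?_
  rintro _ ⟨a, l, b, rfl⟩
  obtain ⟨a', β', h1, h2⟩ := mergeAt_move B i a (Pi.mulSingle (M := fun _ => B) l b)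
  have e : ∀ j, ((Pi.mulSingle (M := fun _ => B) l b j : B) : A)
      = Pi.mulSingle (M := fun _ => A) l (b : A) j := by
    intro j
    by_cases hj : j = l
    · subst hj; simp
    · simp [hj]
  simp only [e] at h1 h2
  change tensorMerge (k := k) (A := A) i _ ∈ cyclicRel B n
  rw [map_sub, tensorMerge_tprod, tensorMerge_tprod, h1, h2]
  exact cyclicRel_move B n a' β'

theorem tensorRot_rel (n : ℕ) : cyclicRel B n ≤ (cyclicRel B n).comap (tensorRot n) := by
  refine Submodule.span_le.2 ?_
  rintro _ ⟨a, l, b, rfl⟩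
  change tensorRot (k := k) (A := A) n _ ∈ cyclicRel B n
  rw [map_sub, tensorRot_tprod, tensorRot_tprod]
  refine Submodule.subset_span ⟨fun j => a (j - 1), l + 1, b, ?_⟩
  congr 3 <;> funext j
  all_goals
    simp only [Pi.mulSingle_apply]
    congr 1
    simp [sub_eq_iff_eq_add]

/-- The face map which multiplies the entries `i` and `i + 1`. -/
def face (n : ℕ) (i : Fin (n + 1)) : CyclicTensor B (n + 1) →ₗ[k] CyclicTensor B n :=
  Submodule.mapQ _ _ (tensorMerge i) (tensorMerge_rel B i)

/-- The cyclic operator `a₀ ⊗ ⋯ ⊗ aₙ ↦ aₙ ⊗ a₀ ⊗ ⋯ ⊗ aₙ₋₁`. -/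
def rot (n : ℕ) : CyclicTensor B n →ₗ[k] CyclicTensor B n :=
  Submodule.mapQ _ _ (tensorRot n) (tensorRot_rel B n)

theorem mergeAt_mergeAt {n : ℕ} (i j : Fin (n + 1)) (h : i ≤ j) (a : Fin (n + 3) → A) :
    mergeAt i (mergeAt j.succ a) = mergeAt j (mergeAt i.castSucc a) := by
  funext l
  simp only [mergeAt, Fin.lt_def, Fin.ext_iff, Fin.le_def, Fin.val_castSucc, Fin.val_succ] at h ⊢
  have : (l : ℕ) < n + 1 := l.2
  split_ifs <;> first | rfl | omega | simp only [mul_assoc, Fin.succ_castSucc]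

theorem mergeAt_rot {n : ℕ} (i : Fin n) (a : Fin (n + 2) → A) :
    mergeAt i.succ (fun j => a (j - 1)) = fun j => mergeAt i.castSucc a (j - 1) := by
  funext l
  induction l using Fin.cases with
  | zero =>
    have h1 : (0 : Fin (n + 1)) < i.succ := Fin.succ_pos i
    have h2 : ¬ (Fin.last n < i.castSucc) := not_lt.2 (Fin.le_last _)
    have h3 : Fin.last n ≠ i.castSucc := (Fin.castSucc_lt_last i).ne'
    simp only [mergeAt, fin_zero_sub_one, if_pos h1, if_neg h2, if_neg h3, Fin.castSucc_zero,
      Fin.succ_last]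
  | succ l =>
    simp only [mergeAt, fin_succ_sub_one, ← Fin.succ_castSucc, Fin.lt_def, Fin.ext_iff, Fin.val_castSucc,
      Fin.val_succ, Nat.add_lt_add_iff_right, Nat.add_right_cancel_iff]

theorem mergeAt_zero_rot_rot {n : ℕ} (a : Fin (n + 2) → A) :
    mergeAt 0 (fun j => a (j - 1 - 1)) = fun j => mergeAt (Fin.last n) a (j - 1) := by
  funext l
  induction l using Fin.cases with
  | zero =>
    have h : (Fin.succ 0 : Fin (n + 2)) - 1 - 1 = Fin.last (n + 1) := by
      rw [fin_succ_sub_one, Fin.castSucc_zero, fin_zero_sub_one]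
    have h' : (0 : Fin (n + 2)) - 1 - 1 = (Fin.last n).castSucc := by
      rw [fin_zero_sub_one, ← Fin.succ_last, fin_succ_sub_one]
    simp only [mergeAt, fin_zero_sub_one, lt_irrefl, if_false, if_true, Fin.castSucc_zero, h,
      Fin.succ_last]
    rw [← fin_zero_sub_one, h']
  | succ l =>
    simp [mergeAt, fin_succ_sub_one, Fin.castSucc_lt_last]

theorem cyclicTensor_ext {n : ℕ} {M : Type*} [AddCommGroup M] [Module k M]
    {f g : CyclicTensor B n →ₗ[k] M}
    (h : ∀ a : Fin (n + 1) → A, f (Submodule.Quotient.mk (PiTensorProduct.tprod k a))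
      = g (Submodule.Quotient.mk (PiTensorProduct.tprod k a))) : f = g := by
  refine Submodule.linearMap_qext _ (PiTensorProduct.ext (MultilinearMap.ext h))

theorem face_mk {n : ℕ} (i : Fin (n + 1)) (a : Fin (n + 2) → A) :
    face B n i (Submodule.Quotient.mk (PiTensorProduct.tprod k a))
      = Submodule.Quotient.mk (PiTensorProduct.tprod k (mergeAt i a)) := by
  rw [← tensorMerge_tprod]; rfl

theorem rot_mk {n : ℕ} (a : Fin (n + 1) → A) :
    rot B n (Submodule.Quotient.mk (PiTensorProduct.tprod k a))
      = Submodule.Quotient.mk (PiTensorProduct.tprod k (fun j => a (j - 1))) := by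
  rw [← tensorRot_tprod]; rfl

theorem face_face (n : ℕ) (i j : Fin (n + 1)) (h : i ≤ j) :
    face B n i ∘ₗ face B (n + 1) j.succ = face B n j ∘ₗ face B (n + 1) i.castSucc :=
  cyclicTensor_ext B fun a => by
    simp only [LinearMap.comp_apply, face_mk, mergeAt_mergeAt i j h]

theorem face_succ_rot (n : ℕ) (i : Fin n) :
    face B n i.succ ∘ₗ rot B (n + 1) = rot B n ∘ₗ face B n i.castSucc :=
  cyclicTensor_ext B fun a => by
    simp only [LinearMap.comp_apply, face_mk, rot_mk, mergeAt_rot]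

theorem face_zero_rot_rot (n : ℕ) :
    face B n 0 ∘ₗ rot B (n + 1) ∘ₗ rot B (n + 1) = rot B n ∘ₗ face B n (Fin.last n) :=
  cyclicTensor_ext B fun a => by
    simp only [LinearMap.comp_apply, face_mk, rot_mk, mergeAt_zero_rot_rot]

theorem rot_pow (n : ℕ) : rot B n ^ (n + 1) = 1 := by
  have h : ∀ (m : ℕ) (a : Fin (n + 1) → A),
      (rot B n ^ m) (Submodule.Quotient.mk (PiTensorProduct.tprod k a))
        = Submodule.Quotient.mk (PiTensorProduct.tprod k (fun j => a (j - m • 1))) := by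
    intro m
    induction m with
    | zero => intro a; simp
    | succ m ih =>
      intro a
      rw [pow_succ, Module.End.mul_apply, rot_mk, ih]
      congr 3
      funext j
      congr 1
      rw [succ_nsmul, sub_sub]
  refine cyclicTensor_ext B fun a => ?_
  have h1 : (n + 1) • (1 : Fin (n + 1)) = 0 := by
    simpa using card_nsmul_eq_zero' (x := (1 : Fin (n + 1)))
  rw [h, h1]
  simp

/-- All face maps; the last one is `a₀ ⊗ ⋯ ⊗ aₙ₊₁ ↦ aₙ₊₁ a₀ ⊗ a₁ ⊗ ⋯ ⊗ aₙ`. -/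
def relFace (n : ℕ) (i : Fin (n + 2)) : CyclicTensor B (n + 1) →ₗ[k] CyclicTensor B n :=
  Fin.lastCases (face B n 0 ∘ₗ rot B (n + 1)) (fun i => face B n i) i

theorem relFace_last (n : ℕ) : relFace B n (Fin.last (n + 1)) = face B n 0 ∘ₗ rot B (n + 1) :=
  Fin.lastCases_last

theorem relFace_castSucc (n : ℕ) (i : Fin (n + 1)) : relFace B n i.castSucc = face B n i :=
  Fin.lastCases_castSucc _

/-- The cyclic module `Z(A/B)` of an extension of algebras `A/B`. -/
def relativeCyclicModule : CyclicModule.{u, max u v} k where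
  X n := CyclicTensor B n
  d := relFace B
  t := rot B
  d_comp_d n i j hij := by
    induction j using Fin.lastCases with
    | last =>
      rw [Fin.succ_last, relFace_last, relFace_last]
      induction i using Fin.lastCases with
      | last =>
        rw [relFace_last, relFace_castSucc]
        have e1 := face_succ_rot B (n + 1) 0
        have e2 := face_zero_rot_rot B (n + 1)
        have e3 := face_face B n 0 0 le_rfl
        rw [Fin.castSucc_zero] at e1 e3
        rw [LinearMap.comp_assoc, LinearMap.comp_assoc, ← e2]
        calc _ = face B n 0 ∘ₗ (rot B (n + 1) ∘ₗ face B (n + 1) 0) ∘ₗ rot B (n + 2) := rfl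
          _ = (face B n 0 ∘ₗ face B (n + 1) (Fin.succ 0)) ∘ₗ rot B (n + 2) ∘ₗ rot B (n + 2) := by
            rw [← e1]; rfl
          _ = _ := by rw [e3]; rfl
      | cast i =>
        rw [relFace_castSucc, relFace_castSucc]
        have e1 := face_succ_rot B (n + 1) i
        have e3 := face_face B n 0 i (Fin.zero_le _)
        rw [LinearMap.comp_assoc, ← e1, ← LinearMap.comp_assoc, ← LinearMap.comp_assoc, e3]
        rfl
    | cast j =>
      induction i using Fin.lastCases with
      | last => exact absurd hij (by simp)
      | cast i =>
        rw [Fin.succ_castSucc, relFace_castSucc, relFace_castSucc, relFace_castSucc,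
          relFace_castSucc]
        exact face_face B n i j (by simpa using hij)
  d_zero_comp_t n := by
    rw [relFace_last, ← Fin.castSucc_zero, relFace_castSucc]
  d_succ_comp_t n i := by
    rw [relFace_castSucc]
    induction i using Fin.lastCases with
    | last =>
      rw [Fin.succ_last, relFace_last, LinearMap.comp_assoc]
      exact face_zero_rot_rot B n
    | cast i =>
      rw [Fin.succ_castSucc, relFace_castSucc]
      exact face_succ_rot B n i
  t_pow := rot_pow B

/-- The cyclic homology `HC_n(A/B)` of an extension `A/B`. The usual cyclic homology `HC_n(A)` is the
case `B = ⊥`, the extension `A/k`. -/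
def relativeHC (n : ℕ) : ModuleCat.{max u v} k := (relativeCyclicModule B).HC n

end RelativeCyclic

section Groups

variable {G : Type u} [Group G]

/-- The centralizer `G_x` of `x`. -/
abbrev Cent (x : G) : Subgroup G := Subgroup.centralizer {x}

theorem self_mem_cent (x : G) : x ∈ Cent x := Subgroup.mem_centralizer_singleton_iff.2 rfl

/-- The subgroup of `G_x` generated by `x`. -/
def cyc (x : G) : Subgroup (Cent x) := Subgroup.zpowers ⟨x, self_mem_cent x⟩

instance cyc_normal (x : G) : (cyc x).Normal := by
  have hc : cyc x ≤ Subgroup.center (Cent x) :=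
    Subgroup.zpowers_le.2 (Subgroup.mem_center_iff.2 fun g =>
      Subtype.ext (Subgroup.mem_centralizer_singleton_iff.1 g.2))
  refine ⟨fun n hn g => ?_⟩
  rw [Subgroup.mem_center_iff.1 (hc hn) g, mul_inv_cancel_right]
  exact hn

/-- The group `G_x / ⟨x⟩`. -/
abbrev CentBar (x : G) : Type u := Cent x ⧸ cyc x

theorem isTrivial_cyc {k : Type u} [CommRing k] {V : Type v} [AddCommGroup V] [Module k V] (x : G)
    (ρ : Representation k (Cent x) V) (h : ρ ⟨x, self_mem_cent x⟩ = 1) :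
    Representation.IsTrivial (MonoidHom.comp ρ (cyc x).subtype) := by
  have : cyc x ≤ MonoidHom.ker ρ := Subgroup.zpowers_le.2 (MonoidHom.mem_ker.2 h)
  exact ⟨fun g => MonoidHom.mem_ker.1 (this g.2)⟩

/-- The direct sum of all `H_{n - 2i}(G_x / ⟨x⟩, M_x)`, `0 ≤ 2i ≤ n`, where `x` runs through the
representatives `t c` of finite order, and of all `H_n(G_x / ⟨x⟩, M_x)`, where `x` runs through those
of infinite order. -/
abbrev BurgheleaSum {k : Type u} [CommRing k] (t : ConjClasses G → G)
    (M : ∀ x : G, Rep.{u} k (CentBar x)) (n : ℕ) : Type u :=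
  (DirectSum {c : ConjClasses G // IsOfFinOrder (t c)} fun c =>
    DirectSum {i : ℕ // 2 * i ≤ n} fun i => groupHomology (M (t c)) (n - 2 * i)) ×
  (DirectSum {c : ConjClasses G // ¬ IsOfFinOrder (t c)} fun c => groupHomology (M (t c)) n)

end Groups

section StronglyGraded

variable {k : Type u} [CommRing k] {G : Type u} [Group G] {A : Type u} [Ring A] [Algebra k A]

/-- `A` is the direct sum of the subspaces `A_x` and `A_x A_y = A_{xy}` for all `x` and `y`. -/
structure IsStronglyGraded (𝒜 : G → Submodule k A) : Prop where
  iSupIndep : iSupIndep 𝒜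
  iSup_eq_top : ⨆ x, 𝒜 x = ⊤
  mul_eq : ∀ x y, 𝒜 x * 𝒜 y = 𝒜 (x * y)

variable {𝒜 : G → Submodule k A}

theorem IsStronglyGraded.mul_mem (h : IsStronglyGraded 𝒜) {x y z : G} {a b : A} (ha : a ∈ 𝒜 x)
    (hb : b ∈ 𝒜 y) (e : x * y = z) : a * b ∈ 𝒜 z := by
  rw [← e, ← h.mul_eq]; exact Submodule.mul_mem_mul ha hb

theorem IsStronglyGraded.one_mem (h : IsStronglyGraded 𝒜) : (1 : A) ∈ 𝒜 1 := by
  have h1 : (1 : A) ∈ 𝒜 1 ⊔ ⨆ (g : G) (_ : g ≠ 1), 𝒜 g := by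
    rw [← iSup_split_single, h.iSup_eq_top]; trivial
  obtain ⟨e, he, r, hr, her⟩ := Submodule.mem_sup.1 h1
  have key : ∀ g, ∀ a ∈ 𝒜 g, a * r = 0 := by
    intro g a ha
    have m1 : a * r ∈ 𝒜 g := by
      have : a * r = a - a * e := by rw [eq_sub_iff_add_eq, ← mul_add, add_comm, her, mul_one]
      rw [this]
      exact sub_mem ha (h.mul_mem ha he (mul_one g))
    have m2 : a * r ∈ ⨆ (y : G) (_ : y ≠ g), 𝒜 y := by
      have : (⨆ (y : G) (_ : y ≠ 1), 𝒜 y) ≤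
          (⨆ (y : G) (_ : y ≠ g), 𝒜 y).comap (LinearMap.mulLeft k a) := by
        refine iSup₂_le fun y hy b hb => ?_
        exact Submodule.mem_iSup_of_mem (g * y) (Submodule.mem_iSup_of_mem (by simpa using hy)
          (h.mul_mem ha hb rfl))
      exact this hr
    exact Submodule.disjoint_def.1 (h.iSupIndep g) _ m1 m2
  have hr0 : r = 0 := by
    have : (⊤ : Submodule k A) ≤ LinearMap.ker (LinearMap.mulRight k r) := by
      rw [← h.iSup_eq_top]
      exact iSup_le fun g a ha => key g a ha
    simpa using this (Submodule.mem_top (x := (1 : A)))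
  rw [← her, hr0, add_zero]; exact he

/-- The subalgebra `B = A_1`. -/
def IsStronglyGraded.base (h : IsStronglyGraded 𝒜) : Subalgebra k A :=
  (𝒜 1).toSubalgebra h.one_mem fun _ _ ha hb => h.mul_mem ha hb (one_mul 1)

/-- The subspace `[A_x, B]` of `A_x`. -/
def commutators (𝒜 : G → Submodule k A) (x : G) : Submodule k (𝒜 x) :=
  Submodule.span k {m | ∃ (a : 𝒜 x) (b : 𝒜 1), (m : A) = a * b - b * a}

/-- The quotient `A_x / [A_x, B]`. -/
abbrev CompBar (𝒜 : G → Submodule k A) (x : G) : Type u := 𝒜 x ⧸ commutators 𝒜 x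

/-- A presentation `1 = ∑ aᵢ bᵢ` with `aᵢ ∈ A_{g⁻¹}` and `bᵢ ∈ A_g`. The element `∑ aᵢ ⊗_B bᵢ` is the
preimage of `1 ⊗ g` under the Galois map `A ⊗_B A → A ⊗ kG`, `a ⊗ b ↦ ∑ a b_y ⊗ y`. -/
structure UnitDecomp (𝒜 : G → Submodule k A) (g : G) where
  ι : Type
  [fintype : Fintype ι]
  a : ι → A
  b : ι → A
  a_mem : ∀ i, a i ∈ 𝒜 g⁻¹
  b_mem : ∀ i, b i ∈ 𝒜 g
  sum_eq : ∑ i, a i * b i = 1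

attribute [instance] UnitDecomp.fintype

theorem IsStronglyGraded.nonempty_unitDecomp (h : IsStronglyGraded 𝒜) (g : G) :
    Nonempty (UnitDecomp 𝒜 g) := by
  have key : ∀ z ∈ 𝒜 g⁻¹ * 𝒜 g, ∃ (ι : Type) (_ : Fintype ι) (a b : ι → A),
      (∀ i, a i ∈ 𝒜 g⁻¹) ∧ (∀ i, b i ∈ 𝒜 g) ∧ ∑ i, a i * b i = z := by
    intro z hz
    induction hz using Submodule.mul_induction_on' with
    | mem_mul_mem a ha b hb =>
      exact ⟨Unit, inferInstance, fun _ => a, fun _ => b, fun _ => ha, fun _ => hb, by simp⟩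
    | add y _ z _ hy hz =>
      obtain ⟨ι, _, a, b, ha, hb, e⟩ := hy
      obtain ⟨ι', _, a', b', ha', hb', e'⟩ := hz
      refine ⟨ι ⊕ ι', inferInstance, Sum.elim a a', Sum.elim b b', ?_, ?_, ?_⟩
      · rintro (i | i); exacts [ha i, ha' i]
      · rintro (i | i); exacts [hb i, hb' i]
      · simp [e, e']
  obtain ⟨ι, _, a, b, ha, hb, e⟩ := key 1 (by
    rw [h.mul_eq, inv_mul_cancel]; exact h.one_mem)
  exact ⟨⟨ι, a, b, ha, hb, e⟩⟩

namespace UnitDecomp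

variable {g : G}

/-- `m ↦ ∑ bᵢ m aᵢ`. -/
def conj (u : UnitDecomp 𝒜 g) : A →ₗ[k] A :=
  ∑ i, LinearMap.mulLeft k (u.b i) ∘ₗ LinearMap.mulRight k (u.a i)

theorem conj_apply (u : UnitDecomp 𝒜 g) (m : A) : u.conj m = ∑ i, u.b i * (m * u.a i) := by
  simp [conj]

theorem conj_mem (h : IsStronglyGraded 𝒜) (u : UnitDecomp 𝒜 g) {x y : G} (e : g * x * g⁻¹ = y)
    {m : A} (hm : m ∈ 𝒜 x) : u.conj m ∈ 𝒜 y := by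
  rw [conj_apply]
  exact sum_mem fun i _ => h.mul_mem (u.b_mem i) (h.mul_mem hm (u.a_mem i) rfl)
    (by rw [← e, mul_assoc])

/-- `conj` on `A_x`, for `g` commuting with `x`. -/
def conjAt (h : IsStronglyGraded 𝒜) (u : UnitDecomp 𝒜 g) {x : G} (e : g * x * g⁻¹ = x) :
    𝒜 x →ₗ[k] 𝒜 x := u.conj.restrict fun _ hm => u.conj_mem h e hm

theorem conj_move (h : IsStronglyGraded 𝒜) (u w : UnitDecomp 𝒜 g) {x : G}
    (e : g * x * g⁻¹ = x) (m : 𝒜 x) (c : 𝒜 1) (p q : 𝒜 x) (hp : (p : A) = w.conj (m * c))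
    (hq : (q : A) = u.conj (c * m)) : p - q ∈ commutators 𝒜 x := by
  have mem1 : ∀ i j, w.b j * ((m : A) * u.a i) ∈ 𝒜 x := fun i j =>
    h.mul_mem (w.b_mem j) (h.mul_mem m.2 (u.a_mem i) rfl) (by rw [← mul_assoc, e])
  have mem2 : ∀ i j, u.b i * ((c : A) * w.a j) ∈ 𝒜 1 := fun i j =>
    h.mul_mem (u.b_mem i) (h.mul_mem c.2 (w.a_mem j) rfl) (by simp)
  have hpq : p - q = ∑ i, ∑ j, (⟨_, sub_mem (h.mul_mem (mem1 i j) (mem2 i j) (mul_one x))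
      (h.mul_mem (mem2 i j) (mem1 i j) (one_mul x))⟩ : 𝒜 x) := by
    apply Subtype.ext
    simp only [Submodule.coe_sub, Submodule.coe_sum, Finset.sum_sub_distrib, hp, hq]
    congr 1
    · rw [conj_apply, Finset.sum_comm]
      refine Finset.sum_congr rfl fun j _ => ?_
      calc w.b j * ((m : A) * c * w.a j) = w.b j * m * 1 * (c * w.a j) := by simp [mul_assoc]
        _ = _ := by
          rw [← u.sum_eq, Finset.mul_sum, Finset.sum_mul]
          exact Finset.sum_congr rfl fun i _ => by simp [mul_assoc]
    · rw [conj_apply]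
      refine Finset.sum_congr rfl fun i _ => ?_
      calc u.b i * ((c : A) * m * u.a i) = u.b i * c * 1 * (m * u.a i) := by simp [mul_assoc]
        _ = _ := by
          rw [← w.sum_eq, Finset.mul_sum, Finset.sum_mul]
          exact Finset.sum_congr rfl fun i _ => by simp [mul_assoc]
  rw [hpq]
  exact sum_mem fun i _ => sum_mem fun j _ =>
    Submodule.subset_span ⟨⟨_, mem1 i j⟩, ⟨_, mem2 i j⟩, rfl⟩

/-- The endomorphism of `A_x / [A_x, B]` induced by `m ↦ ∑ bᵢ m aᵢ`; it does not depend on the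
presentation of `1`, see `act_eq`. -/
def act (h : IsStronglyGraded 𝒜) (u : UnitDecomp 𝒜 g) {x : G} (e : g * x * g⁻¹ = x) :
    CompBar 𝒜 x →ₗ[k] CompBar 𝒜 x :=
  Submodule.mapQ _ _ (u.conjAt h e) <| by
    refine Submodule.span_le.2 ?_
    rintro m ⟨a, c, hm⟩
    have := u.conj_move h u e a c (u.conjAt h e ⟨a * c, h.mul_mem a.2 c.2 (mul_one x)⟩)
      (u.conjAt h e ⟨c * a, h.mul_mem c.2 a.2 (one_mul x)⟩) rfl rfl
    rw [← map_sub] at this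
    have e' : m = ⟨a * c, h.mul_mem a.2 c.2 (mul_one x)⟩ - ⟨c * a, h.mul_mem c.2 a.2 (one_mul x)⟩ :=
      Subtype.ext hm
    rw [e']
    exact this

theorem act_mk (h : IsStronglyGraded 𝒜) (u : UnitDecomp 𝒜 g) {x : G} (e : g * x * g⁻¹ = x)
    (m : 𝒜 x) : u.act h e (Submodule.Quotient.mk m) = Submodule.Quotient.mk (u.conjAt h e m) :=
  rfl

theorem act_eq (h : IsStronglyGraded 𝒜) (u w : UnitDecomp 𝒜 g) {x : G} (e : g * x * g⁻¹ = x) :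
    u.act h e = w.act h e := by
  refine Submodule.linearMap_qext _ (LinearMap.ext fun m => ?_)
  refine (Submodule.Quotient.eq _).2 ?_
  refine w.conj_move h u e m ⟨1, h.one_mem⟩ _ _ ?_ ?_
  · change u.conj m = u.conj (m * 1); rw [mul_one]
  · change w.conj m = w.conj (1 * m); rw [one_mul]

/-- The presentation `1 = 1 * 1` for `g = 1`. -/
def one (h : IsStronglyGraded 𝒜) : UnitDecomp 𝒜 (1 : G) where
  ι := Unit
  a _ := 1
  b _ := 1
  a_mem _ := by rw [inv_one]; exact h.one_mem
  b_mem _ := h.one_mem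
  sum_eq := by simp

/-- The presentation of `1` for `g g'` obtained from those for `g` and `g'`. -/
def mul (h : IsStronglyGraded 𝒜) {g' : G} (u : UnitDecomp 𝒜 g) (w : UnitDecomp 𝒜 g') :
    UnitDecomp 𝒜 (g * g') where
  ι := w.ι × u.ι
  a p := w.a p.1 * u.a p.2
  b p := u.b p.2 * w.b p.1
  a_mem p := h.mul_mem (w.a_mem p.1) (u.a_mem p.2) (by simp)
  b_mem p := h.mul_mem (u.b_mem p.2) (w.b_mem p.1) rfl
  sum_eq := by
    rw [Fintype.sum_prod_type, ← w.sum_eq]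
    refine Finset.sum_congr rfl fun j _ => ?_
    calc _ = ∑ i, w.a j * (u.a i * u.b i) * w.b j :=
          Finset.sum_congr rfl fun i _ => by simp [mul_assoc]
      _ = _ := by rw [← Finset.sum_mul, ← Finset.mul_sum, u.sum_eq, mul_one]

theorem conj_one (h : IsStronglyGraded 𝒜) (m : A) : (one h).conj m = m := by
  rw [conj_apply]
  exact (Fintype.sum_unique (fun _ : Unit => (1 : A) * (m * 1))).trans (by simp)

theorem conj_mul (h : IsStronglyGraded 𝒜) {g' : G} (u : UnitDecomp 𝒜 g) (w : UnitDecomp 𝒜 g')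
    (m : A) : (mul h u w).conj m = u.conj (w.conj m) := by
  rw [conj_apply]
  refine (Fintype.sum_prod_type_right
    (fun p : w.ι × u.ι => u.b p.2 * w.b p.1 * (m * (w.a p.1 * u.a p.2)))).trans ?_
  rw [conj_apply, conj_apply]
  refine Finset.sum_congr rfl fun i _ => ?_
  rw [Finset.sum_mul, Finset.mul_sum]
  exact Finset.sum_congr rfl fun j _ => by simp [mul_assoc]

end UnitDecomp

theorem cent_conj {x : G} (g : Cent x) : (g : G) * x * (g : G)⁻¹ = x :=
  mul_inv_eq_iff_eq_mul.2 (Subgroup.mem_centralizer_singleton_iff.1 g.2)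

/-- The action of `G_x` on `A_x / [A_x, B]` induced by the Ulbrich-Miyashita action,
`g · [m] = [∑ bᵢ m aᵢ]` for any presentation `1 = ∑ aᵢ bᵢ` with `aᵢ ∈ A_{g⁻¹}` and `bᵢ ∈ A_g`. -/
def IsStronglyGraded.action (h : IsStronglyGraded 𝒜) (x : G) :
    Representation k (Cent x) (CompBar 𝒜 x) where
  toFun g := (h.nonempty_unitDecomp (g : G)).some.act h (cent_conj g)
  map_one' := by
    rw [UnitDecomp.act_eq h _ (UnitDecomp.one h)]
    refine Submodule.linearMap_qext _ (LinearMap.ext fun m => ?_)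
    refine congrArg Submodule.Quotient.mk (Subtype.ext ?_)
    exact UnitDecomp.conj_one h m
  map_mul' g g' := by
    rw [UnitDecomp.act_eq h _ (UnitDecomp.mul h (h.nonempty_unitDecomp (g : G)).some
      (h.nonempty_unitDecomp (g' : G)).some)]
    refine Submodule.linearMap_qext _ (LinearMap.ext fun m => ?_)
    refine congrArg Submodule.Quotient.mk (Subtype.ext ?_)
    exact UnitDecomp.conj_mul h _ _ m

theorem IsStronglyGraded.action_self (h : IsStronglyGraded 𝒜) (x : G) :
    h.action x ⟨x, self_mem_cent x⟩ = 1 := by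
  refine Submodule.linearMap_qext _ (LinearMap.ext fun m => ?_)
  refine (Submodule.Quotient.eq _).2 ?_
  let u := (h.nonempty_unitDecomp x).some
  have mem : ∀ i, (m : A) * u.a i ∈ 𝒜 1 := fun i => h.mul_mem m.2 (u.a_mem i) (mul_inv_cancel x)
  have e : u.conjAt h (cent_conj (⟨x, self_mem_cent x⟩ : Cent x)) m - m =
      ∑ i, (⟨_, sub_mem (h.mul_mem (u.b_mem i) (mem i) (mul_one x))
        (h.mul_mem (mem i) (u.b_mem i) (one_mul x))⟩ : 𝒜 x) := by
    apply Subtype.ext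
    simp only [Submodule.coe_sub, Submodule.coe_sum, Finset.sum_sub_distrib]
    congr 1
    · exact u.conj_apply _
    · simp only [mul_assoc]
      rw [← Finset.mul_sum, u.sum_eq, mul_one]
  refine (congrArg (· ∈ commutators 𝒜 x) e).mpr ?_
  exact sum_mem fun i _ => Submodule.subset_span ⟨⟨_, u.b_mem i⟩, ⟨_, mem i⟩, rfl⟩

/-- `A_x / [A_x, B]` as a representation of `G_x / ⟨x⟩`. -/
def IsStronglyGraded.rep (h : IsStronglyGraded 𝒜) (x : G) : Rep.{u} k (CentBar x) :=
  haveI := isTrivial_cyc x (h.action x) (h.action_self x)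
  Rep.of ((h.action x).ofQuotient (cyc x))

end StronglyGraded

section SmashProduct

variable (k : Type u) [CommRing k] {G : Type u} [Group G] (B : Type u) [Ring B] [Algebra k B]
  [MulSemiringAction G B] [SMulCommClass G k B]

/-- The subalgebra `B` of the smash product `B # kG`, that is, the elements `b e_1`. -/
def smashBase : Subalgebra k (SkewMonoidAlgebra B G) where
  toSubsemiring := (SkewMonoidAlgebra.singleOneRingHom (k := B) (G := G)).rangeS
  algebraMap_mem' c := ⟨algebraMap k B c, rfl⟩

/-- The subspace `[B, B]_x` spanned by all `b b' - b' (x • b)`. -/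
def twistedCommutators (x : G) : Submodule k B :=
  Submodule.span k {m | ∃ b b' : B, m = b * b' - b' * (x • b)}

/-- The action of `G_x` on `B / [B, B]_x` induced by the action of `G` on `B`. -/
def twistedAction (x : G) : Representation k (Cent x) (B ⧸ twistedCommutators k B x) where
  toFun g := Submodule.mapQ _ _ (DistribSMul.toLinearMap k B (g : G)) <| by
    refine Submodule.span_le.2 ?_
    rintro _ ⟨b, b', rfl⟩
    refine Submodule.subset_span ⟨(g : G) • b, (g : G) • b', ?_⟩
    change (g : G) • (b * b' - b' * x • b) = _
    rw [smul_sub, smul_mul', smul_mul', smul_smul, smul_smul,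
      Subgroup.mem_centralizer_singleton_iff.1 g.2]
  map_one' := by
    refine Submodule.linearMap_qext _ (LinearMap.ext fun m => ?_)
    exact congrArg Submodule.Quotient.mk (one_smul G m)
  map_mul' g g' := by
    refine Submodule.linearMap_qext _ (LinearMap.ext fun m => ?_)
    exact congrArg Submodule.Quotient.mk (mul_smul (g : G) (g' : G) m)

theorem twistedAction_self (x : G) : twistedAction k B x ⟨x, self_mem_cent x⟩ = 1 := by
  refine Submodule.linearMap_qext _ (LinearMap.ext fun m => ?_)
  refine ((Submodule.Quotient.eq _).2 ?_).symm
  exact Submodule.subset_span ⟨m, 1, by simp⟩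

/-- `B / [B, B]_x` as a representation of `G_x / ⟨x⟩`. -/
def twistedRep (x : G) : Rep.{u} k (CentBar x) :=
  haveI := isTrivial_cyc x (twistedAction k B x) (twistedAction_self k B x)
  Rep.of ((twistedAction k B x).ofQuotient (cyc x))

end SmashProduct

/-- `B` is a separable `k`-algebra: the multiplication `B ⊗ B → B` has a section which is a morphism
of `(B, B)`-bimodules. -/
def IsSeparableAlgebra (k : Type u) [CommRing k] (B : Type v) [Ring B] [Algebra k B] : Prop :=
  ∃ s : B →ₗ[k] B ⊗[k] B, LinearMap.mul' k B ∘ₗ s = LinearMap.id ∧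
    ∀ b x c : B, s (b * x * c) =
      TensorProduct.map (LinearMap.mulLeft k b) (LinearMap.mulRight k c) (s x)

end RelCyclic

end

/-! The cyclic module `Z(A/B)` splits along the conjugacy classes of `G`, and each piece consists of
the coinvariants of a simplicial resolution. A cyclic tensor of homogeneous elements of degrees `g₀,
…, gₙ` is determined by the class of its product in `A/[A,B]`: strong grading lets `split` invert
multiplication, so the part of multidegree `g` is `A_p/[A_p,B]` with `p = g₀⋯gₙ`. A tuple `g` whose
product is conjugate to `x` is the list of steps of a path from `x⁻¹yₙ` through `y₀, …, yₙ`, and `y`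
is unique up to left translation by `G_x` (`exists_loopSteps_eq`, `exists_cent_of_loopSteps_eq`).
Transporting `A_p` to `A_x` by the Ulbrich-Miyashita action of `yₙ` identifies `Z_n(A/B)` with the
sum over `x` of the `G_x`-coinvariants of `A_x/[A_x,B] ⊗ k[G^{n+1}]` (`sumTensor_bijective`). Faces
delete vertices, and the cyclic operator becomes `(y₀,…,yₙ) ↦ (x⁻¹yₙ,y₀,…,yₙ₋₁)`; the identity
`c·[ac] = [ca]` for homogeneous `c` (`baseRep_mk_mul`) is what matches the two rotations.

On `k[G^{n+1}]` this rotation is only paracyclic: its power `n + 1` is the action of `x⁻¹`. Dividing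
by `⟨x⟩` gives a cyclic module `W` with projective terms over `G_x/⟨x⟩`, because `G_x` acts freely
on `G`. If `x` has infinite order, `1 - T` is injective on simplices (`eq_zero_of_simplexT_eq`);
together with the exactness of the rows in characteristic `0` this makes the total complex of `W` a
projective resolution of `k`, and cyclic homology of the piece is a single group homology module. If
`x` has finite order, averaging over `⟨x⟩` shows that already the Hochschild complex of `W` is a
projective resolution, and the identity is equivariantly homotopic to a chain map invariant under
`T` (`invariantMap`). The latter breaks the Connes sequence into short exact sequences `0 → HH_{n+2}
→ HC_{n+2} → HC_n → 0` (`mapI_injective`, `mapI_mapS_exact`, `mapS_surjective`), whence the sum over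
`i`.

If `B` is separable, a separability idempotent yields a homotopy on the Hochschild complex of `A`
from the identity to an endomorphism `retract`, whose kernel is that of `Z(A/k) → Z(A/B)`. So this
kernel has exact columns, and `HC(A)` agrees with `HC(A/B)`. The smash product is strongly graded by
the components `B e_x`, and `B/[B,B]_x` is isomorphic to `A_x/[A_x,B]` equivariantly. -/

noncomputable section

universe w

namespace RelCyclic

open CategoryTheory
open scoped TensorProduct DirectSum

/-! ### Homology of chain complexes as cycles modulo boundaries. -/

section LinearComplex

variable {k : Type u} [CommRing k]
variable {X : ℕ → Type v} [∀ n, AddCommGroup (X n)] [∀ n, Module k (X n)]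
variable {Y : ℕ → Type w} [∀ n, AddCommGroup (Y n)] [∀ n, Module k (Y n)]

/-- The differential out of degree `n` of a chain complex of modules, with the zero map out of
degree `0`. -/
def dFrom (d : ∀ n, X (n + 1) →ₗ[k] X n) : ∀ n, X n →ₗ[k] X (n - 1)
  | 0 => 0
  | n + 1 => d n

/-- The homology in degree `n` of a sequence of linear maps: cycles modulo boundaries. -/
abbrev LinHomology (d : ∀ n, X (n + 1) →ₗ[k] X n) (n : ℕ) : Type v :=
  LinearMap.ker (dFrom d n) ⧸ (LinearMap.range (d n)).submoduleOf (LinearMap.ker (dFrom d n))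

variable {d : ∀ n, X (n + 1) →ₗ[k] X n} {d' : ∀ n, Y (n + 1) →ₗ[k] Y n}

/-- The homology class of a cycle. -/
def LinHomology.mk {n : ℕ} (z : X n) (hz : dFrom d n z = 0) : LinHomology d n :=
  Submodule.Quotient.mk ⟨z, hz⟩

theorem LinHomology.mk_surj {n : ℕ} (x : LinHomology d n) : ∃ z hz, LinHomology.mk z hz = x := by
  obtain ⟨⟨z, hz⟩, rfl⟩ := Submodule.Quotient.mk_surjective _ x
  exact ⟨z, hz, rfl⟩

theorem LinHomology.mk_eq_zero {n : ℕ} {z : X n} {hz : dFrom d n z = 0} :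
    LinHomology.mk z hz = 0 ↔ ∃ w, d n w = z := by
  exact Submodule.Quotient.mk_eq_zero _

theorem LinHomology.mk_eq_mk {n : ℕ} {z z' : X n} {hz : dFrom d n z = 0}
    {hz' : dFrom d n z' = 0} :
    LinHomology.mk z hz = LinHomology.mk z' hz' ↔ ∃ w, d n w = z - z' := by
  exact Submodule.Quotient.eq _

theorem dFrom_comm (f : ∀ n, X n →ₗ[k] Y n) (hf : ∀ n x, d' n (f (n + 1) x) = f n (d n x)) (n : ℕ)
    (x : X n) : dFrom d' n (f n x) = f (n - 1) (dFrom d n x) := by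
  cases n with
  | zero => simp [dFrom]
  | succ n => exact hf n x

/-- The map induced on homology by a map which preserves cycles and boundaries. -/
def LinHomology.mapOf {n m : ℕ} (f : X n →ₗ[k] Y m)
    (h₁ : ∀ z, dFrom d n z = 0 → dFrom d' m (f z) = 0) (h₂ : ∀ w, ∃ w', d' m w' = f (d n w)) :
    LinHomology d n →ₗ[k] LinHomology d' m :=
  Submodule.mapQ _ _ (f.restrict h₁) <| by
    rintro ⟨z, hz⟩ ⟨w, hw⟩
    obtain ⟨w', hw'⟩ := h₂ w
    exact ⟨w', hw'.trans (congrArg f hw)⟩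

/-- The map induced on homology by a chain map. -/
def LinHomology.map (f : ∀ n, X n →ₗ[k] Y n) (hf : ∀ n x, d' n (f (n + 1) x) = f n (d n x))
    (n : ℕ) : LinHomology d n →ₗ[k] LinHomology d' n :=
  LinHomology.mapOf (f n) (fun z hz => by rw [dFrom_comm f hf, hz, map_zero])
    fun w => ⟨f (n + 1) w, hf n w⟩

theorem LinHomology.map_mk (f : ∀ n, X n →ₗ[k] Y n)
    (hf : ∀ n x, d' n (f (n + 1) x) = f n (d n x)) {n : ℕ} (z : X n) (hz : dFrom d n z = 0) :
    LinHomology.map f hf n (LinHomology.mk z hz) =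
      LinHomology.mk (f n z) (by rw [dFrom_comm f hf, hz, map_zero]) := rfl

/-- A chain map which is injective and surjective on the level of classes induces an isomorphism
on homology. -/
theorem LinHomology.nonempty_equiv (f : ∀ n, X n →ₗ[k] Y n)
    (hf : ∀ n x, d' n (f (n + 1) x) = f n (d n x)) (n : ℕ)
    (inj : ∀ z, dFrom d n z = 0 → (∃ w, d' n w = f n z) → ∃ w, d n w = z)
    (surj : ∀ z, dFrom d' n z = 0 → ∃ z', dFrom d n z' = 0 ∧ ∃ w, d' n w = f n z' - z) :
    Nonempty (LinHomology d n ≃ₗ[k] LinHomology d' n) := by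
  refine ⟨LinearEquiv.ofBijective (LinHomology.map f hf n) ⟨?_, ?_⟩⟩
  · refine (injective_iff_map_eq_zero _).2 fun x hx => ?_
    obtain ⟨z, hz, rfl⟩ := LinHomology.mk_surj x
    rw [LinHomology.map_mk, LinHomology.mk_eq_zero] at hx
    exact LinHomology.mk_eq_zero.2 (inj z hz hx)
  · intro y
    obtain ⟨z, hz, rfl⟩ := LinHomology.mk_surj y
    obtain ⟨z', hz', h⟩ := surj z hz
    exact ⟨LinHomology.mk z' hz', LinHomology.mk_eq_mk.2 h⟩

theorem LinHomology.nonempty_equiv_of_bijective (f : ∀ n, X n →ₗ[k] Y n)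
    (hf : ∀ n x, d' n (f (n + 1) x) = f n (d n x)) (hb : ∀ n, Function.Bijective (f n)) (n : ℕ) :
    Nonempty (LinHomology d n ≃ₗ[k] LinHomology d' n) := by
  refine LinHomology.nonempty_equiv f hf n ?_ ?_
  · rintro z hz ⟨w, hw⟩
    obtain ⟨v, rfl⟩ := (hb _).2 w
    exact ⟨v, (hb n).1 ((hf n v).symm.trans hw)⟩
  · intro z hz
    obtain ⟨v, rfl⟩ := (hb _).2 z
    rw [dFrom_comm f hf] at hz
    exact ⟨v, (hb _).1 (hz.trans (map_zero _).symm), 0, by simp⟩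

/-- The homology of a chain complex of modules in terms of cycles and boundaries. -/
theorem nonempty_homology_equiv (C : ChainComplex (ModuleCat.{v} k) ℕ) (n : ℕ) :
    Nonempty (C.homology n ≃ₗ[k] LinHomology (X := fun n => C.X n) (fun n => (C.d (n + 1) n).hom) n) := by
  have hn : (ComplexShape.down ℕ).next n = n - 1 := by
    cases n with
    | zero => simp
    | succ n => simp
  have hp : (ComplexShape.down ℕ).prev n = n + 1 := by simp
  let S := C.sc' (n + 1) n (n - 1)
  have e := (C.homologyIsoSc' (n + 1) n (n - 1) hp hn ≪≫ S.moduleCatHomologyIso).toLinearEquiv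
  -- For `n = 0` truncated subtraction makes `S.g` the component of the differential from degree `0`
  -- to itself, which vanishes by the shape of the complex, as `dFrom` does by definition.
  have hk : LinearMap.ker S.g.hom = LinearMap.ker (dFrom (X := fun n => C.X n) (fun n => (C.d (n + 1) n).hom) n) := by
    cases n with
    | zero =>
      have : S.g = 0 := C.shape _ _ (by simp)
      rw [this]; rfl
    | succ n => rfl
  refine ⟨e.trans (Submodule.Quotient.equiv _ _ (LinearEquiv.ofEq _ _ hk) ?_)⟩
  ext ⟨z, hz⟩
  constructor
  · rintro ⟨_, ⟨w, rfl⟩, hy⟩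
    exact ⟨w, congrArg Subtype.val hy⟩
  · rintro ⟨w, hw⟩
    exact ⟨_, ⟨w, rfl⟩, Subtype.ext hw⟩

theorem nonempty_homology_of_equiv {X : ℕ → ModuleCat.{v} k} {d : ∀ n, X (n + 1) ⟶ X n}
    (h : ∀ n, d (n + 1) ≫ d n = 0) (n : ℕ) :
    Nonempty ((ChainComplex.of X d h).homology n ≃ₗ[k] LinHomology (X := fun n => X n) (fun n => (d n).hom) n) := by
  obtain ⟨e⟩ := nonempty_homology_equiv (ChainComplex.of X d h) n
  have : (fun n => ((ChainComplex.of X d h).d (n + 1) n).hom) = fun n => (d n).hom :=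
    funext fun n => congrArg _ (ChainComplex.of_d X d n)
  rw [this] at e
  exact ⟨e⟩

theorem CyclicModule.nonempty_HC_equiv (Z : CyclicModule.{u, v} k) (n : ℕ) :
    Nonempty (Z.HC n ≃ₗ[k] LinHomology Z.D n) :=
  nonempty_homology_of_equiv (X := fun m => ModuleCat.of k (Z.Tot m))
    (d := fun m => ModuleCat.ofHom (Z.D m))
    (fun m => by rw [← ModuleCat.ofHom_comp, Z.D_comp_D]; rfl) n

end LinearComplex

/-! ### Chains of the Tsygan total complex, row by row. -/

namespace CyclicModule

section Chains

variable {k : Type u} [CommRing k] (Z : CyclicModule.{u, v} k)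

/-- The chain of the total complex with the given entries. -/
def tot (m : ℕ) : (∀ q, Z.X q) →ₗ[k] Z.Tot m where
  toFun z := fun q => z q
  map_add' _ _ := rfl
  map_smul' _ _ := rfl

/-- Entries above row `m` are ignored by `tot m`, so a chain can be handled as a family indexed by
all rows, without dependent indices in `Fin (m + 1)`. The lift pads with zeros. -/
theorem tot_surjective (m : ℕ) : Function.Surjective (Z.tot m) := fun f =>
  ⟨fun q => if h : q < m + 1 then f ⟨q, h⟩ else 0, funext fun q => dif_pos q.2⟩

theorem tot_eq_tot {m : ℕ} {z z' : ∀ q, Z.X q} :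
    Z.tot m z = Z.tot m z' ↔ ∀ p q, p + q = m → z q = z' q := by
  constructor
  · intro h p q hpq
    exact congrFun h ⟨q, by omega⟩
  · intro h
    funext q
    exact h (m - q) q (by omega)

/-- The component of the differential of the total complex in column `p` and row `q`. -/
def dComp (p q : ℕ) : (∀ q, Z.X q) →ₗ[k] Z.X q :=
  if Even p then Z.b q ∘ₗ LinearMap.proj (q + 1) + (1 - Z.T q) ∘ₗ LinearMap.proj q
  else Z.N q ∘ₗ LinearMap.proj q - Z.b' q ∘ₗ LinearMap.proj (q + 1)

variable {Z}

theorem dComp_even {p : ℕ} (hp : Even p) (q : ℕ) (z : ∀ q, Z.X q) :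
    Z.dComp p q z = Z.b q (z (q + 1)) + (1 - Z.T q) (z q) := by
  rw [dComp, if_pos hp]; rfl

theorem dComp_odd {p : ℕ} (hp : ¬ Even p) (q : ℕ) (z : ∀ q, Z.X q) :
    Z.dComp p q z = Z.N q (z q) - Z.b' q (z (q + 1)) := by
  rw [dComp, if_neg hp]; rfl

/-- Locality of the differential: changing a chain in row `q` affects only the components in rows
`q` and `q - 1`. This is what allows boundaries to be corrected one entry at a time. -/
theorem dComp_congr (p q : ℕ) {z z' : ∀ q, Z.X q} (h : z q = z' q) (h' : z (q + 1) = z' (q + 1)) :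
    Z.dComp p q z = Z.dComp p q z' := by
  by_cases hp : Even p
  · rw [dComp_even hp, dComp_even hp, h, h']
  · rw [dComp_odd hp, dComp_odd hp, h, h']

theorem D_tot (m : ℕ) (z : ∀ q, Z.X q) :
    Z.D m (Z.tot (m + 1) z) = Z.tot m fun q => Z.dComp (m - q) q z := by
  funext q
  change Z.D m (Z.tot (m + 1) z) q = Z.dComp (m - q) q z
  by_cases hp : Even (m - (q : ℕ))
  · rw [dComp_even hp]; simp only [D, LinearMap.pi_apply, if_pos hp]; rfl
  · rw [dComp_odd hp]; simp only [D, LinearMap.pi_apply, if_neg hp]; rfl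

/-- The condition `p + q + 1 = m` is void for `m = 0`, in agreement with the zero map out of degree
`0`. -/
theorem dFrom_tot {m : ℕ} {z : ∀ q, Z.X q} :
    dFrom Z.D m (Z.tot m z) = 0 ↔ ∀ p q, p + q + 1 = m → Z.dComp p q z = 0 := by
  cases m with
  | zero => simp [dFrom]
  | succ m =>
    change Z.D m (Z.tot (m + 1) z) = 0 ↔ _
    rw [D_tot, ← map_zero (Z.tot m), tot_eq_tot]
    constructor
    · intro h p q hpq
      have := h p q (by omega)
      rwa [show m - q = p by omega] at this
    · intro h p q hpq
      have := h p q (by omega)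
      rwa [show m - q = p by omega]

theorem D_tot_eq {m : ℕ} {w z : ∀ q, Z.X q} :
    Z.D m (Z.tot (m + 1) w) = Z.tot m z ↔ ∀ p q, p + q = m → Z.dComp p q w = z q := by
  rw [D_tot, tot_eq_tot]
  refine forall₃_congr fun p q hpq => ?_
  rw [show m - q = p by omega]

theorem exists_D_eq {m : ℕ} {z : ∀ q, Z.X q} :
    (∃ w, Z.D m w = Z.tot m z) ↔ ∃ w : ∀ q, Z.X q, ∀ p q, p + q = m → Z.dComp p q w = z q := by
  constructor
  · rintro ⟨w, hw⟩
    obtain ⟨w, rfl⟩ := Z.tot_surjective _ w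
    exact ⟨w, D_tot_eq.1 hw⟩
  · rintro ⟨w, hw⟩
    exact ⟨_, D_tot_eq.2 hw⟩

/-- This is `D² = 0` for families. The truncated `m - q'` is harmless, since only the rows `q` and
`q + 1`, both at most `m`, are read. -/
theorem dComp_dComp (p q m : ℕ) (h : p + q + 1 = m) (w : ∀ q, Z.X q) :
    Z.dComp p q (fun q' => Z.dComp (m - q') q' w) = 0 := by
  subst h
  have := LinearMap.congr_fun (Z.D_comp_D (p + q)) (Z.tot _ w)
  rw [LinearMap.comp_apply, D_tot, D_tot, LinearMap.zero_apply, ← map_zero (Z.tot _),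
    tot_eq_tot] at this
  have := this p q rfl
  rwa [Nat.add_sub_cancel] at this

end Chains

/-! ### Exactness of the total complex from exact rows or exact columns. -/

section Rows

variable {k : Type u} [Field k] [CharZero k] {Z : CyclicModule.{u, v} k}

/-- On invariant elements the norm is multiplication by `n + 1`, which is invertible in
characteristic `0`. -/
theorem exists_N_eq (n : ℕ) (y : Z.X n) (h : (1 - Z.T n) y = 0) : ∃ v, Z.N n v = y := by
  have h' : Z.T n y = y := by
    rw [LinearMap.sub_apply, Module.End.one_apply, sub_eq_zero] at h; exact h.symm
  have hj : ∀ j, (Z.T n ^ j) y = y := fun j => by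
    induction j with
    | zero => simp
    | succ j ih => rw [pow_succ, Module.End.mul_apply, h', ih]
  have hn : ((n : k) + 1) ≠ 0 := by exact_mod_cast Nat.succ_ne_zero n
  refine ⟨((n : k) + 1)⁻¹ • y, ?_⟩
  rw [map_smul, N, LinearMap.sum_apply, Finset.sum_congr rfl fun j _ => hj j, Finset.sum_const,
    Finset.card_range, ← Nat.cast_smul_eq_nsmul k, smul_smul]
  push_cast
  rw [inv_mul_cancel₀ hn, one_smul]

/-- Summing `(1 - T)(1 + ⋯ + T^{j-1}) = 1 - T^j` over `0 ≤ j ≤ n` gives `(n + 1) - N`; on the kernel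
of `N` this is multiplication by `n + 1`. -/
theorem exists_one_sub_T_eq (n : ℕ) (y : Z.X n) (h : Z.N n y = 0) :
    ∃ v, (1 - Z.T n) v = y := by
  have hn : ((n : k) + 1) ≠ 0 := by exact_mod_cast Nat.succ_ne_zero n
  refine ⟨((n : k) + 1)⁻¹ • (∑ j ∈ Finset.range (n + 1), ∑ i ∈ Finset.range j, Z.T n ^ i) y, ?_⟩
  have e : (1 - Z.T n) * (∑ j ∈ Finset.range (n + 1), ∑ i ∈ Finset.range j, Z.T n ^ i)
      = ((n + 1 : ℕ) : Module.End k (Z.X n)) - Z.N n := by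
    rw [Finset.mul_sum, N, Finset.sum_congr rfl fun j _ => mul_neg_geom_sum (Z.T n) j,
      Finset.sum_sub_distrib]
    simp
  rw [map_smul, ← Module.End.mul_apply, e, LinearMap.sub_apply, h, sub_zero]
  rw [Module.End.natCast_apply, ← Nat.cast_smul_eq_nsmul k, smul_smul]
  push_cast
  rw [inv_mul_cancel₀ hn, one_smul]

/-- In characteristic `0`, a cycle of the total complex with vanishing entry in column `0` is a
boundary. -/
theorem exists_boundary_of_column_zero {m : ℕ} {z : ∀ q, Z.X q} (hm : z m = 0)
    (hz : ∀ p q, p + q + 1 = m → Z.dComp p q z = 0) :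
    ∃ w : ∀ q, Z.X q, ∀ p q, p + q = m → Z.dComp p q w = z q := by
  -- Induction on columns: `w` already has the right boundary in the columns `0, …, i`.
  have key : ∀ i ≤ m, ∃ w : ∀ q, Z.X q, ∀ p q, p + q = m → p ≤ i → Z.dComp p q w = z q := by
    intro i
    induction i with
    | zero =>
      refine fun _ => ⟨0, fun p q hpq hp => ?_⟩
      obtain rfl : p = 0 := by omega
      obtain rfl : q = m := by omega
      rw [map_zero, hm]
    | succ i ih =>
      intro hi
      obtain ⟨w, hw⟩ := ih (by omega)
      obtain ⟨q, rfl⟩ : ∃ q, m = i + 1 + q := ⟨m - (i + 1), by omega⟩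
      set r : ∀ q, Z.X q := fun q' => z q' - Z.dComp (i + 1 + q - q') q' w with hr
      have hr1 : r (q + 1) = 0 := by
        have := hw i (q + 1) (by omega) le_rfl
        simp only [hr]
        rw [show i + 1 + q - (q + 1) = i by omega, this, sub_self]
      have hr2 : Z.dComp i q r = 0 := by
        have e : r = z - fun q' => Z.dComp (i + 1 + q - q') q' w := rfl
        rw [e, map_sub, hz i q (by omega), dComp_dComp i q _ (by omega), sub_zero]
      have hrq : r q = z q - Z.dComp (i + 1) q w := by
        simp only [hr]; rw [show i + 1 + q - q = i + 1 by omega]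
      -- The residue `r` is a cycle at `(i, q)` and vanishes in column `i`, so the horizontal map
      -- into column `i` kills `r q`. Exactness of the row supplies `v` in column `i + 2`, with `N`
      -- and `1 - T` alternating according to the parity of `i`.
      have hv : ∃ v : Z.X q, ∀ w' : ∀ q, Z.X q, w' (q + 1) = w (q + 1) → w' q = w q + v →
          Z.dComp (i + 1) q w' = Z.dComp (i + 1) q w + r q := by
        by_cases hpi : Even i
        · rw [dComp_even hpi, hr1, map_zero, zero_add] at hr2
          obtain ⟨v, hv⟩ := exists_N_eq q _ hr2
          refine ⟨v, fun w' h1 h2 => ?_⟩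
          have hpi' : ¬ Even (i + 1) := by simpa [Nat.even_add_one] using hpi
          rw [dComp_odd hpi', dComp_odd hpi', h1, h2, map_add, hv]; abel
        · rw [dComp_odd hpi, hr1, map_zero, sub_zero] at hr2
          obtain ⟨v, hv⟩ := exists_one_sub_T_eq q _ hr2
          refine ⟨v, fun w' h1 h2 => ?_⟩
          have hpi' : Even (i + 1) := by simpa [Nat.even_add_one] using hpi
          rw [dComp_even hpi', dComp_even hpi', h1, h2, map_add, hv]; abel
      obtain ⟨v, hv⟩ := hv
      -- Row `q` of `w` lies in column `i + 2`. Besides the component in column `i + 1`, its change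
      -- is felt only in column `i + 2`, which has not been treated yet.
      refine ⟨Function.update w q (w q + v), fun p q' hpq hp => ?_⟩
      rcases Nat.lt_or_ge i p with h | h
      · obtain rfl : p = i + 1 := by omega
        obtain rfl : q' = q := by omega
        rw [hv _ (Function.update_of_ne (by omega) _ _) (Function.update_self ..), hrq]; abel
      · rw [← hw p q' hpq h]
        exact dComp_congr p q' (Function.update_of_ne (by omega) _ _)
          (Function.update_of_ne (by omega) _ _)
  obtain ⟨w, hw⟩ := key m le_rfl
  exact ⟨w, fun p q hpq => hw p q hpq (by omega)⟩

end Rows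

section Columns

variable {k : Type u} [CommRing k] {Z : CyclicModule.{u, v} k}

/-- If the columns of the Tsygan double complex are exact on a stable family of submodules, then so
is the total complex. -/
theorem exists_boundary_of_columns (U : ∀ q, Submodule k (Z.X q))
    (hU : ∀ p q (w : ∀ q, Z.X q), (∀ q, w q ∈ U q) → Z.dComp p q w ∈ U q)
    (hb : ∀ n x, x ∈ U n → dFrom Z.b n x = 0 → ∃ v ∈ U (n + 1), Z.b n v = x)
    (hb' : ∀ n x, x ∈ U n → dFrom Z.b' n x = 0 → ∃ v ∈ U (n + 1), Z.b' n v = x)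
    {m : ℕ} {z : ∀ q, Z.X q} (hzU : ∀ q, z q ∈ U q)
    (hz : ∀ p q, p + q + 1 = m → Z.dComp p q z = 0) :
    ∃ w : ∀ q, Z.X q, (∀ q, w q ∈ U q) ∧ ∀ p q, p + q = m → Z.dComp p q w = z q := by
  -- Induction on rows: `w` already has the right boundary in all rows below `j`. The residue `r`
  -- then vanishes just below row `j`, so the vertical differential kills `r j`, and exactness of
  -- the column yields a correction in row `j + 1`.
  have key : ∀ j ≤ m + 1, ∃ w : ∀ q, Z.X q, (∀ q, w q ∈ U q) ∧
      ∀ p q, p + q = m → q < j → Z.dComp p q w = z q := by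
    intro j
    induction j with
    | zero => exact fun _ => ⟨0, fun q => zero_mem _, fun p q hpq hp => absurd hp (by omega)⟩
    | succ j ih =>
      intro hj
      obtain ⟨w, hwU, hw⟩ := ih (by omega)
      obtain ⟨p, rfl⟩ : ∃ p, m = p + j := ⟨m - j, by omega⟩
      set r : ∀ q, Z.X q := fun q' => z q' - Z.dComp (p + j - q') q' w with hr
      have hrj : r j = z j - Z.dComp p j w := by
        simp only [hr]; rw [show p + j - j = p by omega]
      have hrU : r j ∈ U j := by rw [hrj]; exact sub_mem (hzU j) (hU _ _ _ hwU)
      have hr2 : ∀ j', j = j' + 1 → Z.dComp p j' r = 0 ∧ r j' = 0 := by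
        rintro j' rfl
        constructor
        · have e : r = z - fun q' => Z.dComp (p + (j' + 1) - q') q' w := rfl
          rw [e, map_sub, hz p j' (by omega), dComp_dComp p j' _ (by omega), sub_zero]
        · have := hw (p + 1) j' (by omega) (by omega)
          simp only [hr]
          rw [show p + (j' + 1) - j' = p + 1 by omega, this, sub_self]
      have hv : ∃ v ∈ U (j + 1), ∀ w' : ∀ q, Z.X q, w' (j + 1) = w (j + 1) + v → w' j = w j →
          Z.dComp p j w' = Z.dComp p j w + r j := by
        by_cases hpi : Even p
        · obtain ⟨v, hvU, hv⟩ := hb j (r j) hrU (by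
            cases j with
            | zero => rfl
            | succ j =>
              obtain ⟨h1, h2⟩ := hr2 j rfl
              rw [dComp_even hpi, h2, map_zero, add_zero] at h1
              exact h1)
          refine ⟨v, hvU, fun w' h1 h2 => ?_⟩
          rw [dComp_even hpi, dComp_even hpi, h1, h2, map_add, hv]; abel
        · obtain ⟨v, hvU, hv⟩ := hb' j (r j) hrU (by
            cases j with
            | zero => rfl
            | succ j =>
              obtain ⟨h1, h2⟩ := hr2 j rfl
              rw [dComp_odd hpi, h2, map_zero, zero_sub, neg_eq_zero] at h1
              exact h1)
          -- Odd columns carry the differential `-b'`, hence the sign.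
          refine ⟨-v, neg_mem hvU, fun w' h1 h2 => ?_⟩
          rw [dComp_odd hpi, dComp_odd hpi, h1, h2, map_add, map_neg, hv]; abel
      obtain ⟨v, hvU, hv⟩ := hv
      refine ⟨Function.update w (j + 1) (w (j + 1) + v), fun q => ?_, fun p' q' hpq hq => ?_⟩
      · by_cases hq : q = j + 1
        · subst hq; rw [Function.update_self]; exact add_mem (hwU _) hvU
        · rw [Function.update_of_ne hq]; exact hwU q
      rcases Nat.lt_or_ge q' j with h | h
      · rw [← hw p' q' hpq h]
        exact dComp_congr p' q' (Function.update_of_ne (by omega) _ _)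
          (Function.update_of_ne (by omega) _ _)
      · obtain rfl : q' = j := by omega
        obtain rfl : p' = p := by omega
        rw [hv _ (Function.update_self ..) (Function.update_of_ne (by omega) _ _), hrj]; abel
  obtain ⟨w, hwU, hw⟩ := key (m + 1) le_rfl
  exact ⟨w, hwU, fun p q hpq => hw p q hpq (by omega)⟩

end Columns

end CyclicModule

/-! ### Recognizing and rearranging direct sums. -/

section DirectSums

variable {k : Type u} [CommRing k] {ι : Type v}

/-- A module with a complete system of injections and projections is a direct sum. -/
theorem nonempty_directSum_equiv {N : ι → Type w} [∀ c, AddCommGroup (N c)] [∀ c, Module k (N c)]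
    {M : Type*} [AddCommGroup M] [Module k M] (i : ∀ c, N c →ₗ[k] M) (p : ∀ c, M →ₗ[k] N c)
    (hs : ∀ c x, p c (i c x) = x) (ho : ∀ c c' x, c ≠ c' → p c' (i c x) = 0)
    (hg : ∀ y, ∃ S : Finset ι, y = ∑ c ∈ S, i c (p c y)) :
    Nonempty ((⨁ c, N c) ≃ₗ[k] M) := by
  classical
  refine ⟨LinearEquiv.ofBijective (DirectSum.toModule k ι M i) ⟨?_, ?_⟩⟩
  · have key : ∀ x c, p c (DirectSum.toModule k ι M i x) = x c := by
      intro x c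
      induction x using DirectSum.induction_on with
      | zero => simp
      | of c' x =>
        change p c (DirectSum.toModule k ι M i (DirectSum.lof k ι N c' x)) = _
        rw [DirectSum.toModule_lof]
        by_cases h : c' = c
        · subst h; rw [hs, DirectSum.of_eq_same]
        · rw [ho _ _ _ h, DirectSum.of_eq_of_ne _ _ _ (Ne.symm h)]
      | add x y hx hy => rw [map_add, map_add, hx, hy, DirectSum.add_apply]
    intro x y hxy
    refine DFinsupp.ext fun c => ?_
    exact (key x c).symm.trans ((congrArg _ hxy).trans (key y c))
  · intro y
    obtain ⟨S, hS⟩ := hg y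
    refine ⟨∑ c ∈ S, DirectSum.lof k ι N c (p c y), ?_⟩
    rw [map_sum]
    conv_rhs => rw [hS]
    exact Finset.sum_congr rfl fun c _ => DirectSum.toModule_lof ..

/-- A direct sum splits according to a predicate on the index set. -/
theorem nonempty_directSum_split (P : ι → Prop) (N : ι → Type w) [∀ c, AddCommGroup (N c)]
    [∀ c, Module k (N c)] :
    Nonempty ((⨁ c, N c) ≃ₗ[k] (⨁ c : {c // P c}, N c) × (⨁ c : {c // ¬ P c}, N c)) := by
  classical
  let N' := fun c : {c // P c} => N c
  let N'' := fun c : {c // ¬ P c} => N c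
  refine nonempty_directSum_equiv
    (fun c => if h : P c then LinearMap.inl k _ _ ∘ₗ DirectSum.lof k _ N' ⟨c, h⟩
      else LinearMap.inr k _ _ ∘ₗ DirectSum.lof k _ N'' ⟨c, h⟩)
    (fun c => if h : P c then DirectSum.component k _ N' ⟨c, h⟩ ∘ₗ LinearMap.fst k _ _
      else DirectSum.component k _ N'' ⟨c, h⟩ ∘ₗ LinearMap.snd k _ _) ?_ ?_ ?_
  · intro c x
    by_cases h : P c
    · simp only [dif_pos h]; exact DirectSum.component.lof_self k (M := N') ⟨c, h⟩ x
    · simp only [dif_neg h]; exact DirectSum.component.lof_self k (M := N'') ⟨c, h⟩ x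
  · intro c c' x hc
    by_cases h : P c <;> by_cases h' : P c' <;>
      simp only [dif_pos, dif_neg, h, h', LinearMap.comp_apply, not_false_eq_true]
    · have : (⟨c, h⟩ : {c // P c}) ≠ ⟨c', h'⟩ := fun e => hc (congrArg Subtype.val e)
      simp [DirectSum.component.of, this]
    · simp
    · simp
    · have : (⟨c, h⟩ : {c // ¬ P c}) ≠ ⟨c', h'⟩ := fun e => hc (congrArg Subtype.val e)
      simp [DirectSum.component.of, this]
  · rintro ⟨y, y'⟩
    refine ⟨(DFinsupp.support y).map ⟨_, Subtype.val_injective⟩ ∪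
      (DFinsupp.support y').map ⟨_, Subtype.val_injective⟩, ?_⟩
    rw [Finset.sum_union (Finset.disjoint_left.2 fun c hc hc' => by
      obtain ⟨a, _, rfl⟩ := Finset.mem_map.1 hc
      obtain ⟨b, _, e⟩ := Finset.mem_map.1 hc'
      exact b.2 ((show (b : ι) = a from e) ▸ a.2)), Finset.sum_map, Finset.sum_map]
    have e1 : ∀ a : {c // P c}, P ((⟨_, Subtype.val_injective⟩ : {c // P c} ↪ ι) a) := fun a => a.2
    have e2 : ∀ a : {c // ¬ P c}, ¬ P ((⟨_, Subtype.val_injective⟩ : {c // ¬ P c} ↪ ι) a) :=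
      fun a => a.2
    simp only [dif_pos (e1 _), dif_neg (e2 _)]
    refine Prod.ext ?_ ?_
    · rw [Prod.fst_add, Prod.fst_sum, Prod.fst_sum]
      refine Eq.trans ?_ (congrArg₂ (· + ·) rfl (Finset.sum_eq_zero fun c _ => rfl)).symm
      rw [add_zero]
      exact (DFinsupp.sum_single (f := y)).symm
    · rw [Prod.snd_add, Prod.snd_sum, Prod.snd_sum]
      refine Eq.trans ?_ (congrArg₂ (· + ·) (Finset.sum_eq_zero fun c _ => rfl) rfl).symm
      rw [zero_add]
      exact (DFinsupp.sum_single (f := y')).symm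

theorem lof_default_bijective [Unique ι] [DecidableEq ι] (N : ι → Type w)
    [∀ c, AddCommGroup (N c)] [∀ c, Module k (N c)] :
    Function.Bijective (DirectSum.lof k ι N default) := by
  refine ⟨DirectSum.of_injective _, fun y => ?_⟩
  induction y using DirectSum.induction_on with
  | zero => exact ⟨0, map_zero _⟩
  | of c x => obtain rfl := Unique.eq_default c; exact ⟨x, rfl⟩
  | add x y hx hy =>
    obtain ⟨x, rfl⟩ := hx
    obtain ⟨y, rfl⟩ := hy
    exact ⟨x + y, map_add _ _ _⟩

/-- The direct sum over `2i ≤ n + 2` splits off the summand with `i = 0`. -/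
theorem nonempty_directSum_succ_equiv (H : ℕ → Type v) [∀ n, AddCommGroup (H n)]
    [∀ n, Module k (H n)] (n : ℕ) :
    Nonempty ((⨁ i : {i : ℕ // 2 * i ≤ n + 2}, H (n + 2 - 2 * i)) ≃ₗ[k]
      H (n + 2) × ⨁ i : {i : ℕ // 2 * i ≤ n}, H (n - 2 * i)) := by
  classical
  let e : {i : ℕ // 2 * i ≤ n + 2} ≃ Option {i : ℕ // 2 * i ≤ n} :=
    { toFun := fun i => if h : i.1 = 0 then none else some ⟨i.1 - 1, by have := i.2; omega⟩
      invFun := fun o => o.elim ⟨0, by omega⟩ fun i => ⟨i.1 + 1, by have := i.2; omega⟩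
      left_inv := by
        rintro ⟨i, hi⟩
        by_cases h : i = 0
        · subst h; rfl
        · simp only [dif_neg h]; exact Subtype.ext (Nat.sub_add_cancel (Nat.pos_of_ne_zero h))
      right_inv := by
        rintro (_ | i)
        · rfl
        · exact dif_neg (Nat.succ_ne_zero _) }
  -- The degrees `n + 2 - 2(i + 1)` and `n - 2i` agree only propositionally, so the isomorphism is
  -- obtained by replacing the whole degree function at once.
  have cast : ∀ f g : {i : ℕ // 2 * i ≤ n} → ℕ, f = g →
      Nonempty ((⨁ i, H (f i)) ≃ₗ[k] ⨁ i, H (g i)) := by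
    rintro f _ rfl
    exact ⟨LinearEquiv.refl _ _⟩
  obtain ⟨c⟩ := cast (fun i => n + 2 - 2 * (i.1 + 1)) (fun i => n - 2 * i.1)
    (funext fun i => by omega)
  have e₁ := DirectSum.lequivCongrLeft k e
    (M := fun i : {i : ℕ // 2 * i ≤ n + 2} => H (n + 2 - 2 * i))
  have e₂ := DirectSum.lequivProdDirectSum k
    (α := fun o : Option {i : ℕ // 2 * i ≤ n} => H (n + 2 - 2 * (e.symm o).1))
  exact ⟨e₁.trans (e₂.trans (LinearEquiv.prodCongr (LinearEquiv.refl _ _) c))⟩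

end DirectSums

/-! ### Morphisms of cyclic modules and their effect on cyclic homology. -/

namespace CyclicModule

variable {k : Type u} [CommRing k]

/-- A morphism of cyclic modules. -/
structure Hom (Z : CyclicModule.{u, v} k) (Z' : CyclicModule.{u, w} k) where
  f : ∀ n, Z.X n →ₗ[k] Z'.X n
  map_d : ∀ n i x, f n (Z.d n i x) = Z'.d n i (f (n + 1) x)
  map_t : ∀ n x, f n (Z.t n x) = Z'.t n (f n x)

namespace Hom

variable {Z : CyclicModule.{u, v} k} {Z' : CyclicModule.{u, w} k} (φ : Hom Z Z')

theorem map_b (n : ℕ) (x : Z.X (n + 1)) : φ.f n (Z.b n x) = Z'.b n (φ.f (n + 1) x) := by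
  simp [b, LinearMap.sum_apply, map_sum, φ.map_d]

theorem map_b' (n : ℕ) (x : Z.X (n + 1)) : φ.f n (Z.b' n x) = Z'.b' n (φ.f (n + 1) x) := by
  simp [b', LinearMap.sum_apply, map_sum, φ.map_d]

theorem map_T (n : ℕ) (x : Z.X n) : φ.f n (Z.T n x) = Z'.T n (φ.f n x) := by
  simp [T, φ.map_t]

theorem map_N (n : ℕ) (x : Z.X n) : φ.f n (Z.N n x) = Z'.N n (φ.f n x) := by
  have h : ∀ j, φ.f n ((Z.T n ^ j) x) = (Z'.T n ^ j) (φ.f n x) := fun j => by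
    induction j with
    | zero => simp
    | succ j ih => rw [pow_succ', Module.End.mul_apply, map_T, ih, pow_succ', Module.End.mul_apply]
  simp [N, LinearMap.sum_apply, map_sum, h]

theorem map_dComp (p q : ℕ) (z : ∀ q, Z.X q) :
    φ.f q (Z.dComp p q z) = Z'.dComp p q (fun q => φ.f q (z q)) := by
  by_cases hp : Even p
  · rw [dComp_even hp, dComp_even hp, map_add, map_b, LinearMap.sub_apply, map_sub, map_T]; rfl
  · rw [dComp_odd hp, dComp_odd hp, map_sub, map_b', map_N]

/-- The induced map of total complexes. -/
def tot (m : ℕ) : Z.Tot m →ₗ[k] Z'.Tot m :=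
  LinearMap.pi fun q => φ.f q ∘ₗ LinearMap.proj q

theorem tot_tot (m : ℕ) (z : ∀ q, Z.X q) :
    φ.tot m (Z.tot m z) = Z'.tot m (fun q => φ.f q (z q)) := rfl

theorem D_tot (m : ℕ) (z : Z.Tot (m + 1)) : Z'.D m (φ.tot (m + 1) z) = φ.tot m (Z.D m z) := by
  obtain ⟨z, rfl⟩ := Z.tot_surjective _ z
  rw [tot_tot, CyclicModule.D_tot, CyclicModule.D_tot, tot_tot]
  simp only [map_dComp]

/-- A surjective morphism of cyclic modules whose kernel has exact columns induces an isomorphism of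
cyclic homology. -/
theorem nonempty_equiv_of_surjective (hs : ∀ n, Function.Surjective (φ.f n))
    (hb : ∀ n x, φ.f n x = 0 → dFrom Z.b n x = 0 → ∃ v, φ.f (n + 1) v = 0 ∧ Z.b n v = x)
    (hb' : ∀ n x, φ.f n x = 0 → dFrom Z.b' n x = 0 → ∃ v, φ.f (n + 1) v = 0 ∧ Z.b' n v = x)
    (n : ℕ) : Nonempty (LinHomology Z.D n ≃ₗ[k] LinHomology Z'.D n) := by
  have exact {m : ℕ} {z : ∀ q, Z.X q} (hzU : ∀ q, φ.f q (z q) = 0)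
      (hz : ∀ p q, p + q + 1 = m → Z.dComp p q z = 0) :=
    exists_boundary_of_columns (fun q => LinearMap.ker (φ.f q)) (fun p q w hw => by
      rw [LinearMap.mem_ker, map_dComp]
      have : (fun q => φ.f q (w q)) = 0 := funext hw
      rw [this, map_zero]) hb hb' hzU hz
  -- Set-theoretic lifts suffice: they need not be linear or commute with the differentials, as all
  -- defects lie in the kernel, where the total complex is exact.
  choose g hg using hs
  refine LinHomology.nonempty_equiv φ.tot φ.D_tot n ?_ ?_
  · intro z hz
    obtain ⟨z, rfl⟩ := Z.tot_surjective _ z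
    rw [tot_tot, exists_D_eq, exists_D_eq]
    rintro ⟨w, hw⟩
    rw [dFrom_tot] at hz
    let w₁ : ∀ q, Z.X q := fun q => g q (w q)
    -- The difference of `z` and the boundary of the lift `w₁` lies in the kernel of `φ` in the rows
    -- `q ≤ n` only. The other rows do not belong to the chain and are set to `0`, because exactness
    -- is stated for families lying in the kernel everywhere.
    let z₁ : ∀ q, Z.X q := fun q => if q ≤ n then z q - Z.dComp (n - q) q w₁ else 0
    have hz₁ : ∀ q ≤ n, z₁ q = z q - Z.dComp (n - q) q w₁ := fun q hq => if_pos hq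
    obtain ⟨v, hv, hv'⟩ := exact (m := n) (z := z₁) (fun q => by
        by_cases hq : q ≤ n
        · rw [hz₁ q hq, map_sub, map_dComp]
          simp only [w₁, hg, hw (n - q) q (by omega), sub_self]
        · simp only [z₁, if_neg hq, map_zero]) (fun p q hpq => by
        rw [dComp_congr p q (z' := z - fun q => Z.dComp (n - q) q w₁) (hz₁ q (by omega))
          (hz₁ (q + 1) (by omega)), map_sub, hz p q hpq, dComp_dComp p q _ hpq, sub_zero])
    refine ⟨v + w₁, fun p q hpq => ?_⟩
    rw [map_add, hv' p q hpq, hz₁ q (by omega), show n - q = p by omega]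
    abel
  · intro z' hz'
    obtain ⟨z', rfl⟩ := Z'.tot_surjective _ z'
    rw [dFrom_tot] at hz'
    let z : ∀ q, Z.X q := fun q => g q (z' q)
    have hzz : ∀ q, φ.f q (z q) = z' q := fun q => hg q _
    have hzz' : (fun q => φ.f q (z q)) = z' := funext hzz
    cases n with
    | zero =>
      refine ⟨Z.tot _ z, rfl, 0, ?_⟩
      rw [tot_tot, hzz', map_zero, sub_self]
    | succ n =>
      -- The boundary of the lift `z` is a cycle in the kernel of `φ`, hence the boundary of some
      -- `w` in the kernel; `z - w` is then a cycle over `z'`.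
      let y : ∀ q, Z.X q := fun q => if q ≤ n then Z.dComp (n - q) q z else 0
      have hy : ∀ q ≤ n, y q = Z.dComp (n - q) q z := fun q hq => if_pos hq
      obtain ⟨w, hw, hw'⟩ := exact (m := n) (z := y) (fun q => by
        by_cases hq : q ≤ n
        · rw [hy q hq, map_dComp, hzz']
          exact hz' (n - q) q (by omega)
        · simp only [y, if_neg hq, map_zero]) (fun p q hpq => by
        rw [dComp_congr p q (z' := fun q => Z.dComp (n - q) q z) (hy q (by omega))
          (hy (q + 1) (by omega)), dComp_dComp p q _ hpq])
      refine ⟨Z.tot _ (z - w), dFrom_tot.2 fun p q hpq => ?_, 0, ?_⟩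
      · rw [map_sub, hw' p q (by omega), hy q (by omega), show n - q = p by omega, sub_self]
      · rw [tot_tot, map_zero, eq_comm, sub_eq_zero]
        congr 1
        funext q
        rw [Pi.sub_apply, map_sub, hw, sub_zero, hzz]

end Hom

/-- The cyclic homology of a direct sum of cyclic modules. -/
theorem nonempty_directSum_homology_equiv {ι : Type*} [DecidableEq ι] {Z : CyclicModule.{u, w} k}
    (X : ι → CyclicModule.{u, v} k) (φ : ∀ c, Hom (X c) Z)
    (h : ∀ n, Function.Bijective (DirectSum.toModule k ι (Z.X n) fun c => (φ c).f n)) (n : ℕ) :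
    Nonempty ((⨁ c, LinHomology (X c).D n) ≃ₗ[k] LinHomology Z.D n) := by
  -- The finite index set in the last clause may be enlarged at will, since one set must later serve
  -- all rows of a chain.
  obtain ⟨pr, hs, ho, hg⟩ : ∃ pr : ∀ n c, Z.X n →ₗ[k] (X c).X n,
      (∀ n c x, pr n c ((φ c).f n x) = x) ∧
      (∀ n c c' x, c ≠ c' → pr n c' ((φ c).f n x) = 0) ∧
      ∀ n y, ∃ S : Finset ι, ∀ S', S ⊆ S' → y = ∑ c ∈ S', (φ c).f n (pr n c y) := by
    classical
    let e := fun n => LinearEquiv.ofBijective (DirectSum.toModule k ι (Z.X n) fun c => (φ c).f n) (h n)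
    have he : ∀ n c x, (e n).symm ((φ c).f n x) = DirectSum.lof k ι (fun c => (X c).X n) c x := by
      intro n c x
      rw [LinearEquiv.symm_apply_eq]
      exact (DirectSum.toModule_lof (φ := fun c => (φ c).f n) k c x).symm
    refine ⟨fun n c => DirectSum.component k ι (fun c => (X c).X n) c ∘ₗ (e n).symm.toLinearMap,
      fun n c x => ?_, fun n c c' x hc => ?_, fun n y => ?_⟩
    · simp only [LinearMap.comp_apply, LinearEquiv.coe_coe, he]
      exact DirectSum.component.lof_self k (M := fun c => (X c).X n) c x
    · simp only [LinearMap.comp_apply, LinearEquiv.coe_coe, he]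
      rw [DirectSum.component.of, dif_neg hc]
    · refine ⟨DFinsupp.support ((e n).symm y), fun S' hS => ?_⟩
      rw [← Finset.sum_subset hS fun c _ hc => by
        have : ((e n).symm y) c = 0 := by simpa using hc
        rw [LinearMap.comp_apply, LinearEquiv.coe_coe]
        exact (congrArg _ this).trans (map_zero _)]
      conv_lhs => rw [← (e n).apply_symm_apply y, ← DFinsupp.sum_single (f := (e n).symm y)]
      rw [DFinsupp.sum, map_sum]
      exact Finset.sum_congr rfl fun c _ =>
        DirectSum.toModule_lof (φ := fun c => (φ c).f n) k c _
  -- Maps out of `Z.X n` are determined on the summands. This turns the degreewise projections into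
  -- morphisms of cyclic modules, so that they act on homology.
  have ext : ∀ n {M : Type v} [AddCommGroup M] [Module k M] (f g : Z.X n →ₗ[k] M),
      (∀ c x, f ((φ c).f n x) = g ((φ c).f n x)) → ∀ y, f y = g y := by
    intro n M _ _ f g hfg y
    obtain ⟨S, hS⟩ := hg n y
    rw [hS S subset_rfl, map_sum, map_sum]
    exact Finset.sum_congr rfl fun c _ => hfg c _
  let π : ∀ c, Hom Z (X c) := fun c =>
    { f := fun n => pr n c
      map_d := fun n i => ext (n + 1) (pr n c ∘ₗ Z.d n i) ((X c).d n i ∘ₗ pr (n + 1) c) <| by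
        intro c' x
        rw [LinearMap.comp_apply, LinearMap.comp_apply, ← (φ c').map_d]
        by_cases hc : c' = c
        · subst hc; rw [hs, hs]
        · rw [ho _ _ _ _ hc, ho _ _ _ _ hc, map_zero]
      map_t := fun n => ext n (pr n c ∘ₗ Z.t n) ((X c).t n ∘ₗ pr n c) <| by
        intro c' x
        rw [LinearMap.comp_apply, LinearMap.comp_apply, ← (φ c').map_t]
        by_cases hc : c' = c
        · subst hc; rw [hs, hs]
        · rw [ho _ _ _ _ hc, ho _ _ _ _ hc, map_zero] }
  refine nonempty_directSum_equiv (fun c => LinHomology.map (φ c).tot (φ c).D_tot n)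
    (fun c => LinHomology.map (π c).tot (π c).D_tot n) ?_ ?_ ?_
  · intro c x
    obtain ⟨z, hz, rfl⟩ := LinHomology.mk_surj x
    refine LinHomology.mk_eq_mk.2 ⟨0, ?_⟩
    rw [map_zero, eq_comm, sub_eq_zero]
    exact funext fun q => hs q c _
  · intro c c' x hc
    obtain ⟨z, hz, rfl⟩ := LinHomology.mk_surj x
    refine LinHomology.mk_eq_zero.2 ⟨0, ?_⟩
    rw [map_zero, eq_comm]
    exact funext fun q => ho q c c' _ hc
  · intro x
    obtain ⟨z, hz, rfl⟩ := LinHomology.mk_surj x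
    choose S hS using fun q : Fin (n + 1) => hg q (z q)
    refine ⟨Finset.univ.biUnion S, ?_⟩
    simp only [LinHomology.map_mk]
    simp only [LinHomology.mk]
    rw [← Submodule.mkQ_apply]
    simp only [← Submodule.mkQ_apply]
    rw [← map_sum]
    congr 1
    refine Subtype.ext (funext fun q => ?_)
    rw [AddSubmonoidClass.coe_finsetSum, Finset.sum_apply]
    exact hS q _ (Finset.subset_biUnion_of_mem S (Finset.mem_univ q))

end CyclicModule

/-! ### The Connes periodicity sequence and its splitting. -/

namespace CyclicModule

section Periodicity

variable {k : Type u} [CommRing k] (Z : CyclicModule.{u, v} k)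

/-- The double complex is periodic in the columns with period `2`; this is the source of the map
`S`. -/
theorem dComp_add_two (p q : ℕ) : Z.dComp (p + 2) q = Z.dComp p q := by
  by_cases hp : Even p
  · rw [dComp, dComp, if_pos hp, if_pos (hp.add even_two)]
  · rw [dComp, dComp, if_neg hp, if_neg (by simpa [Nat.even_add] using hp)]

/-- The inclusion of the Hochschild complex as the column `0`. -/
def inclColumn (n : ℕ) : Z.X n →ₗ[k] Z.Tot n := Z.tot n ∘ₗ LinearMap.single k _ n

theorem inclColumn_apply (n : ℕ) (x : Z.X n) : Z.inclColumn n x = Z.tot n (Pi.single n x) := rfl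

theorem D_inclColumn (n : ℕ) (x : Z.X (n + 1)) :
    Z.D n (Z.inclColumn (n + 1) x) = Z.inclColumn n (Z.b n x) := by
  rw [inclColumn_apply, inclColumn_apply, D_tot_eq]
  intro p q hpq
  by_cases hq : q = n
  · subst hq
    obtain rfl : p = 0 := by omega
    rw [dComp_even (by simp), Pi.single_eq_same, Pi.single_eq_same,
      Pi.single_eq_of_ne (by omega), map_zero, add_zero]
  · rw [Pi.single_eq_of_ne hq, ← map_zero (Z.dComp p q)]
    exact dComp_congr p q (Pi.single_eq_of_ne (by omega) _) (Pi.single_eq_of_ne (by omega) _)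

/-- The projection of the total complex which forgets the columns `0` and `1`. -/
def truncColumns (n : ℕ) : Z.Tot (n + 2) →ₗ[k] Z.Tot n :=
  LinearMap.pi fun q => LinearMap.proj (q.castLE (by omega))

theorem truncColumns_tot (n : ℕ) (z : ∀ q, Z.X q) :
    Z.truncColumns n (Z.tot (n + 2) z) = Z.tot n z := rfl

/-- The map `HH_n → HC_n`. -/
def mapI (n : ℕ) : LinHomology Z.b n →ₗ[k] LinHomology Z.D n :=
  LinHomology.map Z.inclColumn Z.D_inclColumn n

/-- The periodicity map `HC_{n+2} → HC_n`. -/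
def mapS (n : ℕ) : LinHomology Z.D (n + 2) →ₗ[k] LinHomology Z.D n :=
  LinHomology.mapOf (Z.truncColumns n)
    (fun z hz => by
      obtain ⟨z, rfl⟩ := Z.tot_surjective _ z
      rw [dFrom_tot] at hz
      rw [truncColumns_tot, dFrom_tot]
      intro p q hpq
      rw [← dComp_add_two]
      exact hz (p + 2) q (by omega))
    (fun w => by
      obtain ⟨w, rfl⟩ := Z.tot_surjective _ w
      refine ⟨Z.tot _ w, ?_⟩
      rw [D_tot, D_tot, truncColumns_tot, tot_eq_tot]
      intro p q hpq
      rw [show n + 2 - q = n - q + 2 by omega, dComp_add_two])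

variable {Z}

theorem mapI_mk {n : ℕ} (x : Z.X n) (hx : dFrom Z.b n x = 0) :
    Z.mapI n (LinHomology.mk x hx) = LinHomology.mk (Z.inclColumn n x)
      (by rw [dFrom_comm Z.inclColumn Z.D_inclColumn, hx, map_zero]) := rfl

theorem mapS_mk {n : ℕ} (z : Z.Tot (n + 2)) (hz : dFrom Z.D (n + 2) z = 0)
    (hz' : dFrom Z.D n (Z.truncColumns n z) = 0) :
    Z.mapS n (LinHomology.mk z hz) = LinHomology.mk (Z.truncColumns n z) hz' := rfl

theorem dFrom_truncColumns {n : ℕ} {z : Z.Tot (n + 2)} (hz : dFrom Z.D (n + 2) z = 0) :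
    dFrom Z.D n (Z.truncColumns n z) = 0 := by
  obtain ⟨z, rfl⟩ := Z.tot_surjective _ z
  rw [dFrom_tot] at hz
  rw [truncColumns_tot, dFrom_tot]
  intro p q hpq
  rw [← dComp_add_two]
  exact hz (p + 2) q (by omega)

variable (hb' : ∀ n (x : Z.X n), dFrom Z.b' n x = 0 → ∃ v, Z.b' n v = x)

-- A cycle supported in the columns `0` and `1` has a `b'`-cycle in column `1`. As that column is
-- exact, the entry can be removed by a boundary, at the cost of a change in column `0`.
include hb' in
theorem exists_mapI_eq (n : ℕ) (z : ∀ q, Z.X q) (hz : ∀ p q, p + q + 1 = n → Z.dComp p q z = 0)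
    (h0 : ∀ q, q + 1 < n → z q = 0) :
    ∃ (x : Z.X n) (w : ∀ q, Z.X q), dFrom Z.b n x = 0 ∧
      ∀ p q, p + q = n → Z.dComp p q w = z q - (Pi.single n x : ∀ q, Z.X q) q := by
  cases n with
  | zero =>
    refine ⟨z 0, 0, rfl, fun p q hpq => ?_⟩
    obtain rfl : q = 0 := by omega
    rw [map_zero, Pi.single_eq_same, sub_self]
  | succ n =>
    have h1 : dFrom Z.b' n (z n) = 0 := by
      cases n with
      | zero => rfl
      | succ n =>
        have := hz 1 n (by omega)
        rw [dComp_odd (by simp), h0 n (by omega), map_zero, zero_sub, neg_eq_zero] at this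
        exact this
    obtain ⟨v, hv⟩ := hb' n _ h1
    have h2 := hz 0 n (by omega)
    rw [dComp_even (by simp)] at h2
    -- The chain with entry `-v` in column `1` has boundary `b' v = z n` in column `1` and `-(1 - T)
    -- v` in column `0`; hence the shape of `x`.
    refine ⟨z (n + 1) + (1 - Z.T (n + 1)) v, Pi.single (n + 1) (-v), ?_, fun p q hpq => ?_⟩
    · change Z.b n _ = 0
      rw [map_add]
      have := LinearMap.congr_fun (Z.b_comp_one_sub_T n) v
      rw [LinearMap.comp_apply, LinearMap.comp_apply, hv] at this
      rw [this, h2]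
    · rcases Nat.lt_trichotomy q n with h | rfl | h
      · rw [Pi.single_eq_of_ne (by omega), h0 q (by omega), sub_zero, ← map_zero (Z.dComp p q)]
        exact dComp_congr p q (Pi.single_eq_of_ne (by omega) _) (Pi.single_eq_of_ne (by omega) _)
      · obtain rfl : p = 1 := by omega
        rw [dComp_odd (by simp), Pi.single_eq_same, Pi.single_eq_of_ne (by omega), map_zero,
          Pi.single_eq_of_ne (by omega), map_neg, hv]
        abel
      · obtain rfl : q = n + 1 := by omega
        obtain rfl : p = 0 := by omega
        rw [dComp_even (by simp), Pi.single_eq_same, Pi.single_eq_same, 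
          Pi.single_eq_of_ne (by omega), map_zero, map_neg]
        abel

-- In degrees `0` and `1` no columns beyond `0` and `1` occur.
include hb' in
theorem mapI_surjective (n : ℕ) (hn : n < 2) : Function.Surjective (Z.mapI n) := by
  intro y
  obtain ⟨z, hz, rfl⟩ := LinHomology.mk_surj y
  obtain ⟨z, rfl⟩ := Z.tot_surjective _ z
  obtain ⟨x, w, hx, hw⟩ := exists_mapI_eq hb' n z (dFrom_tot.1 hz) fun q hq => absurd hq (by omega)
  refine ⟨LinHomology.mk x hx, ?_⟩
  rw [mapI_mk]
  refine LinHomology.mk_eq_mk.2 ⟨Z.tot _ (-w), ?_⟩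
  rw [inclColumn_apply, ← map_sub, D_tot_eq]
  intro p q hpq
  rw [map_neg, hw p q hpq, Pi.sub_apply]; abel

-- A boundary for the truncated cycle can be read two columns further, by periodicity. Subtracting
-- its boundary leaves a cycle supported in the columns `0` and `1`, which `exists_mapI_eq` moves
-- into column `0`.
include hb' in
theorem mapI_mapS_exact (n : ℕ) : Function.Exact (Z.mapI (n + 2)) (Z.mapS n) := by
  intro y
  constructor
  · intro hy
    obtain ⟨z, hz, rfl⟩ := LinHomology.mk_surj y
    obtain ⟨z, rfl⟩ := Z.tot_surjective _ z
    rw [mapS_mk _ _ (dFrom_truncColumns hz), LinHomology.mk_eq_zero, truncColumns_tot,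
      exists_D_eq] at hy
    obtain ⟨w, hw⟩ := hy
    rw [dFrom_tot] at hz
    obtain ⟨x, w', hx, hw'⟩ := exists_mapI_eq hb' (n + 2) (fun q => z q - Z.dComp (n + 2 - q) q w)
      (fun p q hpq => by
        have e : (fun q => z q - Z.dComp (n + 2 - q) q w)
          = z - fun q => Z.dComp (n + 2 - q) q w := rfl
        rw [e, map_sub, hz p q hpq, dComp_dComp p q _ hpq, sub_zero])
      (fun q hq => by
        rw [show n + 2 - q = n - q + 2 by omega, dComp_add_two, hw (n - q) q (by omega), sub_self])
    refine ⟨LinHomology.mk x hx, ?_⟩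
    rw [mapI_mk]
    refine LinHomology.mk_eq_mk.2 ⟨Z.tot _ (-(w + w')), ?_⟩
    rw [inclColumn_apply, ← map_sub, D_tot_eq]
    intro p q hpq
    rw [map_neg, map_add, hw' p q hpq, Pi.sub_apply, show n + 2 - q = p by omega]; abel
  · rintro ⟨x, rfl⟩
    obtain ⟨x, hx, rfl⟩ := LinHomology.mk_surj x
    have hx' : dFrom Z.D (n + 2) (Z.inclColumn (n + 2) x) = 0 := by
      rw [dFrom_comm Z.inclColumn Z.D_inclColumn, hx, map_zero]
    rw [mapI_mk, mapS_mk _ _ (dFrom_truncColumns hx')]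
    refine LinHomology.mk_eq_zero.2 ⟨0, ?_⟩
    rw [map_zero, inclColumn_apply, truncColumns_tot, ← map_zero (Z.tot n), tot_eq_tot]
    intro p q hpq
    rw [Pi.single_eq_of_ne (by omega)]; rfl

variable (ψ : ∀ n, Z.X n →ₗ[k] Z.X n) (hψb : ∀ n x, ψ n (Z.b n x) = Z.b n (ψ (n + 1) x))
  (hψT : ∀ n x, ψ n (Z.T n x) = ψ n x)
  (hψ : ∀ n x, dFrom Z.b n x = 0 → ∃ w, Z.b n w = x - ψ n x)

-- If `x` in column `0` bounds in the total complex, then `x = b w' + (1 - T) w''`. Since `ψ` kills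
-- the image of `1 - T`, `ψ x` is a Hochschild boundary, and so is `x - ψ x`.
include hψb hψT hψ in
theorem mapI_injective (n : ℕ) : Function.Injective (Z.mapI n) := by
  refine (injective_iff_map_eq_zero _).2 fun x hx => ?_
  obtain ⟨x, hx', rfl⟩ := LinHomology.mk_surj x
  rw [mapI_mk, LinHomology.mk_eq_zero, inclColumn_apply, exists_D_eq] at hx
  obtain ⟨w, hw⟩ := hx
  have h := hw 0 n (by omega)
  rw [dComp_even (by simp), Pi.single_eq_same] at h
  obtain ⟨v, hv⟩ := hψ n x hx'
  refine LinHomology.mk_eq_zero.2 ⟨v + ψ (n + 1) (w (n + 1)), ?_⟩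
  rw [map_add, hv, ← hψb]
  have : ψ n x = ψ n (Z.b n (w (n + 1))) := by
    rw [← h, map_add, LinearMap.sub_apply, map_sub, hψT]; simp
  rw [this]; abel

-- A cycle must be continued into two new columns. The first entry exists because `N z` is a
-- `b'`-cycle and the `b'`-column is exact. The second exists because the resulting Hochschild cycle
-- `(1 - T) z₁` is killed by `ψ`, hence homologous to `0`.
include hb' hψT hψ in
theorem mapS_surjective (n : ℕ) : Function.Surjective (Z.mapS n) := by
  intro y
  obtain ⟨z, hz, rfl⟩ := LinHomology.mk_surj y
  obtain ⟨z, rfl⟩ := Z.tot_surjective _ z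
  rw [dFrom_tot] at hz
  have h1 : dFrom Z.b' n (Z.N n (z n)) = 0 := by
    cases n with
    | zero => rfl
    | succ n =>
      have h := hz 0 n (by omega)
      rw [dComp_even (by simp)] at h
      change Z.b' n _ = 0
      have e1 := LinearMap.congr_fun (Z.b'_comp_N n) (z (n + 1))
      have e2 := LinearMap.congr_fun (Z.N_mul_T n) (z n)
      rw [LinearMap.comp_apply, LinearMap.comp_apply] at e1
      rw [Module.End.mul_apply] at e2
      rw [e1, eq_neg_of_add_eq_zero_left h, map_neg, LinearMap.sub_apply, map_sub, e2]
      simp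
  obtain ⟨z₁, hz₁⟩ := hb' n _ h1
  have h2 : dFrom Z.b (n + 1) ((1 - Z.T (n + 1)) z₁) = 0 := by
    change Z.b n _ = 0
    have e1 := LinearMap.congr_fun (Z.b_comp_one_sub_T n) z₁
    have e2 := LinearMap.congr_fun (Z.T_mul_N n) (z n)
    rw [LinearMap.comp_apply, LinearMap.comp_apply] at e1
    rw [Module.End.mul_apply] at e2
    rw [e1, hz₁, LinearMap.sub_apply, e2]
    simp
  obtain ⟨z₂, hz₂⟩ := hψ _ _ h2
  rw [LinearMap.sub_apply, map_sub, hψT, Module.End.one_apply, sub_self, sub_zero] at hz₂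
  -- In degree `n + 2` the old entries sit two columns further on; `z₁` fills column `1` and `-z₂`
  -- fills column `0`.
  let y : ∀ q, Z.X q := Function.update (Function.update z (n + 1) z₁) (n + 2) (-z₂)
  have y2 : y (n + 2) = -z₂ := Function.update_self ..
  have y1 : y (n + 1) = z₁ := by
    simp only [y]; rw [Function.update_of_ne (by omega), Function.update_self]
  have y0 : ∀ q ≤ n, y q = z q := fun q hq => by
    simp only [y]; rw [Function.update_of_ne (by omega), Function.update_of_ne (by omega)]
  have hy : dFrom Z.D (n + 2) (Z.tot (n + 2) y) = 0 := by
    refine dFrom_tot.2 fun p q hpq => ?_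
    · rcases Nat.lt_or_ge q n with h | h
      · obtain ⟨p, rfl⟩ : ∃ p', p = p' + 2 := ⟨p - 2, by omega⟩
        rw [dComp_add_two, ← hz p q (by omega)]
        exact dComp_congr p q (y0 q (by omega)) (y0 (q + 1) (by omega))
      · rcases Nat.eq_or_lt_of_le h with rfl | h
        · obtain rfl : p = 1 := by omega
          rw [dComp_odd (by simp), y0 n le_rfl, y1, hz₁, sub_self]
        · obtain rfl : q = n + 1 := by omega
          obtain rfl : p = 0 := by omega
          rw [dComp_even (by simp), y1, y2, map_neg, hz₂, LinearMap.sub_apply, 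
            Module.End.one_apply]
          abel
  refine ⟨LinHomology.mk (Z.tot (n + 2) y) hy, ?_⟩
  rw [mapS_mk _ _ (dFrom_truncColumns hy)]
  refine LinHomology.mk_eq_mk.2 ⟨0, ?_⟩
  rw [map_zero, truncColumns_tot, eq_comm, sub_eq_zero, tot_eq_tot]
  exact fun p q hpq => y0 q (by omega)

end Periodicity

section PeriodicityField

variable {k : Type u} [Field k] {Z : CyclicModule.{u, v} k}

/-- If the first column is exact and the identity of the Hochschild complex is homologous to a map
which is invariant under the cyclic operators, cyclic homology is a sum of Hochschild homology
groups. -/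
theorem nonempty_homology_equiv_directSum
    (hb' : ∀ n (x : Z.X n), dFrom Z.b' n x = 0 → ∃ v, Z.b' n v = x)
    (ψ : ∀ n, Z.X n →ₗ[k] Z.X n) (hψb : ∀ n x, ψ n (Z.b n x) = Z.b n (ψ (n + 1) x))
    (hψT : ∀ n x, ψ n (Z.T n x) = ψ n x)
    (hψ : ∀ n x, dFrom Z.b n x = 0 → ∃ w, Z.b n w = x - ψ n x) (n : ℕ) :
    Nonempty (LinHomology Z.D n ≃ₗ[k]
      ⨁ i : {i : ℕ // 2 * i ≤ n}, LinHomology Z.b (n - 2 * i)) := by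
  induction n using Nat.strong_induction_on with
  | _ n ih =>
    rcases Nat.lt_or_ge n 2 with hn | hn
    · let : Unique {i : ℕ // 2 * i ≤ n} :=
        { default := ⟨0, by omega⟩, uniq := fun i => Subtype.ext (by have := i.2; simp; omega) }
      exact ⟨(LinearEquiv.ofBijective (Z.mapI n)
        ⟨mapI_injective ψ hψb hψT hψ n, mapI_surjective hb' n hn⟩).symm.trans
        (LinearEquiv.ofBijective _ (lof_default_bijective (k := k)
          fun i : {i : ℕ // 2 * i ≤ n} => LinHomology Z.b (n - 2 * i)))⟩
    · obtain ⟨n, rfl⟩ : ∃ m, n = m + 2 := ⟨n - 2, by omega⟩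
      obtain ⟨e⟩ := ih n (by omega)
      obtain ⟨e'⟩ := nonempty_directSum_succ_equiv (k := k) (LinHomology Z.b) n
      -- Over a field the surjection `S` has a section, so the short exact sequence splits and the
      -- induction proceeds in steps of two.
      obtain ⟨l, hl⟩ := LinearMap.exists_rightInverse_of_surjective (Z.mapS n)
        (LinearMap.range_eq_top.2 (mapS_surjective hb' ψ hψT hψ n))
      obtain ⟨e'', -⟩ := (mapI_mapS_exact hb' n).splitSurjectiveEquiv
        (mapI_injective ψ hψb hψT hψ (n + 2)) ⟨l, hl⟩
      exact ⟨(e''.trans (LinearEquiv.prodCongr (LinearEquiv.refl _ _) e)).trans e'.symm⟩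

end PeriodicityField

end CyclicModule

/-! ### Group homology from a projective resolution given by linear maps. -/

section Resolutions

open Representation

variable {k Q : Type u} [CommRing k] [Group Q]
variable {V V' V'' M : Type u} [AddCommGroup V] [Module k V] [AddCommGroup V'] [Module k V']
  [AddCommGroup V''] [Module k V''] [AddCommGroup M] [Module k M]
  (σ : Representation k Q M) {ρ : Representation k Q V} {ρ' : Representation k Q V'}
  {ρ'' : Representation k Q V''}

/-- The map on the coinvariants of `M ⊗ V` induced by an equivariant map. -/
def coinvMap (f : V →ₗ[k] V') (hf : ∀ g x, f (ρ g x) = ρ' g (f x)) :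
    Coinvariants (σ.tprod ρ) →ₗ[k] Coinvariants (σ.tprod ρ') :=
  Coinvariants.lift _ (Coinvariants.mk (σ.tprod ρ') ∘ₗ f.lTensor M) fun g =>
    TensorProduct.ext' fun m x => by
      simp only [LinearMap.comp_apply, Representation.tprod_apply, TensorProduct.map_tmul,
        LinearMap.lTensor_tmul, hf]
      exact Coinvariants.mk_self_apply (σ.tprod ρ') g (m ⊗ₜ f x)

theorem coinvMap_mk (f : V →ₗ[k] V') (hf : ∀ g x, f (ρ g x) = ρ' g (f x)) (m : M) (x : V) :
    coinvMap σ f hf (Coinvariants.mk _ (m ⊗ₜ x)) = Coinvariants.mk _ (m ⊗ₜ f x) := rfl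

theorem coinv_ext {N : Type*} [AddCommGroup N] [Module k N]
    {f g : Coinvariants (σ.tprod ρ) →ₗ[k] N}
    (h : ∀ m x, f (Coinvariants.mk _ (m ⊗ₜ x)) = g (Coinvariants.mk _ (m ⊗ₜ x))) : f = g :=
  Coinvariants.hom_ext (TensorProduct.ext' h)

/-- The group homology computed by a projective resolution, in terms of modules and linear maps. -/
theorem nonempty_groupHomology_equiv (A : Rep.{u} k Q) {X : ℕ → Type u} [∀ n, AddCommGroup (X n)]
    [∀ n, Module k (X n)] (τ : ∀ n, Representation k Q (X n)) (d : ∀ n, X (n + 1) →ₗ[k] X n)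
    (hd : ∀ n g x, d n (τ (n + 1) g x) = τ n g (d n x)) (hdd : ∀ n x, d n (d (n + 1) x) = 0)
    (ε : X 0 →ₗ[k] k) (hε : ∀ g x, ε (τ 0 g x) = ε x) (hεs : ∃ x, ε x = 1)
    (hεd : ∀ x, ε (d 0 x) = 0) (ex₀ : ∀ x, ε x = 0 → ∃ y, d 0 y = x)
    (ex : ∀ n x, d n x = 0 → ∃ y, d (n + 1) y = x) (hP : ∀ n, Projective (Rep.of (τ n))) (n : ℕ) :
    Nonempty (groupHomology A n ≃ₗ[k]
      LinHomology (X := fun n => Coinvariants (A.ρ.tprod (τ n)))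
        (fun n => coinvMap A.ρ (d n) (hd n)) n) := by
  classical
  let δ : ∀ n, Rep.of (τ (n + 1)) ⟶ Rep.of (τ n) := fun n =>
    Rep.ofHom ⟨d n, fun g => LinearMap.ext fun x => hd n g x⟩
  have hδ : ∀ n, δ (n + 1) ≫ δ n = 0 := fun n => by
    ext x; exact hdd n x
  let C := ChainComplex.of (fun n => Rep.of (τ n)) δ hδ
  have hC : ∀ n, C.d (n + 1) n = δ n := fun n => ChainComplex.of_d (fun n => Rep.of (τ n)) δ n
  let ε' : C.X 0 ⟶ Rep.trivial k Q k := Rep.ofHom ⟨ε, fun g => LinearMap.ext fun x => hε g x⟩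
  let π : C ⟶ (ChainComplex.single₀ _).obj (Rep.trivial k Q k) :=
    (C.toSingle₀Equiv _).symm ⟨ε', by rw [hC]; ext x; exact hεd x⟩
  have hπ : QuasiIso π := by
    refine ⟨fun m => ?_⟩
    cases m with
    | zero =>
      -- In degree `0` the quasi-isomorphism amounts to exactness of `X 1 → X 0 → k → 0`, in
      -- positive degrees to exactness of the complex. Both are tested on underlying modules.
      rw [ChainComplex.quasiIsoAt₀_iff, ShortComplex.quasiIso_iff_of_zeros' _ rfl rfl rfl]
      constructor
      · apply (forget₂ _ (ModuleCat k)).reflects_exact_of_faithful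
        rw [ShortComplex.moduleCat_exact_iff]
        intro x hx
        obtain ⟨y, hy⟩ := ex₀ x hx
        refine ⟨y, ?_⟩
        change (C.d 1 0).hom y = x
        rw [hC]; exact hy
      · refine (Rep.epi_iff_surjective _).2 fun x => ?_
        obtain ⟨y, hy⟩ := hεs
        have key : ∀ c : k, ε (c • y) = c := fun c => by
          rw [map_smul, hy, smul_eq_mul, mul_one]
        exact ⟨_, key x⟩
    | succ m =>
      rw [quasiIsoAt_iff_exactAt' (hL := ChainComplex.exactAt_succ_single_obj ..),
          HomologicalComplex.exactAt_iff' _ (m + 2) (m + 1) m (by simp) (by simp)]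
      apply (forget₂ _ (ModuleCat k)).reflects_exact_of_faithful
      rw [ShortComplex.moduleCat_exact_iff]
      intro x hx
      have hx' : (C.d (m + 1) m).hom x = 0 := hx
      rw [hC] at hx'
      obtain ⟨y, hy⟩ := ex m x hx'
      refine ⟨y, ?_⟩
      change (C.d (m + 2) (m + 1)).hom y = x
      rw [hC]; exact hy
  let P : ProjectiveResolution (Rep.trivial k Q k) :=
    { complex := C, projective := hP, π := π, quasiIso := hπ }
  obtain ⟨e⟩ := nonempty_homology_equiv (P.complex.coinvariantsTensorObj A) n
  have h : (fun n => ((P.complex.coinvariantsTensorObj A).d (n + 1) n).hom) =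
      fun n => coinvMap A.ρ (d n) (hd n) := by
    funext m
    refine coinv_ext A.ρ fun a x => ?_
    change (((Rep.coinvariantsTensor k Q).obj A).map (C.d (m + 1) m)).hom _ = _
    rw [hC]; rfl
  rw [h] at e
  exact ⟨(groupHomologyIso A n P).toLinearEquiv.trans e⟩

end Resolutions

/-! ### Cyclic modules with a group action, and their coinvariants. -/

section EquivariantCyclic

open Representation

/-- A cyclic module with a compatible linear action of a group. -/
structure EquivariantCyclicModule (k Q : Type u) [CommRing k] [Group Q] extends
    CyclicModule.{u, u} k where
  ρ : ∀ n, Representation k Q (X n)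
  d_ρ : ∀ n i g x, d n i (ρ (n + 1) g x) = ρ n g (d n i x)
  t_ρ : ∀ n g x, t n (ρ n g x) = ρ n g (t n x)

namespace EquivariantCyclicModule

variable {k Q : Type u} [CommRing k] [Group Q] (W : EquivariantCyclicModule k Q)
variable {M : Type u} [AddCommGroup M] [Module k M] (σ : Representation k Q M)

/-- The action of a group element as a morphism of cyclic modules. -/
def actHom (g : Q) : CyclicModule.Hom W.toCyclicModule W.toCyclicModule where
  f n := W.ρ n g
  map_d n i x := (W.d_ρ n i g x).symm
  map_t n x := (W.t_ρ n g x).symm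

theorem b_ρ (n : ℕ) (g : Q) (x) : W.b n (W.ρ (n + 1) g x) = W.ρ n g (W.b n x) :=
  ((W.actHom g).map_b n x).symm

/-- The cyclic module of coinvariants of `M ⊗ W`. -/
def coinv : CyclicModule.{u, u} k where
  X n := Coinvariants (σ.tprod (W.ρ n))
  d n i := coinvMap σ (W.d n i) (W.d_ρ n i)
  t n := coinvMap σ (W.t n) (W.t_ρ n)
  d_comp_d n i j hij := coinv_ext σ fun m x => by
    have := LinearMap.congr_fun (W.d_comp_d n i j hij) x
    simp only [LinearMap.comp_apply] at this ⊢
    rw [coinvMap_mk, coinvMap_mk, coinvMap_mk, coinvMap_mk, this]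
  d_zero_comp_t n := coinv_ext σ fun m x => by
    have := LinearMap.congr_fun (W.d_zero_comp_t n) x
    simp only [LinearMap.comp_apply] at this ⊢
    rw [coinvMap_mk, coinvMap_mk, coinvMap_mk, this]
  d_succ_comp_t n i := coinv_ext σ fun m x => by
    have := LinearMap.congr_fun (W.d_succ_comp_t n i) x
    simp only [LinearMap.comp_apply] at this ⊢
    rw [coinvMap_mk, coinvMap_mk, coinvMap_mk, coinvMap_mk, this]
  t_pow n := coinv_ext σ fun m x => by
    have h : ∀ j, (coinvMap σ (W.t n) (W.t_ρ n) ^ j) (Coinvariants.mk _ (m ⊗ₜ x)) =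
        Coinvariants.mk _ (m ⊗ₜ (W.t n ^ j) x) := by
      intro j
      induction j with
      | zero => rfl
      | succ j ih => rw [pow_succ', Module.End.mul_apply, ih, coinvMap_mk, pow_succ',
          Module.End.mul_apply]
    rw [h, W.t_pow]; rfl

/-- The morphism `w ↦ [m ⊗ w]`. -/
def mkHom (m : M) : CyclicModule.Hom W.toCyclicModule (W.coinv σ) where
  f n := Coinvariants.mk (σ.tprod (W.ρ n)) ∘ₗ TensorProduct.mk k M (W.X n) m
  map_d _ _ _ := rfl
  map_t _ _ := rfl

/-- The diagonal action on the total complex. -/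
def totRep (m : ℕ) : Representation k Q (W.Tot m) where
  toFun g := (W.actHom g).tot m
  map_one' := LinearMap.ext fun z => funext fun q => by
    change W.ρ q 1 (z q) = z q
    rw [map_one]; rfl
  map_mul' g g' := LinearMap.ext fun z => funext fun q => by
    change W.ρ q (g * g') (z q) = W.ρ q g (W.ρ q g' (z q))
    rw [map_mul]; rfl

theorem totRep_apply (m : ℕ) (g : Q) (z : W.Tot m) (q : Fin (m + 1)) :
    W.totRep m g z q = W.ρ q g (z q) := rfl

theorem D_totRep (m : ℕ) (g : Q) (z : W.Tot (m + 1)) :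
    W.D m (W.totRep (m + 1) g z) = W.totRep m g (W.D m z) := (W.actHom g).D_tot m z

theorem proj_totRep (m : ℕ) (q : Fin (m + 1)) (g : Q) (z : W.Tot m) :
    (LinearMap.proj q : W.Tot m →ₗ[k] W.X q) (W.totRep m g z) =
      W.ρ q g ((LinearMap.proj q : W.Tot m →ₗ[k] W.X q) z) := rfl

theorem single_ρ (m : ℕ) (q : Fin (m + 1)) (g : Q) (x : W.X q) :
    LinearMap.single k (fun q : Fin (m + 1) => W.X q) q (W.ρ q g x) =
      W.totRep m g (LinearMap.single k (fun q : Fin (m + 1) => W.X q) q x) := by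
  funext q'
  rw [totRep_apply]
  by_cases h : q' = q
  · subst h; simp
  · simp [h]

/-- The total complex of the coinvariants is the complex of coinvariants of the total complex. -/
def coinvTot (m : ℕ) : Coinvariants (σ.tprod (W.totRep m)) →ₗ[k] (W.coinv σ).Tot m :=
  LinearMap.pi fun q => coinvMap σ (LinearMap.proj q) (W.proj_totRep m q)

theorem coinvTot_mk (m : ℕ) (a : M) (z : W.Tot m) :
    W.coinvTot σ m (Coinvariants.mk _ (a ⊗ₜ z)) = (W.mkHom σ a).tot m z := rfl

/-- A chain of the total complex has finitely many rows, and coinvariants of a tensor product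
commute with finite products. The inverse `g` adds up the inclusions of the single rows. -/
theorem coinvTot_bijective (m : ℕ) : Function.Bijective (W.coinvTot σ m) := by
  let g : (W.coinv σ).Tot m →ₗ[k] Coinvariants (σ.tprod (W.totRep m)) :=
    ∑ q : Fin (m + 1), coinvMap σ (LinearMap.single k (fun q : Fin (m + 1) => W.X q) q)
      (W.single_ρ m q) ∘ₗ LinearMap.proj q
  have h1 : g ∘ₗ W.coinvTot σ m = LinearMap.id := coinv_ext σ fun a z => by
    rw [LinearMap.comp_apply, coinvTot_mk, LinearMap.sum_apply]
    have : ∀ q : Fin (m + 1), (coinvMap σ (LinearMap.single k (fun q : Fin (m + 1) => W.X q) q)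
        (W.single_ρ m q) ∘ₗ LinearMap.proj q) ((W.mkHom σ a).tot m z) =
        Coinvariants.mk (σ.tprod (W.totRep m)) (a ⊗ₜ[k] (Pi.single q (z q) : W.Tot m)) :=
      fun q => rfl
    rw [Finset.sum_congr rfl fun q _ => this q, ← map_sum, ← TensorProduct.tmul_sum,
      Finset.univ_sum_single]
    rfl
  have h2 : ∀ y, W.coinvTot σ m (g y) = y := by
    intro y
    have key : ∀ (q q' : Fin (m + 1)) (v : (W.coinv σ).X q),
        coinvMap σ (LinearMap.proj q') (W.proj_totRep m q')
          (coinvMap σ (LinearMap.single k (fun q : Fin (m + 1) => W.X q) q) (W.single_ρ m q) v) =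
        (Pi.single q v : (W.coinv σ).Tot m) q' := by
      intro q q'
      refine LinearMap.congr_fun (f := coinvMap σ (LinearMap.proj q') (W.proj_totRep m q') ∘ₗ
        coinvMap σ (LinearMap.single k (fun q : Fin (m + 1) => W.X q) q) (W.single_ρ m q))
        (g := LinearMap.proj q' ∘ₗ LinearMap.single k (fun q : Fin (m + 1) => (W.coinv σ).X q) q)
        (coinv_ext σ fun a x => ?_)
      rw [LinearMap.comp_apply, coinvMap_mk, coinvMap_mk]
      by_cases h : q' = q
      · subst h
        refine Eq.trans ?_ (Pi.single_eq_same (M := fun q : Fin (m + 1) => (W.coinv σ).X q) q'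
          (Coinvariants.mk (σ.tprod (W.ρ q')) (a ⊗ₜ x))).symm
        simp
      · refine Eq.trans ?_ (Pi.single_eq_of_ne (M := fun q : Fin (m + 1) => (W.coinv σ).X q) h
          (Coinvariants.mk (σ.tprod (W.ρ q)) (a ⊗ₜ x))).symm
        simp [h]
        rfl
    funext q'
    change coinvMap σ (LinearMap.proj q') (W.proj_totRep m q') (g y) = y q'
    rw [LinearMap.sum_apply, map_sum]
    refine (Finset.sum_congr rfl fun q _ => key q q' (y q)).trans ?_
    exact (Finset.sum_apply q' Finset.univ
      fun q => (Pi.single q (y q) : (W.coinv σ).Tot m)).symm.trans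
        (congrFun (Finset.univ_sum_single y) q')
  exact ⟨fun x y hxy => by
    rw [← LinearMap.id_apply (R := k) x, ← h1, LinearMap.comp_apply, hxy, ← LinearMap.comp_apply,
      h1, LinearMap.id_apply], fun y => ⟨g y, h2 y⟩⟩

/-- A finite sum of projectives is projective: the identity is the sum of the maps `pr q ≫ inc q`,
so lifts found row by row can be added. -/
theorem projective_totRep (hP : ∀ n, Projective (Rep.of (W.ρ n))) (m : ℕ) :
    Projective (Rep.of (W.totRep m)) := by
  let pr : ∀ q : Fin (m + 1), Rep.of (W.totRep m) ⟶ Rep.of (W.ρ q) := fun q =>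
    Rep.ofHom ⟨LinearMap.proj q, fun g => LinearMap.ext fun z => W.proj_totRep m q g z⟩
  let inc : ∀ q : Fin (m + 1), Rep.of (W.ρ q) ⟶ Rep.of (W.totRep m) := fun q =>
    Rep.ofHom ⟨LinearMap.single k (fun q : Fin (m + 1) => W.X q) q,
      fun g => LinearMap.ext fun z => W.single_ρ m q g z⟩
  have h : ∑ q, pr q ≫ inc q = 𝟙 (Rep.of (W.totRep m)) := by
    refine Rep.hom_ext (Representation.IntertwiningMap.ext (LinearMap.ext fun z => ?_))
    have : ∀ q, (pr q ≫ inc q).hom z = (Pi.single q (z q) : W.Tot m) := fun q => rfl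
    rw [Rep.sum_hom]
    change (∑ q, (pr q ≫ inc q).hom) z = z
    rw [Representation.IntertwiningMap.sum_apply, Finset.sum_congr rfl fun q _ => this q]
    exact Finset.univ_sum_single z
  refine ⟨fun {E X} f e he => ⟨∑ q, pr q ≫ Projective.factorThru (inc q ≫ f) e, ?_⟩⟩
  rw [Preadditive.sum_comp]
  simp only [Category.assoc, Projective.factorThru_comp]
  simp only [← Category.assoc]
  rw [← Preadditive.sum_comp, h, Category.id_comp]

/-- If the Hochschild complex of `W` is a projective resolution of `k`, the Hochschild homology of
the coinvariants is group homology. -/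
theorem nonempty_groupHomology_equiv_b (A : Rep.{u} k Q) (ε : W.X 0 →ₗ[k] k)
    (hε : ∀ g x, ε (W.ρ 0 g x) = ε x) (hεs : ∃ x, ε x = 1) (hεd : ∀ x, ε (W.b 0 x) = 0)
    (ex₀ : ∀ x, ε x = 0 → ∃ y, W.b 0 y = x) (ex : ∀ n x, W.b n x = 0 → ∃ y, W.b (n + 1) y = x)
    (hP : ∀ n, Projective (Rep.of (W.ρ n))) (n : ℕ) :
    Nonempty (groupHomology A n ≃ₗ[k] LinHomology (W.coinv A.ρ).b n) := by
  obtain ⟨e⟩ := nonempty_groupHomology_equiv A W.ρ W.b W.b_ρ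
    (fun n x => LinearMap.congr_fun (W.b_comp_b n) x) ε hε hεs hεd ex₀ ex hP n
  have : (fun n => coinvMap A.ρ (W.b n) (W.b_ρ n)) = (W.coinv A.ρ).b :=
    funext fun n => coinv_ext A.ρ fun a x => (W.mkHom A.ρ a).map_b n x
  rw [this] at e
  exact ⟨e⟩

/-- If the total complex of `W` is a projective resolution of `k`, the cyclic homology of the
coinvariants is group homology. -/
theorem nonempty_groupHomology_equiv_D (A : Rep.{u} k Q) (ε : W.X 0 →ₗ[k] k)
    (hε : ∀ g x, ε (W.ρ 0 g x) = ε x) (hεs : ∃ x, ε x = 1)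
    (hεd : ∀ z, ε (W.D 0 z 0) = 0)
    (ex₀ : ∀ z : W.Tot 0, ε (z 0) = 0 → ∃ y, W.D 0 y = z)
    (ex : ∀ n z, W.D n z = 0 → ∃ y, W.D (n + 1) y = z)
    (hP : ∀ n, Projective (Rep.of (W.ρ n))) (n : ℕ) :
    Nonempty (groupHomology A n ≃ₗ[k] LinHomology (W.coinv A.ρ).D n) := by
  obtain ⟨e⟩ := nonempty_groupHomology_equiv A W.totRep W.D W.D_totRep
    (fun n x => LinearMap.congr_fun (W.D_comp_D n) x)
    (ε ∘ₗ (LinearMap.proj (0 : Fin 1) : W.Tot 0 →ₗ[k] W.X 0)) (fun g z => hε g (z 0)) (by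
      obtain ⟨x, hx⟩ := hεs
      exact ⟨W.tot 0 (Pi.single 0 x), by
        change ε ((Pi.single 0 x : ∀ q, W.X q) 0) = 1
        rw [Pi.single_eq_same, hx]⟩) hεd ex₀ ex
    (W.projective_totRep hP) n
  obtain ⟨e'⟩ := LinHomology.nonempty_equiv_of_bijective (d' := (W.coinv A.ρ).D)
    (W.coinvTot A.ρ) (d := fun n => coinvMap A.ρ (W.D n) (W.D_totRep n)) (fun m x => by
      refine LinearMap.congr_fun (f := (W.coinv A.ρ).D m ∘ₗ W.coinvTot A.ρ (m + 1))
        (g := W.coinvTot A.ρ m ∘ₗ coinvMap A.ρ (W.D m) (W.D_totRep m))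
        (coinv_ext A.ρ fun a z => ?_) x
      rw [LinearMap.comp_apply, LinearMap.comp_apply, coinvMap_mk, coinvTot_mk, coinvTot_mk]
      exact (W.mkHom A.ρ a).D_tot m z) (W.coinvTot_bijective A.ρ) n
  exact ⟨e.trans e'⟩

end EquivariantCyclicModule

end EquivariantCyclic

/-! ### The complex of simplices on a set of vertices, and its contractions. -/

section SimplexModules

variable (k : Type u) [CommRing k] (Y : Type v)

/-- The free module on the `n`-simplices with vertices in `Y`. -/
abbrev SimplexModule (n : ℕ) : Type max u v := (Fin (n + 1) → Y) →₀ k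

variable {k Y}

/-- The linear map given by a map of simplices. -/
def simplexMap {n m : ℕ} (f : (Fin (n + 1) → Y) → (Fin (m + 1) → Y)) :
    SimplexModule k Y n →ₗ[k] SimplexModule k Y m := Finsupp.lmapDomain k k f

theorem simplexMap_single {n m : ℕ} (f : (Fin (n + 1) → Y) → (Fin (m + 1) → Y)) (h) (c : k) :
    simplexMap f (Finsupp.single h c) = Finsupp.single (f h) c := by
  simp [simplexMap]

theorem simplexModule_ext {n : ℕ} {N : Type*} [AddCommGroup N] [Module k N]
    {f g : SimplexModule k Y n →ₗ[k] N}
    (h : ∀ y, f (Finsupp.single y 1) = g (Finsupp.single y 1)) : f = g :=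
  Finsupp.lhom_ext' fun y => LinearMap.ext_ring (h y)

theorem simplexMap_comp {n m l : ℕ} (f : (Fin (n + 1) → Y) → (Fin (m + 1) → Y))
    (g : (Fin (m + 1) → Y) → (Fin (l + 1) → Y)) :
    (simplexMap g ∘ₗ simplexMap f : SimplexModule k Y n →ₗ[k] _) = simplexMap (g ∘ f) :=
  simplexModule_ext fun y => by
    rw [LinearMap.comp_apply, simplexMap_single, simplexMap_single, simplexMap_single]; rfl

theorem simplexMap_id (n : ℕ) :
    (simplexMap id : SimplexModule k Y n →ₗ[k] SimplexModule k Y n) = LinearMap.id :=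
  simplexModule_ext fun y => by rw [simplexMap_single]; rfl

/-- Delete the vertex `i`. -/
def simplexFace (n : ℕ) (i : Fin (n + 2)) : SimplexModule k Y (n + 1) →ₗ[k] SimplexModule k Y n :=
  simplexMap fun h j => h (i.succAbove j)

/-- The simplicial boundary. -/
def simplexB (n : ℕ) : SimplexModule k Y (n + 1) →ₗ[k] SimplexModule k Y n :=
  ∑ i : Fin (n + 2), (-1 : k) ^ (i : ℕ) • simplexFace n i

/-- The alternating sum of all faces but the last. -/
def simplexB' (n : ℕ) : SimplexModule k Y (n + 1) →ₗ[k] SimplexModule k Y n :=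
  ∑ i : Fin (n + 1), (-1 : k) ^ (i : ℕ) • simplexFace n i.castSucc

theorem simplexFace_comp (n : ℕ) (i j : Fin (n + 2)) (h : i ≤ j) :
    (simplexFace n i ∘ₗ simplexFace (n + 1) j.succ : SimplexModule k Y (n + 2) →ₗ[k] _) =
      simplexFace n j ∘ₗ simplexFace (n + 1) i.castSucc := by
  simp only [simplexFace, simplexMap_comp]
  congr 1
  funext y l
  simp only [Function.comp_apply]
  congr 1
  simp only [Fin.succAbove, Fin.lt_def, Fin.ext_iff, Fin.le_def, Fin.val_castSucc, Fin.val_succ] at h ⊢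
  split_ifs <;> first | omega | (simp only [Fin.val_castSucc, Fin.val_succ] at * <;> omega)

theorem simplexB_comp (n : ℕ) :
    (simplexB n ∘ₗ simplexB (n + 1) : SimplexModule k Y (n + 2) →ₗ[k] _) = 0 :=
  CyclicModule.alternating_comp _ _ (simplexFace_comp n)

theorem simplexB_simplexB (n : ℕ) (x : SimplexModule k Y (n + 2)) :
    simplexB n (simplexB (n + 1) x) = 0 := LinearMap.congr_fun (simplexB_comp n) x

/-- The sum of the coefficients. -/
def simplexAug (n : ℕ) : SimplexModule k Y n →ₗ[k] k := Finsupp.linearCombination k fun _ => 1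

theorem simplexAug_single (n : ℕ) (h : Fin (n + 1) → Y) (c : k) :
    simplexAug n (Finsupp.single h c) = c := by simp [simplexAug]

theorem simplexAug_simplexMap {n m : ℕ} (f : (Fin (n + 1) → Y) → (Fin (m + 1) → Y))
    (x : SimplexModule k Y n) : simplexAug m (simplexMap f x) = simplexAug n x :=
  LinearMap.congr_fun (f := simplexAug m ∘ₗ simplexMap f) (simplexModule_ext fun y => by
    rw [LinearMap.comp_apply, simplexMap_single, simplexAug_single, simplexAug_single]) x

theorem simplexAug_simplexB (x : SimplexModule k Y 1) : simplexAug 0 (simplexB 0 x) = 0 := by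
  simp [simplexB, simplexFace, Fin.sum_univ_two, simplexAug_simplexMap]

/-- The cone with apex `y`. -/
def cone (y : Y) (n : ℕ) : SimplexModule k Y n →ₗ[k] SimplexModule k Y (n + 1) :=
  simplexMap fun h => Fin.cons (α := fun _ => Y) y h

theorem simplexFace_zero_cone (y : Y) (n : ℕ) (x : SimplexModule k Y n) :
    simplexFace n 0 (cone y n x) = x := by
  refine LinearMap.congr_fun (f := simplexFace n 0 ∘ₗ cone y n) (g := LinearMap.id) ?_ x
  rw [simplexFace, cone, simplexMap_comp, ← simplexMap_id]
  rfl

theorem simplexFace_succ_cone (y : Y) (n : ℕ) (i : Fin (n + 2)) (x : SimplexModule k Y (n + 1)) :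
    simplexFace (n + 1) i.succ (cone y (n + 1) x) = cone y n (simplexFace n i x) := by
  refine LinearMap.congr_fun (f := simplexFace (n + 1) i.succ ∘ₗ cone y (n + 1))
    (g := cone y n ∘ₗ simplexFace n i) ?_ x
  simp only [simplexFace, cone, simplexMap_comp]
  congr 1
  funext h j
  simp only [Function.comp_apply]
  refine Fin.cases ?_ (fun j => ?_) j
  · simp
  · simp [Fin.succ_succAbove_succ]

/-- Face `0` removes the apex, while face `i + 1` acts as face `i` on the base with the opposite
sign. The cone is thus a contraction of the augmented complex. -/
theorem simplexB_cone (y : Y) (n : ℕ) (x : SimplexModule k Y (n + 1)) :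
    simplexB (n + 1) (cone y (n + 1) x) = x - cone y n (simplexB n x) := by
  rw [simplexB, LinearMap.sum_apply, Fin.sum_univ_succ, simplexB, LinearMap.sum_apply, map_sum,
    sub_eq_add_neg, ← Finset.sum_neg_distrib]
  congr 1
  · simp [simplexFace_zero_cone]
  · refine Finset.sum_congr rfl fun i _ => ?_
    simp [simplexFace_succ_cone, pow_succ]

/-- In degree `0` the second face of the cone is the apex times the augmentation, which vanishes
here. -/
theorem simplexB_cone_zero (y : Y) (x : SimplexModule k Y 0) (hx : simplexAug 0 x = 0) :
    simplexB 0 (cone y 0 x) = x := by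
  have h : (simplexFace 0 1 ∘ₗ cone y 0 : SimplexModule k Y 0 →ₗ[k] _) =
      (LinearMap.toSpanSingleton k _ (Finsupp.single (fun _ => y) 1)) ∘ₗ simplexAug 0 :=
    simplexModule_ext fun h => by
      rw [LinearMap.comp_apply, LinearMap.comp_apply, cone, simplexMap_single, simplexFace,
        simplexMap_single, simplexAug_single, LinearMap.toSpanSingleton_apply, one_smul]
      congr 1
      funext j
      fin_cases j
      rfl
  have h' := LinearMap.congr_fun h x
  rw [LinearMap.comp_apply, LinearMap.comp_apply, hx, map_zero] at h'
  rw [simplexB, LinearMap.sum_apply, Fin.sum_univ_two]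
  simp [simplexFace_zero_cone, h']

/-- The contraction `(h₀,…,hₙ) ↦ (hₙ,h₀,…,hₙ)` of the complex with differential `simplexB'`. -/
def lastCone (n : ℕ) : SimplexModule k Y n →ₗ[k] SimplexModule k Y (n + 1) :=
  simplexMap fun h => Fin.cons (α := fun _ => Y) (h (Fin.last n)) h

theorem simplexB'_lastCone_zero (x : SimplexModule k Y 0) : simplexB' 0 (lastCone 0 x) = x := by
  refine LinearMap.congr_fun (f := simplexB' 0 ∘ₗ lastCone 0) (g := LinearMap.id)
    (simplexModule_ext fun h => ?_) x
  rw [LinearMap.comp_apply, lastCone, simplexMap_single, simplexB']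
  simp [simplexFace, simplexMap_single]

/-- No face occurring in `simplexB'` deletes the last vertex, so prefixing a copy of that vertex
commutes with these faces. Unlike a cone with fixed apex, this contraction is equivariant. -/
theorem simplexB'_lastCone (n : ℕ) (x : SimplexModule k Y (n + 1)) :
    simplexB' (n + 1) (lastCone (n + 1) x) = x - lastCone n (simplexB' n x) := by
  refine LinearMap.congr_fun (f := simplexB' (n + 1) ∘ₗ lastCone (n + 1))
    (g := LinearMap.id - lastCone n ∘ₗ simplexB' n) (simplexModule_ext fun h => ?_) x
  simp only [LinearMap.comp_apply, LinearMap.sub_apply, LinearMap.id_apply]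
  rw [lastCone, simplexMap_single, simplexB', LinearMap.sum_apply, Fin.sum_univ_succ, simplexB',
    LinearMap.sum_apply, map_sum, sub_eq_add_neg, ← Finset.sum_neg_distrib]
  congr 1
  · simp [simplexFace, simplexMap_single]
  · refine Finset.sum_congr rfl fun i _ => ?_
    simp only [LinearMap.smul_apply, map_smul, simplexFace, simplexMap_single, lastCone]
    rw [Fin.val_succ, pow_succ, mul_neg_one, neg_smul]
    congr 3
    funext j
    refine Fin.cases ?_ (fun j => ?_) j
    · simp
    · rw [← Fin.succ_castSucc, Fin.succ_succAbove_succ, Fin.cons_succ, Fin.cons_succ]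

/-- The map `h ↦ cone (h 0) (φ h)` on simplices. -/
def coneMap {n m : ℕ} (φ : SimplexModule k Y n →ₗ[k] SimplexModule k Y m) :
    SimplexModule k Y n →ₗ[k] SimplexModule k Y (m + 1) :=
  Finsupp.linearCombination k fun h => cone (h 0) m (φ (Finsupp.single h 1))

theorem coneMap_single {n m : ℕ} (φ : SimplexModule k Y n →ₗ[k] SimplexModule k Y m) (h) :
    coneMap φ (Finsupp.single h 1) = cone (h 0) m (φ (Finsupp.single h 1)) := by
  simp [coneMap]

/-- Any map with values in cycles gets a primitive. Taking the first vertex of the argument as apex,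
rather than a fixed one, keeps the construction equivariant (`coneMap_simplexRep`). -/
theorem simplexB_coneMap {n m : ℕ} (φ : SimplexModule k Y n →ₗ[k] SimplexModule k Y (m + 1))
    (hφ : ∀ x, simplexB m (φ x) = 0) (x) : simplexB (m + 1) (coneMap φ x) = φ x :=
  LinearMap.congr_fun (f := simplexB (m + 1) ∘ₗ coneMap φ) (simplexModule_ext fun h => by
    rw [LinearMap.comp_apply, coneMap_single, simplexB_cone, hφ, map_zero, sub_zero]) x

theorem simplexB_coneMap_zero {n : ℕ} (φ : SimplexModule k Y n →ₗ[k] SimplexModule k Y 0)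
    (hφ : ∀ x, simplexAug 0 (φ x) = 0) (x) : simplexB 0 (coneMap φ x) = φ x :=
  LinearMap.congr_fun (f := simplexB 0 ∘ₗ coneMap φ) (simplexModule_ext fun h => by
    rw [LinearMap.comp_apply, coneMap_single, simplexB_cone_zero _ _ (hφ _)]) x

end SimplexModules

/-! ### The paracyclic operator twisted by a group element. -/

section Paracyclic

variable {k : Type u} [CommRing k] {Γ : Type v} [Group Γ] {Y : Type w} [MulAction Γ Y]

variable (k Y) in
/-- The action on the module of simplices. -/
def simplexRep (n : ℕ) : Representation k Γ (SimplexModule k Y n) where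
  toFun γ := simplexMap fun h j => γ • h j
  map_one' := by
    rw [Module.End.one_eq_id, ← simplexMap_id]
    congr 1
    funext h j
    exact one_smul _ _
  map_mul' γ γ' := by
    rw [Module.End.mul_eq_comp, simplexMap_comp]
    congr 1
    funext h j
    exact mul_smul _ _ _

theorem simplexRep_apply (n : ℕ) (γ : Γ) :
    simplexRep k Y n γ = simplexMap fun h j => γ • h j := rfl

theorem simplexRep_single (n : ℕ) (γ : Γ) (h : Fin (n + 1) → Y) (c : k) :
    simplexRep k Y n γ (Finsupp.single h c) = Finsupp.single (fun j => γ • h j) c :=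
  simplexMap_single _ _ _

theorem simplexFace_simplexRep (n : ℕ) (i) (γ : Γ) (x) :
    simplexFace n i (simplexRep k Y (n + 1) γ x) = simplexRep k Y n γ (simplexFace n i x) :=
  LinearMap.congr_fun (f := simplexFace n i ∘ₗ simplexRep k Y (n + 1) γ)
    (g := simplexRep k Y n γ ∘ₗ simplexFace n i) (by
      simp only [simplexFace, simplexRep_apply, simplexMap_comp]; rfl) x

theorem simplexB_simplexRep (n : ℕ) (γ : Γ) (x) :
    simplexB n (simplexRep k Y (n + 1) γ x) = simplexRep k Y n γ (simplexB n x) := by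
  simp only [simplexB, LinearMap.sum_apply, LinearMap.smul_apply, map_sum, map_smul,
    simplexFace_simplexRep]

theorem lastCone_simplexRep (n : ℕ) (γ : Γ) (x) :
    lastCone n (simplexRep k Y n γ x) = simplexRep k Y (n + 1) γ (lastCone n x) := by
  refine LinearMap.congr_fun (f := lastCone n ∘ₗ simplexRep k Y n γ)
    (g := simplexRep k Y (n + 1) γ ∘ₗ lastCone n) ?_ x
  simp only [lastCone, simplexRep_apply, simplexMap_comp]
  congr 1
  funext h j
  refine Fin.cases ?_ (fun j => ?_) j <;> simp

theorem coneMap_simplexRep {n m : ℕ} (φ : SimplexModule k Y n →ₗ[k] SimplexModule k Y m) (γ : Γ)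
    (hφ : ∀ x, φ (simplexRep k Y n γ x) = simplexRep k Y m γ (φ x)) (x) :
    coneMap φ (simplexRep k Y n γ x) = simplexRep k Y (m + 1) γ (coneMap φ x) := by
  refine LinearMap.congr_fun (f := coneMap φ ∘ₗ simplexRep k Y n γ)
    (g := simplexRep k Y (m + 1) γ ∘ₗ coneMap φ) (simplexModule_ext fun h => ?_) x
  rw [LinearMap.comp_apply, LinearMap.comp_apply, simplexRep_single, coneMap_single,
    coneMap_single, ← simplexRep_single, hφ]
  generalize φ (Finsupp.single h 1) = y
  refine LinearMap.congr_fun (f := cone (γ • h 0) m ∘ₗ simplexRep k Y m γ)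
    (g := simplexRep k Y (m + 1) γ ∘ₗ cone (h 0) m) ?_ y
  simp only [cone, simplexRep_apply, simplexMap_comp]
  congr 1
  funext h j
  refine Fin.cases ?_ (fun j => ?_) j <;> simp

variable (z : Γ)

/-- The rotation `(h₀,…,hₙ) ↦ (z⁻¹hₙ,h₀,…,hₙ₋₁)`. -/
def rotateSimplex (n : ℕ) (h : Fin (n + 1) → Y) : Fin (n + 1) → Y :=
  Fin.cons (α := fun _ => Y) (z⁻¹ • h (Fin.last n)) fun j => h j.castSucc

/-- The paracyclic operator. -/
def simplexRot (n : ℕ) : SimplexModule k Y n →ₗ[k] SimplexModule k Y n :=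
  simplexMap (rotateSimplex z n)

/-- The signed paracyclic operator. -/
def simplexT (n : ℕ) : Module.End k (SimplexModule k Y n) := (-1 : k) ^ n • simplexRot z n

/-- After `m` rotations the last `m` vertices have moved to the front, each having picked up `z⁻¹`.
The bound `m ≤ n + 1` ensures that none is wrapped around twice. -/
theorem rotateSimplex_iterate (n m : ℕ) (hm : m ≤ n + 1) (h : Fin (n + 1) → Y) (j : Fin (n + 1)) :
    (rotateSimplex z n)^[m] h j = if hj : (j : ℕ) < m then z⁻¹ • h ⟨j + (n + 1) - m, by omega⟩
      else h ⟨j - m, by omega⟩ := by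
  induction m generalizing j with
  | zero => simp
  | succ m ih =>
    rw [Function.iterate_succ_apply', rotateSimplex]
    refine Fin.cases ?_ (fun j => ?_) j
    · rw [Fin.cons_zero, ih (by omega), dif_neg (by simp; omega), dif_pos (by simp)]
      congr 2
      apply Fin.ext
      simp
    · rw [Fin.cons_succ, ih (by omega)]
      simp only [Fin.val_castSucc, Fin.val_succ, Nat.add_lt_add_iff_right]
      split_ifs
      · congr 2; apply Fin.ext; simp only; omega
      · congr 1; apply Fin.ext; simp only; omega

theorem simplexRot_pow (n m : ℕ) :
    (simplexRot z n : Module.End k (SimplexModule k Y n)) ^ m =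
      simplexMap (rotateSimplex z n)^[m] := by
  induction m with
  | zero => exact (simplexMap_id n).symm
  | succ m ih =>
    rw [pow_succ, ih, Module.End.mul_eq_comp, simplexRot, simplexMap_comp]
    rfl

/-- In a full turn every vertex is wrapped around exactly once and is moved by `z⁻¹`. Hence dividing
by the action of `z` makes the rotation cyclic. -/
theorem simplexRot_pow_succ (n : ℕ) :
    (simplexRot z n : Module.End k (SimplexModule k Y n)) ^ (n + 1) = simplexRep k Y n z⁻¹ := by
  rw [simplexRot_pow, simplexRep_apply]
  congr 1
  funext h j
  rw [rotateSimplex_iterate z n _ le_rfl, dif_pos j.2]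
  congr 2
  apply Fin.ext
  simp

theorem simplexT_pow_succ (n : ℕ) :
    (simplexT z n : Module.End k (SimplexModule k Y n)) ^ (n + 1) = simplexRep k Y n z⁻¹ := by
  rw [simplexT, smul_pow, simplexRot_pow_succ, ← pow_mul,
    Even.neg_one_pow (Nat.even_mul_succ_self n), one_smul]

theorem simplexFace_zero_rot (n : ℕ) :
    (simplexFace n 0 ∘ₗ simplexRot z (n + 1) : SimplexModule k Y (n + 1) →ₗ[k] _) =
      simplexFace n (Fin.last (n + 1)) := by
  simp only [simplexFace, simplexRot, simplexMap_comp]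
  congr 1
  funext h j
  simp [rotateSimplex]

theorem simplexFace_succ_rot (n : ℕ) (i : Fin (n + 1)) :
    (simplexFace n i.succ ∘ₗ simplexRot z (n + 1) : SimplexModule k Y (n + 1) →ₗ[k] _) =
      simplexRot z n ∘ₗ simplexFace n i.castSucc := by
  simp only [simplexFace, simplexRot, simplexMap_comp]
  congr 1
  funext h j
  simp only [Function.comp_apply, rotateSimplex]
  refine Fin.cases ?_ (fun j => ?_) j
  · simp
  · rw [Fin.succ_succAbove_succ, Fin.cons_succ, Fin.cons_succ, Fin.castSucc_succAbove_castSucc]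

/-- Only the relations between faces and rotation enter, not the order of the rotation, so the
identity already holds before dividing by `z`. -/
theorem simplexB_one_sub_T (n : ℕ) (x : SimplexModule k Y (n + 1)) :
    simplexB n (x - simplexT z (n + 1) x) = simplexB' n x - simplexT z n (simplexB' n x) := by
  have h1 : simplexB n (simplexT z (n + 1) x) =
      (-1 : k) ^ (n + 1) • simplexFace n (Fin.last (n + 1)) x + simplexT z n (simplexB' n x) := by
    rw [simplexB, LinearMap.sum_apply, Fin.sum_univ_succ, simplexB', LinearMap.sum_apply, map_sum]
    congr 1
    · simp [simplexT, ← simplexFace_zero_rot z]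
    · refine Finset.sum_congr rfl fun i _ => ?_
      have := LinearMap.congr_fun (simplexFace_succ_rot (k := k) z n i) x
      simp only [LinearMap.comp_apply] at this
      simp only [simplexT, LinearMap.smul_apply, map_smul, this, smul_smul, Fin.val_succ]
      congr 1
      ring
  have h2 : simplexB n x = simplexB' n x + (-1 : k) ^ (n + 1) • simplexFace n (Fin.last (n + 1)) x := by
    rw [simplexB, LinearMap.sum_apply, Fin.sum_univ_castSucc, simplexB', LinearMap.sum_apply]
    simp
  rw [map_sub, h1, h2]
  abel

variable {z}

theorem simplexRot_simplexRep (n : ℕ) (γ : Γ) (hz : Commute γ z) (x) :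
    simplexRot z n (simplexRep k Y n γ x) = simplexRep k Y n γ (simplexRot z n x) := by
  refine LinearMap.congr_fun (f := simplexRot z n ∘ₗ simplexRep k Y n γ)
    (g := simplexRep k Y n γ ∘ₗ simplexRot z n) ?_ x
  simp only [simplexRot, simplexRep_apply, simplexMap_comp]
  congr 1
  funext h j
  simp only [Function.comp_apply, rotateSimplex]
  refine Fin.cases ?_ (fun j => ?_) j
  · simp only [Fin.cons_zero, smul_smul, hz.inv_right.eq]
  · simp

theorem simplexT_simplexRep (n : ℕ) (γ : Γ) (hz : Commute γ z) (x) :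
    simplexT z n (simplexRep k Y n γ x) = simplexRep k Y n γ (simplexT z n x) := by
  simp [simplexT, simplexRot_simplexRep n γ hz]

/-- If the central element has infinite order and the action is free, then `1 - T` is injective. -/
theorem eq_zero_of_simplexT_eq (hz : ¬ IsOfFinOrder z) (hfree : ∀ (γ : Γ) (y : Y), γ • y = y → γ = 1)
    (n : ℕ) (x : SimplexModule k Y n) (hx : simplexT z n x = x) : x = 0 := by
  have h1 : ∀ m : ℕ, ((simplexT z n : Module.End k (SimplexModule k Y n)) ^ m) x = x := fun m => by
    induction m with
    | zero => rfl
    | succ m ih => rw [pow_succ, Module.End.mul_apply, hx, ih]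
  -- The power `(n + 1) m` of `T` is the action of `z⁻¹ ^ m`, so an invariant of `T` is invariant
  -- under all of these.
  have h2 : ∀ m : ℕ, simplexRep k Y n (z⁻¹ ^ m) x = x := fun m => by
    rw [map_pow, ← simplexT_pow_succ, ← pow_mul, h1]
  by_contra h0
  obtain ⟨h, hh⟩ := Finsupp.ne_iff.1 h0
  have h3 : ∀ m : ℕ, x (fun j => z⁻¹ ^ m • h j) = x h := fun m => by
    conv_lhs => rw [← h2 m, simplexRep_apply, simplexMap, Finsupp.lmapDomain_apply]
    refine Finsupp.mapDomain_apply (f := fun (h : Fin (n + 1) → Y) j => z⁻¹ ^ m • h j) ?_ x h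
    intro a b hab
    funext j
    exact MulAction.injective _ (congrFun hab j)
  have h4 : Function.Injective fun m : ℕ => (fun j => z⁻¹ ^ m • h j : Fin (n + 1) → Y) := by
    intro a b hab
    refine (injective_pow_iff_not_isOfFinOrder (x := z⁻¹)).2 (by simpa using hz) ?_
    have : z⁻¹ ^ a • h 0 = z⁻¹ ^ b • h 0 := congrFun hab 0
    have := hfree ((z⁻¹ ^ b)⁻¹ * z⁻¹ ^ a) (h 0) (by rw [mul_smul, this, inv_smul_smul])
    exact (inv_mul_eq_one.1 this).symm
  -- A nonzero coefficient would recur along an infinite orbit of simplices, contradicting finite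
  -- support.
  refine (Set.infinite_range_of_injective h4) (x.support.finite_toSet.subset ?_)
  rintro _ ⟨m, rfl⟩
  simp only [Finset.mem_coe, Finsupp.mem_support_iff, h3]
  exact hh

end Paracyclic

/-! ### The quotient by `⟨z⟩` as a cyclic module with projective terms. -/

section ParacyclicQuotient

variable {k : Type u} [CommRing k] {Γ : Type u} [Group Γ] {Y : Type u} [MulAction Γ Y]

variable (k Y) in
/-- The quotient of the module of simplices by the action of `z`. -/
abbrev SimplexQuotient (z : Γ) (n : ℕ) : Type u :=
  SimplexModule k Y n ⧸ LinearMap.range (1 - simplexRep k Y n z)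

variable {z : Γ}

theorem simplexQuotient_mk_eq_zero {n : ℕ} {x : SimplexModule k Y n} :
    (Submodule.Quotient.mk x : SimplexQuotient k Y z n) = 0 ↔
      ∃ y, y - simplexRep k Y n z y = x := Submodule.Quotient.mk_eq_zero _

theorem simplexQuotient_mk_smul (n : ℕ) (x : SimplexModule k Y n) :
    (Submodule.Quotient.mk (simplexRep k Y n z x) : SimplexQuotient k Y z n) =
      Submodule.Quotient.mk x :=
  Eq.symm ((Submodule.Quotient.eq (LinearMap.range (1 - simplexRep k Y n z))).2 ⟨x, rfl⟩)

/-- The map induced on the quotients by an equivariant map. -/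
def simplexQuotientMap {n m : ℕ} (f : SimplexModule k Y n →ₗ[k] SimplexModule k Y m)
    (hf : ∀ x, f (simplexRep k Y n z x) = simplexRep k Y m z (f x)) :
    SimplexQuotient k Y z n →ₗ[k] SimplexQuotient k Y z m :=
  Submodule.mapQ _ _ f <| by
    rintro _ ⟨x, rfl⟩
    exact ⟨f x, by simp [hf]⟩

theorem simplexQuotientMap_mk {n m : ℕ} (f : SimplexModule k Y n →ₗ[k] SimplexModule k Y m)
    (hf : ∀ x, f (simplexRep k Y n z x) = simplexRep k Y m z (f x)) (x) :
    simplexQuotientMap f hf (Submodule.Quotient.mk x) = Submodule.Quotient.mk (f x) := rfl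

theorem simplexRep_comm {γ : Γ} (h : Commute γ z) (n : ℕ) (x) :
    simplexRep k Y n γ (simplexRep k Y n z x) = simplexRep k Y n z (simplexRep k Y n γ x) := by
  rw [← Module.End.mul_apply, ← map_mul, h.eq, map_mul, Module.End.mul_apply]

/-- The action on the quotient. -/
def simplexQuotientRep (hz : ∀ γ : Γ, Commute γ z) (n : ℕ) :
    Representation k Γ (SimplexQuotient k Y z n) where
  toFun γ := simplexQuotientMap (simplexRep k Y n γ) (simplexRep_comm (hz γ) n)
  map_one' := Submodule.linearMap_qext _ (LinearMap.ext fun x => by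
    change Submodule.Quotient.mk (simplexRep k Y n 1 x) = Submodule.Quotient.mk x
    rw [map_one]; rfl)
  map_mul' γ γ' := Submodule.linearMap_qext _ (LinearMap.ext fun x => by
    change Submodule.Quotient.mk (simplexRep k Y n (γ * γ') x) =
      Submodule.Quotient.mk (simplexRep k Y n γ (simplexRep k Y n γ' x))
    rw [map_mul]; rfl)

instance simplexQuotientRep_isTrivial (hz : ∀ γ : Γ, Commute γ z) (n : ℕ) :
    Representation.IsTrivial (MonoidHom.comp (simplexQuotientRep (k := k) (Y := Y) hz n)
      (Subgroup.zpowers z).subtype) := by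
  have : Subgroup.zpowers z ≤ MonoidHom.ker (simplexQuotientRep (k := k) (Y := Y) hz n) :=
    Subgroup.zpowers_le.2 (MonoidHom.mem_ker.2
      (Submodule.linearMap_qext _ (LinearMap.ext fun x => simplexQuotient_mk_smul n x)))
  exact ⟨fun g => MonoidHom.mem_ker.1 (this g.2)⟩

variable [(Subgroup.zpowers z).Normal]

variable (k Y) in
/-- The quotient of the paracyclic module of simplices by the action of `z`, as a cyclic module with
an action of `Γ / ⟨z⟩`. -/
def simplexCyclicModule (hz : ∀ γ : Γ, Commute γ z) :
    EquivariantCyclicModule k (Γ ⧸ Subgroup.zpowers z) where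
  X n := SimplexQuotient k Y z n
  d n i := simplexQuotientMap (simplexFace n i) (simplexFace_simplexRep n i z)
  t n := simplexQuotientMap (simplexRot z n) (simplexRot_simplexRep n z (hz z))
  d_comp_d n i j hij := Submodule.linearMap_qext _ (LinearMap.ext fun x =>
    congrArg Submodule.Quotient.mk (LinearMap.congr_fun (simplexFace_comp n i j hij) x))
  d_zero_comp_t n := Submodule.linearMap_qext _ (LinearMap.ext fun x =>
    congrArg Submodule.Quotient.mk (LinearMap.congr_fun (simplexFace_zero_rot z n) x))
  d_succ_comp_t n i := Submodule.linearMap_qext _ (LinearMap.ext fun x =>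
    congrArg Submodule.Quotient.mk (LinearMap.congr_fun (simplexFace_succ_rot z n i) x))
  t_pow n := Submodule.linearMap_qext _ (LinearMap.ext fun x => by
    have h : ∀ m, (simplexQuotientMap (simplexRot z n) (simplexRot_simplexRep n z (hz z)) ^ m)
        (Submodule.Quotient.mk x) = (Submodule.Quotient.mk ((simplexRot z n ^ m) x) :
          SimplexQuotient k Y z n) := fun m => by
      induction m with
      | zero => rfl
      | succ m ih => rw [pow_succ', Module.End.mul_apply, ih, simplexQuotientMap_mk, pow_succ',
          Module.End.mul_apply]
    -- The full turn is the action of `z⁻¹`, which is trivial on the quotient.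
    refine (h (n + 1)).trans ?_
    rw [simplexRot_pow_succ, ← simplexQuotient_mk_smul, ← Module.End.mul_apply, ← map_mul,
      mul_inv_cancel, map_one]
    rfl)
  ρ n := (simplexQuotientRep hz n).ofQuotient (Subgroup.zpowers z)
  d_ρ n i g x := by
    induction g using QuotientGroup.induction_on with | _ γ
    obtain ⟨x, rfl⟩ := Submodule.Quotient.mk_surjective _ x
    exact congrArg Submodule.Quotient.mk (simplexFace_simplexRep n i γ x)
  t_ρ n g x := by
    induction g using QuotientGroup.induction_on with | _ γ
    obtain ⟨x, rfl⟩ := Submodule.Quotient.mk_surjective _ x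
    exact congrArg Submodule.Quotient.mk (simplexRot_simplexRep n γ (hz γ) x)

namespace simplexCyclicModule

variable (hz : ∀ γ : Γ, Commute γ z)

/-- The projection from the module of simplices. -/
def proj (n : ℕ) : SimplexModule k Y n →ₗ[k] (simplexCyclicModule k Y hz).X n :=
  Submodule.mkQ _

theorem proj_surjective (n : ℕ) : Function.Surjective (proj (k := k) (Y := Y) hz n) :=
  Submodule.mkQ_surjective _

theorem proj_eq_zero {n : ℕ} {x : SimplexModule k Y n} :
    proj hz n x = 0 ↔ ∃ y, y - simplexRep k Y n z y = x := simplexQuotient_mk_eq_zero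

theorem proj_rep (n : ℕ) (γ : Γ) (x : SimplexModule k Y n) :
    proj hz n (simplexRep k Y n γ x) =
      (simplexCyclicModule k Y hz).ρ n (γ : Γ ⧸ Subgroup.zpowers z) (proj hz n x) := rfl

theorem proj_b (n : ℕ) (x : SimplexModule k Y (n + 1)) :
    (simplexCyclicModule k Y hz).b n (proj hz (n + 1) x) = proj hz n (simplexB n x) := by
  simp only [CyclicModule.b, simplexB, LinearMap.sum_apply, map_sum, LinearMap.smul_apply, map_smul]
  rfl

theorem proj_b' (n : ℕ) (x : SimplexModule k Y (n + 1)) :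
    (simplexCyclicModule k Y hz).b' n (proj hz (n + 1) x) = proj hz n (simplexB' n x) := by
  simp only [CyclicModule.b', simplexB', LinearMap.sum_apply, map_sum, LinearMap.smul_apply,
    map_smul]
  rfl

theorem proj_T (n : ℕ) (x : SimplexModule k Y n) :
    (simplexCyclicModule k Y hz).T n (proj hz n x) = proj hz n (simplexT z n x) := by
  simp only [CyclicModule.T, simplexT, LinearMap.smul_apply, map_smul]
  rfl

/-- The map of quotients induced by an equivariant map. -/
def descend {n m : ℕ} (f : SimplexModule k Y n →ₗ[k] SimplexModule k Y m)
    (hf : ∀ (γ : Γ) x, f (simplexRep k Y n γ x) = simplexRep k Y m γ (f x)) :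
    (simplexCyclicModule k Y hz).X n →ₗ[k] (simplexCyclicModule k Y hz).X m :=
  simplexQuotientMap f (hf z)

theorem descend_proj {n m : ℕ} (f : SimplexModule k Y n →ₗ[k] SimplexModule k Y m)
    (hf : ∀ (γ : Γ) x, f (simplexRep k Y n γ x) = simplexRep k Y m γ (f x)) (x) :
    descend hz f hf (proj hz n x) = proj hz m (f x) := rfl

theorem descend_ρ {n m : ℕ} (f : SimplexModule k Y n →ₗ[k] SimplexModule k Y m)
    (hf : ∀ (γ : Γ) x, f (simplexRep k Y n γ x) = simplexRep k Y m γ (f x))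
    (g : Γ ⧸ Subgroup.zpowers z) (x) :
    descend hz f hf ((simplexCyclicModule k Y hz).ρ n g x) =
      (simplexCyclicModule k Y hz).ρ m g (descend hz f hf x) := by
  induction g using QuotientGroup.induction_on with | _ γ
  obtain ⟨x, rfl⟩ := proj_surjective hz n x
  rw [← proj_rep, descend_proj, descend_proj, hf, proj_rep]

/-- The augmentation of the quotient. -/
def aug : (simplexCyclicModule k Y hz).X 0 →ₗ[k] k :=
  Submodule.liftQ _ (simplexAug 0) <| by
    rintro _ ⟨x, rfl⟩
    simp [simplexRep_apply, simplexAug_simplexMap]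

theorem aug_proj (x : SimplexModule k Y 0) : aug hz (proj hz 0 x) = simplexAug 0 x := rfl

theorem aug_ρ (g : Γ ⧸ Subgroup.zpowers z) (x) :
    aug hz ((simplexCyclicModule k Y hz).ρ 0 g x) = aug hz x := by
  induction g using QuotientGroup.induction_on with | _ γ
  obtain ⟨x, rfl⟩ := proj_surjective hz 0 x
  rw [← proj_rep, aug_proj, aug_proj, simplexRep_apply, simplexAug_simplexMap]

theorem exists_aug_eq_one [Nonempty Y] : ∃ x, aug (k := k) (Y := Y) hz x = 1 :=
  ⟨proj hz 0 (Finsupp.single (fun _ => Classical.arbitrary Y) 1), by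
    rw [aug_proj, simplexAug_single]⟩

theorem aug_b (x) : aug (k := k) (Y := Y) hz ((simplexCyclicModule k Y hz).b 0 x) = 0 := by
  obtain ⟨x, rfl⟩ := proj_surjective hz 1 x
  rw [proj_b, aug_proj, simplexAug_simplexB]

theorem aug_T (x) : aug (k := k) (Y := Y) hz ((simplexCyclicModule k Y hz).T 0 x) = aug hz x := by
  obtain ⟨x, rfl⟩ := proj_surjective hz 0 x
  rw [proj_T, aug_proj, aug_proj, simplexT, pow_zero, one_smul, simplexRot, simplexAug_simplexMap]

theorem exists_b_zero_eq [Nonempty Y] (x) (hx : aug (k := k) (Y := Y) hz x = 0) :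
    ∃ y, (simplexCyclicModule k Y hz).b 0 y = x := by
  obtain ⟨x, rfl⟩ := proj_surjective hz 0 x
  exact ⟨proj hz 1 (cone (Classical.arbitrary Y) 0 x), by
    rw [proj_b, simplexB_cone_zero _ _ hx]⟩

/-- The modules of the quotient are projective if the action on the vertices is free. -/
theorem projective (hfree : ∀ (γ : Γ) (y : Y), γ • y = y → γ = 1) (n : ℕ) :
    Projective (Rep.of ((simplexCyclicModule k Y hz).ρ n)) := by
  refine ⟨fun {E X} f e he => ?_⟩
  have hsurj := (Rep.epi_iff_surjective e).1 he
  choose s hs using hsurj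
  -- A lift is prescribed on one simplex per `Γ`-orbit and spread by translation. Freeness makes the
  -- translating element `γ h` unique, hence equivariant in `h`.
  let o : (Fin (n + 1) → Y) → Quotient (MulAction.orbitRel Γ (Fin (n + 1) → Y)) := Quotient.mk _
  have h1 : ∀ h : Fin (n + 1) → Y, ∃ γ : Γ, γ • (o h).out = h := fun h => by
    obtain ⟨γ, hγ⟩ := Quotient.mk_out (s := MulAction.orbitRel Γ (Fin (n + 1) → Y)) h
    exact ⟨γ⁻¹, inv_smul_eq_iff.2 hγ.symm⟩
  choose γ hγ using h1
  have h2 : ∀ (g : Γ) h, γ (fun j => g • h j) = g * γ h := by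
    intro g h
    have ho : o (fun j => g • h j) = o h := Quotient.sound ⟨g, rfl⟩
    have e1 := hγ (fun j => g • h j)
    rw [ho] at e1
    have e2 : (g * γ h) • (o h).out = fun j => g • h j := by
      rw [mul_smul, hγ]; rfl
    have e3 : ((g * γ h)⁻¹ * γ (fun j => g • h j)) • (o h).out = (o h).out := by
      rw [mul_smul, e1, ← e2, inv_smul_smul]
    exact (inv_mul_eq_one.1 (hfree _ _ (congrFun e3 0))).symm
  let F : SimplexModule k Y n →ₗ[k] E := Finsupp.linearCombination k fun h =>
    E.ρ (γ h : Γ ⧸ Subgroup.zpowers z) (s (f.hom (proj hz n (Finsupp.single (o h).out 1))))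
  have hF : ∀ (g : Γ) x, F (simplexRep k Y n g x) = E.ρ (g : Γ ⧸ Subgroup.zpowers z) (F x) := by
    intro g x
    refine LinearMap.congr_fun (f := F ∘ₗ simplexRep k Y n g) (g := E.ρ g ∘ₗ F)
      (simplexModule_ext fun h => ?_) x
    have ho : o (fun j => g • h j) = o h := Quotient.sound ⟨g, rfl⟩
    rw [LinearMap.comp_apply, LinearMap.comp_apply, simplexRep_single]
    simp only [F, Finsupp.linearCombination_single, one_smul, h2, ho]
    rw [QuotientGroup.mk_mul, map_mul]
    rfl
  -- `F` descends to the quotient because `z` becomes trivial in `Γ ⧸ ⟨z⟩` and so acts trivially on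
  -- the target.
  let F' : (simplexCyclicModule k Y hz).X n →ₗ[k] E := Submodule.liftQ _ F <| by
    rintro _ ⟨x, rfl⟩
    have : (z : Γ ⧸ Subgroup.zpowers z) = 1 :=
      (QuotientGroup.eq_one_iff z).2 (Subgroup.mem_zpowers z)
    simp [hF, this]
  refine ⟨Rep.ofHom ⟨F', fun g => LinearMap.ext fun x => ?_⟩, ?_⟩
  · induction g using QuotientGroup.induction_on with | _ g
    obtain ⟨x, rfl⟩ := proj_surjective hz n x
    exact hF g x
  · refine Rep.hom_ext (Representation.IntertwiningMap.ext (LinearMap.ext fun x => ?_))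
    obtain ⟨x, rfl⟩ := proj_surjective hz n x
    refine LinearMap.congr_fun (f := e.hom.toLinearMap ∘ₗ F)
      (g := f.hom.toLinearMap ∘ₗ proj hz n) (simplexModule_ext fun h => ?_) x
    change e.hom (F _) = f.hom _
    simp only [F, Finsupp.linearCombination_single, one_smul]
    rw [Rep.hom_comm_apply, hs, ← Rep.hom_comm_apply]
    refine congrArg f.hom ?_
    refine (proj_rep hz n _ _).symm.trans ?_
    rw [simplexRep_single]
    congr 2
    exact hγ h

end simplexCyclicModule

end ParacyclicQuotient

/-! ### Averaging, and an invariant chain map homotopic to the identity. -/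

section PowerAverage

variable {k : Type u} [Field k] {M : Type v} [AddCommGroup M] [Module k M]

/-- The average of the first `N` powers of an endomorphism. -/
def powAverage (T : Module.End k M) (N : ℕ) : Module.End k M :=
  (N : k)⁻¹ • ∑ j ∈ Finset.range N, T ^ j

theorem powAverage_apply (T : Module.End k M) (N : ℕ) (x : M) :
    powAverage T N x = (N : k)⁻¹ • ∑ j ∈ Finset.range N, (T ^ j) x := by
  simp [powAverage, LinearMap.sum_apply]

theorem powAverage_map {T : Module.End k M} {N : ℕ} (h : T ^ N = 1) (x : M) :
    powAverage T N (T x) = powAverage T N x := by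
  rw [powAverage_apply, powAverage_apply]
  congr 1
  have e := Finset.sum_range_succ' (fun j => (T ^ j) x) N
  rw [Finset.sum_range_succ, h] at e
  simp only [pow_zero, add_left_inj] at e
  rw [e]
  exact Finset.sum_congr rfl fun j _ => by rw [pow_succ, Module.End.mul_apply]

theorem map_powAverage [CharZero k] {T : Module.End k M} {N : ℕ} (hN : N ≠ 0) {M' : Type*}
    [AddCommGroup M'] [Module k M'] (f : M →ₗ[k] M') (hf : ∀ x, f (T x) = f x) (x : M) :
    f (powAverage T N x) = f x := by
  have h : ∀ j, f ((T ^ j) x) = f x := fun j => by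
    induction j with
    | zero => rfl
    | succ j ih => rw [pow_succ', Module.End.mul_apply, hf, ih]
  rw [powAverage_apply, map_smul, map_sum, Finset.sum_congr rfl fun j _ => h j, Finset.sum_const,
    Finset.card_range, ← Nat.cast_smul_eq_nsmul k, smul_smul,
    inv_mul_cancel₀ (Nat.cast_ne_zero.2 hN), one_smul]

theorem powAverage_comm {T : Module.End k M} {N : ℕ} (f : M →ₗ[k] M)
    (hf : ∀ x, T (f x) = f (T x)) (x : M) : powAverage T N (f x) = f (powAverage T N x) := by
  have h : ∀ j, (T ^ j) (f x) = f ((T ^ j) x) := fun j => by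
    induction j with
    | zero => rfl
    | succ j ih => rw [pow_succ', Module.End.mul_apply, ih, hf, Module.End.mul_apply]
  rw [powAverage_apply, powAverage_apply, map_smul, map_sum, Finset.sum_congr rfl fun j _ => h j]

end PowerAverage

section CyclicInvariantChainMap

variable {k : Type u} [Field k] {Γ : Type v} [Group Γ] {Y : Type w} [MulAction Γ Y]

variable (k Y) in
/-- A chain endomorphism of the complex of simplices which is invariant under `T`. -/
def invariantMap (z : Γ) : ∀ n, Module.End k (SimplexModule k Y n)
  | 0 => powAverage (simplexT z 0) (orderOf z)
  -- In degree `n + 1` the operator `T` satisfies `T ^ ((n + 2) * orderOf z) = 1`, so the average is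
  -- invariant; `coneMap` then supplies the primitive that the chain map property requires.
  | n + 1 => coneMap (invariantMap z n ∘ₗ simplexB n) ∘ₗ
      powAverage (simplexT z (n + 1)) ((n + 2) * orderOf z)

theorem invariantMap_succ (z : Γ) (n : ℕ) (x) : invariantMap k Y z (n + 1) x =
    coneMap (invariantMap k Y z n ∘ₗ simplexB n)
      (powAverage (simplexT z (n + 1)) ((n + 2) * orderOf z) x) := rfl

theorem simplexT_pow_orderOf (z : Γ) (n : ℕ) :
    (simplexT z n : Module.End k (SimplexModule k Y n)) ^ ((n + 1) * orderOf z) = 1 := by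
  rw [pow_mul, simplexT_pow_succ, ← map_pow, inv_pow, pow_orderOf_eq_one, inv_one, map_one]

theorem invariantMap_T (z : Γ) (n : ℕ) (x) :
    invariantMap k Y z n (simplexT z n x) = invariantMap k Y z n x := by
  cases n with
  | zero =>
    refine powAverage_map ?_ x
    simpa using simplexT_pow_orderOf z 0
  | succ n =>
    rw [invariantMap_succ, invariantMap_succ,
      powAverage_map (simplexT_pow_orderOf z (n + 1))]

/-- From `b (1 - T) = (1 - T) b'`: invariance in degree `n` makes the boundary insensitive to `T`
one degree higher, so that averaging there does not disturb the chain map property. -/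
theorem invariantMap_simplexB_T (z : Γ) (n : ℕ) (x) :
    invariantMap k Y z n (simplexB n (simplexT z (n + 1) x)) =
      invariantMap k Y z n (simplexB n x) := by
  have h := congrArg (invariantMap k Y z n) (simplexB_one_sub_T z n x)
  rw [map_sub, map_sub, map_sub, invariantMap_T, sub_self, sub_eq_zero] at h
  exact h.symm

theorem invariantMap_rep {z : Γ} (hz : ∀ γ : Γ, Commute γ z) (n : ℕ) (γ : Γ) (x) :
    invariantMap k Y z n (simplexRep k Y n γ x) = simplexRep k Y n γ (invariantMap k Y z n x) := by
  have h : ∀ n N x, powAverage (simplexT z n) N (simplexRep k Y n γ x) =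
      simplexRep k Y n γ (powAverage (simplexT z n) N x) := fun n N =>
    powAverage_comm _ (simplexT_simplexRep n γ (hz γ))
  induction n with
  | zero => exact h 0 _ x
  | succ n ih =>
    rw [invariantMap_succ, invariantMap_succ, h]
    refine coneMap_simplexRep _ γ (fun x => ?_) _
    rw [LinearMap.comp_apply, LinearMap.comp_apply, simplexB_simplexRep, ih]

variable [CharZero k]

theorem simplexAug_invariantMap {z : Γ} (hz : IsOfFinOrder z) (x) :
    simplexAug 0 (invariantMap k Y z 0 x) = simplexAug 0 x :=
  map_powAverage hz.orderOf_pos.ne' _ (fun x => by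
    rw [simplexT, pow_zero, one_smul, simplexRot, simplexAug_simplexMap]) x

/-- By induction the map inside `coneMap` takes values in cycles, so its primitive has the
prescribed boundary; the average drops out because the preceding degree composed with `simplexB` is
invariant under `T`. -/
theorem simplexB_invariantMap {z : Γ} (hz : IsOfFinOrder z) (n : ℕ) (x) :
    simplexB n (invariantMap k Y z (n + 1) x) = invariantMap k Y z n (simplexB n x) := by
  have h : ∀ n x, invariantMap k Y z n (simplexB n (powAverage (simplexT z (n + 1))
      ((n + 2) * orderOf z) x)) = invariantMap k Y z n (simplexB n x) := fun n =>
    map_powAverage (mul_ne_zero (by omega) hz.orderOf_pos.ne')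
      (invariantMap k Y z n ∘ₗ simplexB n) (invariantMap_simplexB_T z n)
  induction n with
  | zero =>
    rw [invariantMap_succ, simplexB_coneMap_zero, LinearMap.comp_apply, h]
    intro x
    rw [LinearMap.comp_apply, simplexAug_invariantMap hz, simplexAug_simplexB]
  | succ n ih =>
    rw [invariantMap_succ, simplexB_coneMap, LinearMap.comp_apply, h]
    intro x
    rw [LinearMap.comp_apply, ih, simplexB_simplexB, map_zero]

variable (k Y) in
/-- A chain homotopy between the identity and `invariantMap`. -/
def invariantHomotopy (z : Γ) : ∀ n, SimplexModule k Y n →ₗ[k] SimplexModule k Y (n + 1)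
  | 0 => coneMap (1 - invariantMap k Y z 0)
  | n + 1 => coneMap (1 - invariantMap k Y z (n + 1) - invariantHomotopy z n ∘ₗ simplexB n)

omit [CharZero k] in
theorem invariantHomotopy_succ (z : Γ) (n : ℕ) : invariantHomotopy k Y z (n + 1) =
    coneMap (1 - invariantMap k Y z (n + 1) - invariantHomotopy k Y z n ∘ₗ simplexB n) := rfl

omit [CharZero k] in
theorem invariantHomotopy_rep {z : Γ} (hz : ∀ γ : Γ, Commute γ z) (n : ℕ) (γ : Γ) (x) :
    invariantHomotopy k Y z n (simplexRep k Y n γ x) =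
      simplexRep k Y (n + 1) γ (invariantHomotopy k Y z n x) := by
  induction n with
  | zero =>
    refine coneMap_simplexRep _ γ (fun x => ?_) _
    simp [invariantMap_rep hz]
  | succ n ih =>
    refine coneMap_simplexRep _ γ (fun x => ?_) _
    simp [invariantMap_rep hz, simplexB_simplexRep, ih]

theorem simplexB_invariantHomotopy_zero {z : Γ} (hz : IsOfFinOrder z) (x) :
    simplexB 0 (invariantHomotopy k Y z 0 x) = x - invariantMap k Y z 0 x := by
  rw [invariantHomotopy, simplexB_coneMap_zero]
  · simp
  · intro x
    simp [simplexAug_invariantMap hz]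

/-- The usual comparison argument: `x ↦ x - φ x - H ∂x`, with `φ` the invariant map and `H` the
homotopy already built, has values in cycles by the previous degree, and `coneMap` gives an
equivariant primitive. -/
theorem simplexB_invariantHomotopy {z : Γ} (hz : IsOfFinOrder z) (n : ℕ) (x) :
    simplexB (n + 1) (invariantHomotopy k Y z (n + 1) x) =
      x - invariantMap k Y z (n + 1) x - invariantHomotopy k Y z n (simplexB n x) := by
  induction n with
  | zero =>
    rw [invariantHomotopy_succ, simplexB_coneMap]
    · simp
    · intro x
      simp [simplexB_invariantMap hz, simplexB_invariantHomotopy_zero hz]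
  | succ n ih =>
    rw [invariantHomotopy_succ, simplexB_coneMap]
    · simp
    · intro x
      simp [simplexB_invariantMap hz, ih, simplexB_simplexB]

end CyclicInvariantChainMap

/-! ### Cyclic homology of the coinvariants for elements of infinite and of finite order. -/

section Resolution

variable {k : Type u} [Field k] [CharZero k] {Γ : Type u} [Group Γ] {Y : Type u} [MulAction Γ Y]
  {z : Γ} [(Subgroup.zpowers z).Normal] (hz : ∀ γ : Γ, Commute γ z)

namespace simplexCyclicModule

-- Exactness of column `0` modulo the image of `1 - T`, which holds because `1 - T` is injective
-- before passing to the quotient by `z`. A lifted relation is corrected upstairs, where `b` and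
-- `b'` have contractions.
omit [CharZero k] in
theorem exists_eq_b_add [Nonempty Y] (hinf : ¬ IsOfFinOrder z)
    (hfree : ∀ (γ : Γ) (y : Y), γ • y = y → γ = 1) (n : ℕ)
    (x : (simplexCyclicModule k Y hz).X (n + 1)) (y : (simplexCyclicModule k Y hz).X n)
    (h : (simplexCyclicModule k Y hz).b n x + (y - (simplexCyclicModule k Y hz).T n y) = 0) :
    ∃ u v, (simplexCyclicModule k Y hz).b (n + 1) u +
      (v - (simplexCyclicModule k Y hz).T (n + 1) v) = x := by
  obtain ⟨c, rfl⟩ := proj_surjective hz _ x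
  obtain ⟨w, rfl⟩ := proj_surjective hz _ y
  rw [proj_b, proj_T, ← map_sub, ← map_add, proj_eq_zero] at h
  obtain ⟨w', hw'⟩ := h
  -- The error from lifting is `w' - z w'`. Since `T ^ (n + 1) = z⁻¹`, it equals `-(1 - T ^ (n + 1))
  -- (z w')` and is absorbed into the image of `1 - T` by a geometric sum.
  have hT : ∃ w, w - simplexT z n w = simplexB n c := by
    have e : w' - simplexRep k Y n z w' = -(simplexRep k Y n z w' -
        ((simplexT z n : Module.End k (SimplexModule k Y n)) ^ (n + 1)) (simplexRep k Y n z w')) := by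
      rw [simplexT_pow_succ, ← Module.End.mul_apply, ← map_mul, inv_mul_cancel, map_one]
      simp
    let y := simplexRep k Y n z w'
    let s := (∑ j ∈ Finset.range (n + 1), (simplexT z n : Module.End k (SimplexModule k Y n)) ^ j) y
    have hs : s - simplexT z n s =
        y - ((simplexT z n : Module.End k (SimplexModule k Y n)) ^ (n + 1)) y := by
      have := LinearMap.congr_fun
        (mul_neg_geom_sum (simplexT z n : Module.End k (SimplexModule k Y n)) (n + 1)) y
      simpa [s, sub_mul, LinearMap.sum_apply, map_sum] using this
    refine ⟨-s - w, ?_⟩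
    have h2 : simplexB n c = w' - simplexRep k Y n z w' - (w - simplexT z n w) := by
      rw [hw']; abel
    rw [h2, e, ← hs]
    simp only [map_sub, map_neg]
    abel
  obtain ⟨w, hw⟩ := hT
  -- From `(1 - T) b' w = b (1 - T) w = b b c = 0` and injectivity of `1 - T`, `w` is a `b'`-cycle,
  -- hence a `b'`-boundary. In degree `0` no condition is needed.
  have hv : ∃ v, simplexB' n v = w := by
    cases n with
    | zero => exact ⟨_, simplexB'_lastCone_zero w⟩
    | succ n =>
      have : simplexB' n w = 0 := by
        refine eq_zero_of_simplexT_eq hinf hfree n _ ?_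
        have := simplexB_one_sub_T z n w
        rw [hw, simplexB_simplexB] at this
        exact (sub_eq_zero.1 this.symm).symm
      exact ⟨lastCone (n + 1) w, by rw [simplexB'_lastCone, this, map_zero, sub_zero]⟩
  obtain ⟨v, rfl⟩ := hv
  -- Now `c - (1 - T) v` is a cycle of simplices, and the cone over it bounds it.
  refine ⟨proj hz _ (cone (Classical.arbitrary Y) (n + 1) (c - (v - simplexT z (n + 1) v))),
    proj hz _ v, ?_⟩
  rw [proj_b, proj_T, simplexB_cone, map_sub (simplexB n) c, simplexB_one_sub_T, hw, sub_self,
    map_zero, sub_zero, map_sub, map_sub, sub_add_cancel]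

/-- If the central element has infinite order, the cyclic homology of the coinvariants is group
homology. -/
theorem nonempty_equiv_of_not_isOfFinOrder [Nonempty Y] (hinf : ¬ IsOfFinOrder z)
    (hfree : ∀ (γ : Γ) (y : Y), γ • y = y → γ = 1) (A : Rep.{u} k (Γ ⧸ Subgroup.zpowers z)) (n : ℕ) :
    Nonempty (LinHomology ((simplexCyclicModule k Y hz).coinv A.ρ).D n ≃ₗ[k] groupHomology A n) := by
  let W := simplexCyclicModule k Y hz
  obtain ⟨e⟩ := W.nonempty_groupHomology_equiv_D A (aug hz) (aug_ρ hz) (exists_aug_eq_one hz)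
    (fun w => by
      obtain ⟨w, rfl⟩ := W.tot_surjective 1 w
      rw [CyclicModule.D_tot]
      change aug hz (W.dComp 0 0 w) = 0
      rw [CyclicModule.dComp_even Even.zero, map_add, aug_b, zero_add]
      change aug hz (w 0 - W.T 0 (w 0)) = 0
      rw [map_sub, aug_T, sub_self])
    (fun w hw => by
      obtain ⟨w, rfl⟩ := W.tot_surjective 0 w
      obtain ⟨y, hy⟩ := exists_b_zero_eq hz (w 0) hw
      rw [CyclicModule.exists_D_eq]
      refine ⟨Pi.single 1 y, fun p q hpq => ?_⟩
      obtain ⟨rfl, rfl⟩ : p = 0 ∧ q = 0 := by omega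
      rw [CyclicModule.dComp_even Even.zero, Pi.single_eq_same,
        Pi.single_eq_of_ne (by omega), map_zero, add_zero]
      exact hy)
    -- The chain `y`, with `u` in column `0` and `v` in column `1`, clears column `0`. What remains
    -- is a boundary by exactness of the rows in characteristic `0`.
    (fun n w hw => by
      obtain ⟨w, rfl⟩ := W.tot_surjective (n + 1) w
      have hw' := CyclicModule.dFrom_tot (m := n + 1).1 hw
      have h0 := hw' 0 n (by omega)
      rw [CyclicModule.dComp_even Even.zero] at h0
      obtain ⟨u, v, huv⟩ := exists_eq_b_add hz hinf hfree n (w (n + 1)) (w n) h0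
      rw [CyclicModule.exists_D_eq]
      let y : ∀ q, W.X q := Pi.single (n + 2) u + Pi.single (n + 1) v
      let w' : ∀ q, W.X q := fun q => w q - W.dComp (n + 1 - q) q y
      have e1 : W.dComp 0 (n + 1) y = w (n + 1) := by
        rw [CyclicModule.dComp_even Even.zero, ← huv]
        simp only [y, Pi.add_apply, Pi.single_eq_same]
        rw [Pi.single_eq_of_ne (by omega), Pi.single_eq_of_ne (by omega), zero_add, add_zero]
        rfl
      obtain ⟨x, hx⟩ := CyclicModule.exists_boundary_of_column_zero (z := w') (m := n + 1) (by
        simp only [w', Nat.sub_self, e1, sub_self]) (fun p q hpq => by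
        have h1 : w' = w - fun q => W.dComp (n + 1 - q) q y := rfl
        rw [h1, map_sub, hw' p q hpq, CyclicModule.dComp_dComp p q _ hpq, sub_zero])
      refine ⟨x + y, fun p q hpq => ?_⟩
      rw [map_add, hx p q hpq]
      simp only [w']
      rw [show n + 1 - q = p by omega, sub_add_cancel])
    (projective hz hfree) n
  exact ⟨e.symm⟩

/-- Averaging over the finite group `⟨z⟩` turns a lift of a cycle of the quotient into a cycle of
simplices with the same image; the cone bounds it. -/
theorem exists_b_eq_of_isOfFinOrder [Nonempty Y] (hfin : IsOfFinOrder z) (n : ℕ)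
    (x : (simplexCyclicModule k Y hz).X (n + 1)) (hx : (simplexCyclicModule k Y hz).b n x = 0) :
    ∃ y, (simplexCyclicModule k Y hz).b (n + 1) y = x := by
  obtain ⟨c, rfl⟩ := proj_surjective hz _ x
  rw [proj_b, proj_eq_zero] at hx
  obtain ⟨w, hw⟩ := hx
  have hpow : ∀ n, simplexRep k Y n z ^ orderOf z = 1 := fun n => by
    rw [← map_pow, pow_orderOf_eq_one, map_one]
  let a := powAverage (simplexRep k Y (n + 1) z) (orderOf z) c
  have h1 : simplexB n a = 0 := by
    have e : simplexB n a = powAverage (simplexRep k Y n z) (orderOf z) (simplexB n c) := by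
      simp only [a, powAverage_apply, map_smul, map_sum]
      congr 1
      refine Finset.sum_congr rfl fun j _ => ?_
      rw [← map_pow, ← map_pow, simplexB_simplexRep]
    rw [e, ← hw, map_sub, powAverage_map (hpow n), sub_self]
  have h2 : proj hz (n + 1) a = proj hz (n + 1) c :=
    map_powAverage hfin.orderOf_pos.ne' (proj hz (n + 1))
      (fun x => simplexQuotient_mk_smul (n + 1) x) c
  refine ⟨proj hz _ (cone (Classical.arbitrary Y) _ a), ?_⟩
  rw [proj_b, simplexB_cone, h1, map_zero, sub_zero, h2]

end simplexCyclicModule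

end Resolution

namespace EquivariantCyclicModule

open Representation

variable {k Q : Type u} [CommRing k] [Group Q] (W : EquivariantCyclicModule k Q)
variable {M : Type u} [AddCommGroup M] [Module k M] (σ : Representation k Q M)

/-- The map on coinvariants induced by an equivariant map. -/
def coinvMapX {n m : ℕ} (f : W.X n →ₗ[k] W.X m) (hf : ∀ g x, f (W.ρ n g x) = W.ρ m g (f x)) :
    (W.coinv σ).X n →ₗ[k] (W.coinv σ).X m := coinvMap σ f hf

theorem coinvMapX_mkHom {n m : ℕ} (f : W.X n →ₗ[k] W.X m)
    (hf : ∀ g x, f (W.ρ n g x) = W.ρ m g (f x)) (a : M) (x : W.X n) :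
    W.coinvMapX σ f hf ((W.mkHom σ a).f n x) = (W.mkHom σ a).f m (f x) := rfl

theorem coinvX_ext {n : ℕ} {N : Type*} [AddCommGroup N] [Module k N]
    {f g : (W.coinv σ).X n →ₗ[k] N}
    (h : ∀ a x, f ((W.mkHom σ a).f n x) = g ((W.mkHom σ a).f n x)) : f = g := coinv_ext σ h

end EquivariantCyclicModule

section Resolution

variable {k : Type u} [Field k] [CharZero k] {Γ : Type u} [Group Γ] {Y : Type u} [MulAction Γ Y]
  {z : Γ} [(Subgroup.zpowers z).Normal] (hz : ∀ γ : Γ, Commute γ z)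

namespace simplexCyclicModule

open EquivariantCyclicModule

variable {M : Type u} [AddCommGroup M] [Module k M]
  (σ : Representation k (Γ ⧸ Subgroup.zpowers z) M)

-- The contraction `lastCone` is equivariant, so it survives both the quotient by `z` and the
-- passage to coinvariants with coefficients. A cone with fixed apex would not.
omit [CharZero k] in
theorem exists_b'_coinv (n : ℕ) (x : ((simplexCyclicModule k Y hz).coinv σ).X n)
    (hx : dFrom ((simplexCyclicModule k Y hz).coinv σ).b' n x = 0) :
    ∃ v, ((simplexCyclicModule k Y hz).coinv σ).b' n v = x := by
  let W := simplexCyclicModule k Y hz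
  let s := fun n => W.coinvMapX σ (descend hz (lastCone (k := k) (Y := Y) n)
    (fun γ x => lastCone_simplexRep n γ x)) (descend_ρ hz _ _)
  refine ⟨s n x, ?_⟩
  cases n with
  | zero =>
    refine LinearMap.congr_fun (f := (W.coinv σ).b' 0 ∘ₗ s 0) (g := LinearMap.id)
      (W.coinvX_ext σ fun a x => ?_) x
    obtain ⟨x, rfl⟩ := proj_surjective hz _ x
    rw [LinearMap.comp_apply, coinvMapX_mkHom, ← CyclicModule.Hom.map_b', descend_proj, proj_b',
      simplexB'_lastCone_zero]
    rfl
  | succ n =>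
    have h : (W.coinv σ).b' (n + 1) ∘ₗ s (n + 1) =
        LinearMap.id - s n ∘ₗ (W.coinv σ).b' n := W.coinvX_ext σ fun a x => by
      obtain ⟨x, rfl⟩ := proj_surjective hz _ x
      rw [LinearMap.comp_apply, coinvMapX_mkHom, ← CyclicModule.Hom.map_b', descend_proj, proj_b',
        simplexB'_lastCone, LinearMap.sub_apply, LinearMap.comp_apply, ← CyclicModule.Hom.map_b', proj_b',
        coinvMapX_mkHom, descend_proj, map_sub, map_sub]
      rfl
    have h' := LinearMap.congr_fun h x
    rw [LinearMap.sub_apply, LinearMap.comp_apply, LinearMap.comp_apply] at h'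
    refine h'.trans ?_
    change (W.coinv σ).b' n x = 0 at hx
    rw [hx, map_zero, sub_zero]
    rfl

/-- If the central element has finite order, the cyclic homology of the coinvariants is a direct sum
of group homology modules. -/
theorem nonempty_equiv_of_isOfFinOrder [Nonempty Y] (hfin : IsOfFinOrder z)
    (hfree : ∀ (γ : Γ) (y : Y), γ • y = y → γ = 1) (A : Rep.{u} k (Γ ⧸ Subgroup.zpowers z)) (n : ℕ) :
    Nonempty (LinHomology ((simplexCyclicModule k Y hz).coinv A.ρ).D n ≃ₗ[k]
      ⨁ i : {i : ℕ // 2 * i ≤ n}, groupHomology A (n - 2 * i)) := by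
  let W := simplexCyclicModule k Y hz
  let Z := W.coinv A.ρ
  have e1 : ∀ n, Nonempty (groupHomology A n ≃ₗ[k] LinHomology Z.b n) :=
    W.nonempty_groupHomology_equiv_b A (aug hz) (aug_ρ hz) (exists_aug_eq_one hz) (aug_b hz)
      (exists_b_zero_eq hz) (exists_b_eq_of_isOfFinOrder hz hfin) (projective hz hfree)
  -- The invariant map and its homotopy to the identity commute with all of `Γ`, hence they descend
  -- to the coinvariants and provide the data that splits the periodicity sequence.
  let ψ := fun n => W.coinvMapX A.ρ (descend hz (invariantMap k Y z n)
    (fun γ x => invariantMap_rep hz n γ x)) (descend_ρ hz _ _)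
  let H := fun n => W.coinvMapX A.ρ (descend hz (invariantHomotopy k Y z n)
    (fun γ x => invariantHomotopy_rep hz n γ x)) (descend_ρ hz _ _)
  have hψb : ∀ n x, ψ n (Z.b n x) = Z.b n (ψ (n + 1) x) := fun n x => by
    refine LinearMap.congr_fun (f := ψ n ∘ₗ Z.b n) (g := Z.b n ∘ₗ ψ (n + 1))
      (W.coinvX_ext A.ρ fun a x => ?_) x
    obtain ⟨x, rfl⟩ := proj_surjective hz _ x
    rw [LinearMap.comp_apply, LinearMap.comp_apply, coinvMapX_mkHom, ← CyclicModule.Hom.map_b, ← CyclicModule.Hom.map_b,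
      coinvMapX_mkHom, proj_b, descend_proj, descend_proj, proj_b, simplexB_invariantMap hfin]
  have hψT : ∀ n x, ψ n (Z.T n x) = ψ n x := fun n x => by
    refine LinearMap.congr_fun (f := ψ n ∘ₗ Z.T n) (g := ψ n)
      (W.coinvX_ext A.ρ fun a x => ?_) x
    obtain ⟨x, rfl⟩ := proj_surjective hz _ x
    rw [LinearMap.comp_apply, ← CyclicModule.Hom.map_T, coinvMapX_mkHom, coinvMapX_mkHom, proj_T, descend_proj,
      descend_proj, invariantMap_T]
  have hψ : ∀ n x, dFrom Z.b n x = 0 → ∃ w, Z.b n w = x - ψ n x := fun n x hx => by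
    refine ⟨H n x, ?_⟩
    cases n with
    | zero =>
      refine LinearMap.congr_fun (f := Z.b 0 ∘ₗ H 0) (g := LinearMap.id - ψ 0)
        (W.coinvX_ext A.ρ fun a x => ?_) x
      obtain ⟨x, rfl⟩ := proj_surjective hz _ x
      rw [LinearMap.comp_apply, coinvMapX_mkHom, ← CyclicModule.Hom.map_b, descend_proj, proj_b,
        simplexB_invariantHomotopy_zero hfin, map_sub, map_sub]
      rfl
    | succ n =>
      have h : Z.b (n + 1) ∘ₗ H (n + 1) = LinearMap.id - ψ (n + 1) - H n ∘ₗ Z.b n :=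
        W.coinvX_ext A.ρ fun a x => by
          obtain ⟨x, rfl⟩ := proj_surjective hz _ x
          rw [LinearMap.comp_apply, coinvMapX_mkHom, ← CyclicModule.Hom.map_b, descend_proj, proj_b,
            simplexB_invariantHomotopy hfin, LinearMap.sub_apply, LinearMap.comp_apply,
            ← CyclicModule.Hom.map_b, proj_b, coinvMapX_mkHom, descend_proj, map_sub, map_sub, map_sub, map_sub]
          rfl
      have h' := LinearMap.congr_fun h x
      rw [LinearMap.sub_apply, LinearMap.comp_apply, LinearMap.comp_apply] at h'
      refine h'.trans ?_
      change Z.b n x = 0 at hx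
      rw [hx, map_zero, sub_zero]
      rfl
  obtain ⟨e⟩ := Z.nonempty_homology_equiv_directSum (exists_b'_coinv hz A.ρ) ψ hψb hψT hψ n
  exact ⟨e.trans (DFinsupp.mapRange.linearEquiv fun i => (e1 (n - 2 * (i : ℕ))).some.symm)⟩

end simplexCyclicModule

end Resolution

/-! ### The Ulbrich-Miyashita action of `G` on `A / [A, B]`. -/

section BaseQuotient

variable {k : Type u} [CommRing k] {G : Type u} [Group G] {A : Type u} [Ring A] [Algebra k A]

/-- The subspace `[A, B]` of a graded algebra with `B = A_1`. -/
def baseCommutators (𝒜 : G → Submodule k A) : Submodule k A :=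
  Submodule.span k {m | ∃ (a : A) (b : A), b ∈ 𝒜 1 ∧ m = a * b - b * a}

/-- The quotient `A / [A, B]`. -/
abbrev BaseQuotient (𝒜 : G → Submodule k A) : Type u := A ⧸ baseCommutators 𝒜

variable {𝒜 : G → Submodule k A}

/-- The class of an element of `A` in `A / [A, B]`. -/
def baseMk (𝒜 : G → Submodule k A) : A →ₗ[k] BaseQuotient 𝒜 := (baseCommutators 𝒜).mkQ

theorem baseMk_surjective : Function.Surjective (baseMk 𝒜) := Submodule.mkQ_surjective _

theorem baseMk_comm (a : A) {b : A} (hb : b ∈ 𝒜 1) : baseMk 𝒜 (a * b) = baseMk 𝒜 (b * a) :=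
  (Submodule.Quotient.eq _).2 (Submodule.subset_span ⟨a, b, hb, rfl⟩)

variable (𝒜) in
/-- The map `A_x / [A_x, B] → A / [A, B]`. -/
def compIncl (x : G) : CompBar 𝒜 x →ₗ[k] BaseQuotient 𝒜 :=
  Submodule.mapQ _ _ (𝒜 x).subtype <| by
    refine Submodule.span_le.2 ?_
    rintro m ⟨a, b, hm⟩
    exact Submodule.subset_span ⟨a, b, b.2, hm⟩

theorem compIncl_mk (x : G) (a : 𝒜 x) :
    compIncl 𝒜 x (Submodule.Quotient.mk a) = baseMk 𝒜 (a : A) := rfl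

variable (h : IsStronglyGraded 𝒜)

-- Inserting `1 = ∑ aᵢ bᵢ` from both presentations exhibits the two sides as sums of `p q` and of `q
-- p`, where `q = bᵢ c a'ⱼ` lies in `B`. Taking `u = w` makes the action well defined on the
-- quotient, and `c = 1` makes it independent of the presentation.
include h in
theorem UnitDecomp.baseMk_conj_move {g : G} (u w : UnitDecomp 𝒜 g) (a : A) {c : A} (hc : c ∈ 𝒜 1) :
    baseMk 𝒜 (w.conj (a * c)) = baseMk 𝒜 (u.conj (c * a)) := by
  have mem : ∀ i j, u.b i * (c * w.a j) ∈ 𝒜 1 := fun i j =>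
    h.mul_mem (u.b_mem i) (h.mul_mem hc (w.a_mem j) rfl) (by simp)
  have e1 : w.conj (a * c) = ∑ i, ∑ j, w.b j * (a * u.a i) * (u.b i * (c * w.a j)) := by
    rw [conj_apply, Finset.sum_comm]
    refine Finset.sum_congr rfl fun j _ => ?_
    calc w.b j * (a * c * w.a j) = w.b j * a * 1 * (c * w.a j) := by simp [mul_assoc]
      _ = _ := by
        rw [← u.sum_eq, Finset.mul_sum, Finset.sum_mul]
        exact Finset.sum_congr rfl fun i _ => by simp [mul_assoc]
  have e2 : u.conj (c * a) = ∑ i, ∑ j, u.b i * (c * w.a j) * (w.b j * (a * u.a i)) := by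
    rw [conj_apply]
    refine Finset.sum_congr rfl fun i _ => ?_
    calc u.b i * (c * a * u.a i) = u.b i * c * 1 * (a * u.a i) := by simp [mul_assoc]
      _ = _ := by
        rw [← w.sum_eq, Finset.mul_sum, Finset.sum_mul]
        exact Finset.sum_congr rfl fun i _ => by simp [mul_assoc]
  rw [e1, e2, map_sum, map_sum]
  refine Finset.sum_congr rfl fun i _ => ?_
  rw [map_sum, map_sum]
  exact Finset.sum_congr rfl fun j _ => baseMk_comm _ (mem i j)

namespace IsStronglyGraded

/-- The endomorphism of `A / [A, B]` given by `m ↦ ∑ bᵢ m aᵢ`. -/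
def baseAct (g : G) : BaseQuotient 𝒜 →ₗ[k] BaseQuotient 𝒜 :=
  Submodule.mapQ _ _ (h.nonempty_unitDecomp g).some.conj <| by
    refine Submodule.span_le.2 ?_
    rintro _ ⟨a, c, hc, rfl⟩
    have := (h.nonempty_unitDecomp g).some.baseMk_conj_move h (h.nonempty_unitDecomp g).some a hc
    change (h.nonempty_unitDecomp g).some.conj _ ∈ baseCommutators 𝒜
    rw [map_sub]
    exact (Submodule.Quotient.eq _).1 this

theorem baseAct_mk {g : G} (u : UnitDecomp 𝒜 g) (a : A) :
    h.baseAct g (baseMk 𝒜 a) = baseMk 𝒜 (u.conj a) := by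
  have := u.baseMk_conj_move h (h.nonempty_unitDecomp g).some a h.one_mem
  rw [mul_one, one_mul] at this
  exact this

/-- The Ulbrich-Miyashita action of `G` on `A / [A, B]`. -/
def baseRep : Representation k G (BaseQuotient 𝒜) where
  toFun := h.baseAct
  map_one' := LinearMap.ext fun v => by
    obtain ⟨a, rfl⟩ := baseMk_surjective v
    rw [h.baseAct_mk (UnitDecomp.one h), UnitDecomp.conj_one]; rfl
  map_mul' g g' := LinearMap.ext fun v => by
    obtain ⟨a, rfl⟩ := baseMk_surjective v
    rw [Module.End.mul_apply, h.baseAct_mk (h.nonempty_unitDecomp g').some,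
      h.baseAct_mk (h.nonempty_unitDecomp g).some, h.baseAct_mk (UnitDecomp.mul h
      (h.nonempty_unitDecomp g).some (h.nonempty_unitDecomp g').some), UnitDecomp.conj_mul]

theorem baseRep_mk {g : G} (u : UnitDecomp 𝒜 g) (a : A) :
    h.baseRep g (baseMk 𝒜 a) = baseMk 𝒜 (u.conj a) := h.baseAct_mk u a

/-- Moving a homogeneous factor from the end of a product to its front is the action of its degree.
With `1 = ∑ aᵢ bᵢ` one has `c a = ∑ (c aᵢ)(bᵢ a)`, and `c aᵢ` lies in `B`, so it may be moved to the
right. -/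
theorem baseRep_mk_mul {g : G} (a : A) {c : A} (hc : c ∈ 𝒜 g) :
    h.baseRep g (baseMk 𝒜 (a * c)) = baseMk 𝒜 (c * a) := by
  let u := (h.nonempty_unitDecomp g).some
  have e : c * a = ∑ i, c * u.a i * (u.b i * a) := by
    calc c * a = c * 1 * a := by rw [mul_one]
      _ = _ := by
        rw [← u.sum_eq, Finset.mul_sum, Finset.sum_mul]
        exact Finset.sum_congr rfl fun i _ => by simp [mul_assoc]
  rw [h.baseRep_mk u, UnitDecomp.conj_apply, e, map_sum, map_sum]
  refine Finset.sum_congr rfl fun i _ => ?_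
  rw [mul_assoc a, ← mul_assoc (u.b i)]
  exact baseMk_comm _ (h.mul_mem hc (u.a_mem i) (mul_inv_cancel g))

theorem exists_baseRep_mk_eq (g : G) {y z : G} (e : g * y * g⁻¹ = z) {a : A} (ha : a ∈ 𝒜 y) :
    ∃ a' ∈ 𝒜 z, h.baseRep g (baseMk 𝒜 a) = baseMk 𝒜 a' :=
  ⟨_, (h.nonempty_unitDecomp g).some.conj_mem h e ha, h.baseRep_mk _ a⟩

include h in
theorem linearMap_ext {N : Type*} [AddCommGroup N] [Module k N] {f g : A →ₗ[k] N}
    (hfg : ∀ y, ∀ a ∈ 𝒜 y, f a = g a) : f = g := by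
  refine LinearMap.ext fun a => ?_
  have : (⊤ : Submodule k A) ≤ LinearMap.eqLocus f g := by
    rw [← h.iSup_eq_top]
    exact iSup_le fun y a ha => hfg y a ha
  exact this (Submodule.mem_top (x := a))

include h in
theorem isCompl (g : G) : IsCompl (𝒜 g) (⨆ (y : G) (_ : y ≠ g), 𝒜 y) :=
  ⟨h.iSupIndep g, by
    rw [codisjoint_iff, ← iSup_split_single (f := 𝒜) g, h.iSup_eq_top]⟩

/-- The projection to a homogeneous component. -/
def component (g : G) : A →ₗ[k] 𝒜 g := Submodule.projectionOnto _ _ (h.isCompl g)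

theorem component_of_mem {g : G} {a : A} (ha : a ∈ 𝒜 g) : h.component g a = ⟨a, ha⟩ :=
  Submodule.projectionOnto_apply_left (h.isCompl g) ⟨a, ha⟩

theorem component_of_ne {g y : G} {a : A} (ha : a ∈ 𝒜 y) (hy : y ≠ g) : h.component g a = 0 := by
  refine (Submodule.projectionOnto_apply_eq_zero_iff (h.isCompl g)).2 ?_
  exact Submodule.mem_iSup_of_mem y (Submodule.mem_iSup_of_mem hy ha)

/-- The projection to a homogeneous component, as an endomorphism. -/
def proj (g : G) : A →ₗ[k] A := (𝒜 g).subtype ∘ₗ h.component g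

theorem proj_mem (g : G) (a : A) : h.proj g a ∈ 𝒜 g := (h.component g a).2

theorem proj_of_mem {g : G} {a : A} (ha : a ∈ 𝒜 g) : h.proj g a = a := by
  rw [proj, LinearMap.comp_apply, h.component_of_mem ha]; rfl

theorem proj_of_ne {g y : G} {a : A} (ha : a ∈ 𝒜 y) (hy : y ≠ g) : h.proj g a = 0 := by
  rw [proj, LinearMap.comp_apply, h.component_of_ne ha hy]; rfl

theorem proj_mul_base (g : G) (a : A) {b : A} (hb : b ∈ 𝒜 1) :
    h.proj g (a * b) = h.proj g a * b := by
  refine LinearMap.congr_fun (f := h.proj g ∘ₗ LinearMap.mulRight k b)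
    (g := LinearMap.mulRight k b ∘ₗ h.proj g) (h.linearMap_ext fun y a ha => ?_) a
  have hab := h.mul_mem ha hb (mul_one y)
  simp only [LinearMap.comp_apply, LinearMap.mulRight_apply]
  by_cases hy : y = g
  · subst hy; rw [h.proj_of_mem hab, h.proj_of_mem ha]
  · rw [h.proj_of_ne hab hy, h.proj_of_ne ha hy, zero_mul]

theorem proj_base_mul (g : G) (a : A) {b : A} (hb : b ∈ 𝒜 1) :
    h.proj g (b * a) = b * h.proj g a := by
  refine LinearMap.congr_fun (f := h.proj g ∘ₗ LinearMap.mulLeft k b)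
    (g := LinearMap.mulLeft k b ∘ₗ h.proj g) (h.linearMap_ext fun y a ha => ?_) a
  have hab := h.mul_mem hb ha (one_mul y)
  simp only [LinearMap.comp_apply, LinearMap.mulLeft_apply]
  by_cases hy : y = g
  · subst hy; rw [h.proj_of_mem hab, h.proj_of_mem ha]
  · rw [h.proj_of_ne hab hy, h.proj_of_ne ha hy, mul_zero]

/-- The projection `A / [A, B] → A_x / [A_x, B]`. -/
def compProj (x : G) : BaseQuotient 𝒜 →ₗ[k] CompBar 𝒜 x :=
  Submodule.mapQ _ _ (h.component x) <| by
    refine Submodule.span_le.2 ?_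
    rintro _ ⟨a, b, hb, rfl⟩
    refine Submodule.subset_span ⟨h.component x a, ⟨b, hb⟩, ?_⟩
    change h.proj x (a * b - b * a) = h.proj x a * b - b * h.proj x a
    rw [map_sub, h.proj_mul_base x a hb, h.proj_base_mul x a hb]

theorem compIncl_compProj_mk (x : G) (a : A) :
    compIncl 𝒜 x (h.compProj x (baseMk 𝒜 a)) = baseMk 𝒜 (h.proj x a) := rfl

theorem compProj_compIncl (x : G) (m : CompBar 𝒜 x) : h.compProj x (compIncl 𝒜 x m) = m := by
  obtain ⟨m, rfl⟩ := Submodule.Quotient.mk_surjective _ m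
  rw [compIncl_mk]
  change Submodule.Quotient.mk (h.component x m) = _
  rw [h.component_of_mem m.2]

theorem compIncl_action (x : G) (g : Cent x) (m : CompBar 𝒜 x) :
    compIncl 𝒜 x (h.action x g m) = h.baseRep (g : G) (compIncl 𝒜 x m) := by
  obtain ⟨m, rfl⟩ := Submodule.Quotient.mk_surjective _ m
  rw [compIncl_mk, h.baseRep_mk (h.nonempty_unitDecomp (g : G)).some]
  rfl

/-- The action of `g` carries the component of degree `y` to that of degree `g y g⁻¹`, hence
permutes the projections accordingly. -/
theorem compProj_baseRep (g x y : G) (e : g * y * g⁻¹ = x) (v : BaseQuotient 𝒜) :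
    compIncl 𝒜 x (h.compProj x (h.baseRep g v)) =
      h.baseRep g (compIncl 𝒜 y (h.compProj y v)) := by
  obtain ⟨a, rfl⟩ := baseMk_surjective v
  refine LinearMap.congr_fun
    (f := compIncl 𝒜 x ∘ₗ h.compProj x ∘ₗ h.baseRep g ∘ₗ baseMk 𝒜)
    (g := h.baseRep g ∘ₗ compIncl 𝒜 y ∘ₗ h.compProj y ∘ₗ baseMk 𝒜)
    (h.linearMap_ext fun y' a ha => ?_) a
  simp only [LinearMap.comp_apply]
  obtain ⟨a', ha', e'⟩ := h.exists_baseRep_mk_eq g (y := y') rfl ha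
  rw [e', compIncl_compProj_mk, compIncl_compProj_mk]
  by_cases hy : y' = y
  · subst hy
    subst e
    rw [h.proj_of_mem ha', h.proj_of_mem ha, e']
  · rw [h.proj_of_ne ha' (fun h' => hy ?_), h.proj_of_ne ha hy, map_zero, map_zero]
    rw [← e] at h'
    exact mul_left_cancel (mul_right_cancel h')

end IsStronglyGraded

end BaseQuotient

/-! ### Products of tuples and bookkeeping for entries moved between slots. -/

section TupleProducts

/-- The product of the entries of a tuple. -/
def tupleProd {M : Type*} [Monoid M] {n : ℕ} (a : Fin n → M) : M := (List.ofFn a).prod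

theorem tupleProd_succ {M : Type*} [Monoid M] {n : ℕ} (a : Fin (n + 1) → M) :
    tupleProd a = a 0 * tupleProd fun j => a j.succ := by
  rw [tupleProd, List.ofFn_succ, List.prod_cons]; rfl

theorem tupleProd_castSucc {M : Type*} [Monoid M] {n : ℕ} (a : Fin (n + 1) → M) :
    tupleProd a = (tupleProd fun j : Fin n => a j.castSucc) * a (Fin.last n) := by
  rw [tupleProd, List.ofFn_succ', List.concat_eq_append, List.prod_append, List.prod_singleton]; rfl

theorem tupleProd_one {M : Type*} [Monoid M] (a : Fin 1 → M) : tupleProd a = a 0 := by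
  rw [tupleProd_succ]; simp [tupleProd]

theorem tupleProd_rot {M : Type*} [Monoid M] {n : ℕ} (a : Fin (n + 1) → M) :
    (tupleProd fun j => a (j - 1)) = a (Fin.last n) * tupleProd fun j : Fin n => a j.castSucc := by
  rw [tupleProd_succ, fin_zero_sub_one]
  simp only [fin_succ_sub_one]

theorem tupleProd_mergeAt {A : Type*} [Ring A] {n : ℕ} (i : Fin (n + 1)) (a : Fin (n + 2) → A) :
    tupleProd (mergeAt i a) = tupleProd a := by
  induction n with
  | zero =>
    obtain rfl : i = 0 := Fin.fin_one_eq_zero i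
    rw [tupleProd_one, tupleProd_succ, tupleProd_one]
    simp [mergeAt]
  | succ n ih =>
    rw [tupleProd_succ, tupleProd_succ a]
    refine Fin.cases ?_ (fun i => ?_) i
    · rw [tupleProd_succ (fun j : Fin (n + 2) => a j.succ), ← mul_assoc]
      congr 1
    · have h1 : mergeAt i.succ a 0 = a 0 := by
        simp [mergeAt]
      have h2 : (fun j : Fin (n + 1) => mergeAt i.succ a j.succ) =
          mergeAt i fun j => a j.succ := by
        funext j
        simp only [mergeAt, Fin.succ_lt_succ_iff, Fin.succ_inj, Fin.succ_castSucc]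
      rw [h1, h2, ih]

/-- Both products contain the same word `c₀ β₁ c₁ β₂ ⋯ cₙ`; only the outer factor, last `β` or first
`β`, differs. -/
theorem exists_tupleProd_shift {A : Type*} [Monoid A] {n : ℕ} (c : Fin (n + 1) → A)
    (β : Fin (n + 2) → A) :
    ∃ X, (tupleProd fun j => c j * β j.succ) = X * β (Fin.last (n + 1)) ∧
      (tupleProd fun j => β j.castSucc * c j) = β 0 * X := by
  induction n with
  | zero => exact ⟨c 0, by simp [tupleProd_one], by simp [tupleProd_one]⟩
  | succ n ih =>
    obtain ⟨X, h1, h2⟩ := ih (fun j => c j.succ) fun j => β j.succ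
    refine ⟨c 0 * β 1 * X, ?_, ?_⟩
    · rw [tupleProd_succ, h1]; simp [mul_assoc]
    · rw [tupleProd_succ]
      simp only [← Fin.succ_castSucc, h2]
      simp [mul_assoc]

end TupleProducts

theorem mulSingle_mul_mulSingle {A I : Type*} [MulOneClass A] [DecidableEq I] (i j : I) (x y : A) :
    Pi.mulSingle (M := fun _ => A) i x j * Pi.mulSingle (M := fun _ => A) i y j =
      Pi.mulSingle (M := fun _ => A) i (x * y) j :=
  (congrFun (Pi.mulSingle_mul (f := fun _ => A) i x y) j).symm

theorem mulSingle_comm_of_ne {A I : Type*} [MulOneClass A] [DecidableEq I] {i i' : I} (hi : i ≠ i')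
    (j : I) (x y : A) : Pi.mulSingle (M := fun _ => A) i x j * Pi.mulSingle (M := fun _ => A) i' y j =
      Pi.mulSingle (M := fun _ => A) i' y j * Pi.mulSingle (M := fun _ => A) i x j := by
  by_cases h : j = i
  · subst h; rw [Pi.mulSingle_eq_of_ne hi, one_mul, mul_one]
  · rw [Pi.mulSingle_eq_of_ne h, one_mul, mul_one]

/-- A tuple with a new first entry. -/
abbrev consTuple {A : Type*} {n : ℕ} (x : A) (c : Fin n → A) : Fin (n + 1) → A :=
  Fin.cons (α := fun _ => A) x c

theorem consTuple_zero {A : Type*} {n : ℕ} (x : A) (c : Fin n → A) : consTuple x c 0 = x := rfl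

theorem consTuple_succ {A : Type*} {n : ℕ} (x : A) (c : Fin n → A) (j : Fin n) :
    consTuple x c j.succ = c j := rfl

section MoveTuples

variable {A : Type*} [MulOneClass A] {n : ℕ} (x : A) (c : Fin (n + 1) → A) (b : A)

theorem consTuple_mul_mulSingle_zero :
    (fun l => consTuple x c l * Pi.mulSingle (M := fun _ => A) 0 b (l + 1)) =
      consTuple x fun j => c j * Pi.mulSingle (M := fun _ => A) 0 b (j + 1) := by
  funext l
  refine Fin.cases ?_ (fun j => ?_) l
  · simp
  · simp only [consTuple_succ]
    congr 1
    refine Fin.lastCases ?_ (fun j => ?_) j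
    · rw [Fin.succ_last, Fin.last_add_one, Fin.last_add_one, Pi.mulSingle_eq_same, Pi.mulSingle_eq_same]
    · rw [Fin.coeSucc_eq_succ, Fin.succ_castSucc, Fin.coeSucc_eq_succ,
        Pi.mulSingle_eq_of_ne (Fin.succ_ne_zero _), Pi.mulSingle_eq_of_ne (Fin.succ_ne_zero _)]

theorem mulSingle_zero_mul_consTuple :
    (fun l => Pi.mulSingle (M := fun _ => A) 0 b l * consTuple x c l) = consTuple (b * x) c := by
  funext l
  refine Fin.cases ?_ (fun j => ?_) l
  · simp
  · simp

theorem consTuple_mul_mulSingle_one :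
    (fun l => consTuple x c l * Pi.mulSingle (M := fun _ => A) 1 b (l + 1)) =
      consTuple (x * b) c := by
  funext l
  refine Fin.cases ?_ (fun j => ?_) l
  · simp
  · simp only [consTuple_succ]
    refine Fin.lastCases ?_ (fun j => ?_) j
    · rw [Fin.succ_last, Fin.last_add_one, Pi.mulSingle_eq_of_ne (by simp), mul_one]
    · rw [Fin.succ_castSucc, Fin.coeSucc_eq_succ, Pi.mulSingle_eq_of_ne, mul_one]
      rw [← Fin.succ_zero_eq_one, Ne, Fin.succ_inj]
      exact Fin.succ_ne_zero _

theorem mulSingle_one_mul_consTuple :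
    (fun l => Pi.mulSingle (M := fun _ => A) 1 b l * consTuple x c l) =
      consTuple x fun j => Pi.mulSingle (M := fun _ => A) 0 b j * c j := by
  funext l
  refine Fin.cases ?_ (fun j => ?_) l
  · simp
  · simp only [consTuple_succ]
    congr 1
    rw [← Fin.succ_zero_eq_one]
    simp only [Pi.mulSingle_apply, Fin.succ_inj]

theorem consTuple_mul_mulSingle_succ (i : Fin n) :
    (fun l => consTuple x c l * Pi.mulSingle (M := fun _ => A) i.succ.succ b (l + 1)) =
      consTuple x fun j => c j * Pi.mulSingle (M := fun _ => A) i.succ b (j + 1) := by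
  funext l
  refine Fin.cases ?_ (fun j => ?_) l
  · rw [consTuple_zero, consTuple_zero, zero_add, ← Fin.succ_zero_eq_one, Pi.mulSingle_eq_of_ne,
      mul_one]
    rw [Ne, Fin.succ_inj]
    exact (Fin.succ_ne_zero _).symm
  · simp only [consTuple_succ]
    congr 1
    refine Fin.lastCases ?_ (fun j => ?_) j
    · rw [Fin.succ_last, Fin.last_add_one, Fin.last_add_one,
        Pi.mulSingle_eq_of_ne (Fin.succ_ne_zero _).symm,
        Pi.mulSingle_eq_of_ne (Fin.succ_ne_zero _).symm]
    · rw [Fin.coeSucc_eq_succ, Fin.succ_castSucc, Fin.coeSucc_eq_succ]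
      simp only [Pi.mulSingle_apply, Fin.succ_inj]

theorem mulSingle_succ_mul_consTuple (i : Fin n) :
    (fun l => Pi.mulSingle (M := fun _ => A) i.succ.succ b l * consTuple x c l) =
      consTuple x fun j => Pi.mulSingle (M := fun _ => A) i.succ b j * c j := by
  funext l
  refine Fin.cases ?_ (fun j => ?_) l
  · rw [consTuple_zero, consTuple_zero, Pi.mulSingle_eq_of_ne (Fin.succ_ne_zero _).symm, one_mul]
  · simp only [consTuple_succ]
    congr 1
    simp only [Pi.mulSingle_apply, Fin.succ_inj]

end MoveTuples

/-! ### Multilinear calculus in the cyclic tensor powers. -/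

section CyclicTensors

variable {k : Type u} [CommRing k] {A : Type v} [Ring A] [Algebra k A] (B : Subalgebra k A)

/-- The class `[a₀ ⊗ ⋯ ⊗ aₙ]` in the cyclic tensor power. -/
def cyclicMk (n : ℕ) : MultilinearMap k (fun _ : Fin (n + 1) => A) (CyclicTensor B n) :=
  (cyclicRel B n).mkQ.compMultilinearMap (PiTensorProduct.tprod k)

theorem cyclicMk_apply {n : ℕ} (a : Fin (n + 1) → A) :
    cyclicMk B n a = Submodule.Quotient.mk (PiTensorProduct.tprod k a) := rfl

variable {B}

theorem cyclicMk_move {n : ℕ} (a : Fin (n + 1) → A) (i : Fin (n + 1)) {b : A} (hb : b ∈ B) :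
    cyclicMk B n (fun j => a j * Pi.mulSingle (M := fun _ => A) i b (j + 1)) =
      cyclicMk B n (fun j => Pi.mulSingle (M := fun _ => A) i b j * a j) :=
  (Submodule.Quotient.eq _).2 (Submodule.subset_span ⟨a, i, ⟨b, hb⟩, rfl⟩)

theorem cyclicMk_move_zero {n : ℕ} (x : A) (c : Fin (n + 1) → A) {b : A} (hb : b ∈ B) :
    cyclicMk B (n + 1) (consTuple x fun j => c j * Pi.mulSingle (M := fun _ => A) 0 b (j + 1)) =
      cyclicMk B (n + 1) (consTuple (b * x) c) := by
  rw [← consTuple_mul_mulSingle_zero, ← mulSingle_zero_mul_consTuple, cyclicMk_move _ _ hb]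

theorem cyclicMk_move_one {n : ℕ} (x : A) (c : Fin (n + 1) → A) {b : A} (hb : b ∈ B) :
    cyclicMk B (n + 1) (consTuple (x * b) c) =
      cyclicMk B (n + 1) (consTuple x fun j => Pi.mulSingle (M := fun _ => A) 0 b j * c j) := by
  rw [← consTuple_mul_mulSingle_one, ← mulSingle_one_mul_consTuple, cyclicMk_move _ _ hb]

theorem cyclicMk_move_succ {n : ℕ} (x : A) (c : Fin (n + 1) → A) (i : Fin n) {b : A} (hb : b ∈ B) :
    cyclicMk B (n + 1) (consTuple x fun j => c j * Pi.mulSingle (M := fun _ => A) i.succ b (j + 1)) =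
      cyclicMk B (n + 1) (consTuple x fun j => Pi.mulSingle (M := fun _ => A) i.succ b j * c j) := by
  rw [← consTuple_mul_mulSingle_succ, ← mulSingle_succ_mul_consTuple, cyclicMk_move _ _ hb]

theorem cyclicMk_cons_sum {n : ℕ} {ι : Type*} (s : Finset ι) (x : ι → A) (c : Fin (n + 1) → A) :
    cyclicMk B (n + 1) (consTuple (∑ i ∈ s, x i) c) =
      ∑ i ∈ s, cyclicMk B (n + 1) (consTuple (x i) c) := by
  have hF : ∀ y, cyclicMk B (n + 1) (consTuple y c) =
      (cyclicMk B (n + 1)).toLinearMap (consTuple 0 c) 0 y := fun y =>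
    congrArg (cyclicMk B (n + 1)) (Fin.update_cons_zero (α := fun _ => A) 0 c y).symm
  simp only [hF, map_sum]

theorem cyclicMk_cons_sum_mul {n : ℕ} {ι : Type*} (s : Finset ι) (x : A) (y : ι → A)
    (c : Fin (n + 1) → A) :
    cyclicMk B (n + 1) (consTuple x fun j =>
        Pi.mulSingle (M := fun _ => A) 0 (∑ i ∈ s, y i) j * c j) =
      ∑ i ∈ s, cyclicMk B (n + 1) (consTuple x fun j =>
        Pi.mulSingle (M := fun _ => A) 0 (y i) j * c j) := by
  let F : A →ₗ[k] CyclicTensor B (n + 1) :=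
    ((cyclicMk B (n + 1)).curryLeft x).toLinearMap c 0 ∘ₗ LinearMap.mulRight k (c 0)
  have hF : ∀ y, cyclicMk B (n + 1) (consTuple x fun j =>
      Pi.mulSingle (M := fun _ => A) 0 y j * c j) = F y := by
    intro y
    change _ = cyclicMk B (n + 1) (consTuple x (Function.update c 0 (y * c 0)))
    congr 2
    funext j
    refine Fin.cases ?_ (fun j => ?_) j
    · simp
    · rw [Pi.mulSingle_eq_of_ne (Fin.succ_ne_zero _), one_mul,
        Function.update_of_ne (Fin.succ_ne_zero _)]
  simp only [hF, map_sum]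

theorem cyclicMk_ext {n : ℕ} {N : Type*} [AddCommGroup N] [Module k N]
    {f g : CyclicTensor B n →ₗ[k] N} (h : ∀ a, f (cyclicMk B n a) = g (cyclicMk B n a)) : f = g :=
  cyclicTensor_ext B h

variable (B) in
/-- The linear map on a cyclic tensor power given by a multilinear map. -/
def cyclicLift {n : ℕ} {N : Type*} [AddCommGroup N] [Module k N]
    (f : MultilinearMap k (fun _ : Fin (n + 1) => A) N)
    (hf : ∀ (a : Fin (n + 1) → A) i b, b ∈ B → f (fun j => a j * Pi.mulSingle (M := fun _ => A) i b (j + 1)) =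
      f (fun j => Pi.mulSingle (M := fun _ => A) i b j * a j)) : CyclicTensor B n →ₗ[k] N :=
  Submodule.liftQ _ (PiTensorProduct.lift f) <| by
    refine Submodule.span_le.2 ?_
    rintro _ ⟨a, i, b, rfl⟩
    rw [SetLike.mem_coe, LinearMap.mem_ker, map_sub, PiTensorProduct.lift.tprod,
      PiTensorProduct.lift.tprod, hf a i b b.2, sub_self]

theorem cyclicLift_mk {n : ℕ} {N : Type*} [AddCommGroup N] [Module k N]
    (f : MultilinearMap k (fun _ : Fin (n + 1) => A) N)
    (hf : ∀ (a : Fin (n + 1) → A) i b, b ∈ B → f (fun j => a j * Pi.mulSingle (M := fun _ => A) i b (j + 1)) =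
      f (fun j => Pi.mulSingle (M := fun _ => A) i b j * a j)) (a) :
    cyclicLift B f hf (cyclicMk B n a) = f a := PiTensorProduct.lift.tprod _

end CyclicTensors

/-! ### Homogeneous cyclic tensors are determined by their product. -/

section HomogeneousTensors

variable {k : Type u} [CommRing k] {G : Type u} [Group G] {A : Type u} [Ring A] [Algebra k A]
  {𝒜 : G → Submodule k A} (h : IsStronglyGraded 𝒜)

namespace IsStronglyGraded

theorem mem_base {b : A} : b ∈ h.base ↔ b ∈ 𝒜 1 := Iff.rfl

/-- The multilinear map `a ↦ ∑ aᵢ ⊗ bᵢ a₀ ⊗ a₁ ⊗ ⋯ ⊗ aₙ`. -/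
def expandMul {g : G} (u : UnitDecomp 𝒜 g) (n : ℕ) :
    MultilinearMap k (fun _ : Fin (n + 1) => A) (CyclicTensor h.base (n + 1)) :=
  ∑ i, ((cyclicMk h.base (n + 1)).curryLeft (u.a i)).compLinearMap
    fun j => LinearMap.mulLeft k (Pi.mulSingle (M := fun _ => A) 0 (u.b i) j)

theorem expandMul_apply {g : G} (u : UnitDecomp 𝒜 g) (n : ℕ) (a : Fin (n + 1) → A) :
    h.expandMul u n a = ∑ i, cyclicMk h.base (n + 1)
      (consTuple (u.a i) fun j => Pi.mulSingle (M := fun _ => A) 0 (u.b i) j * a j) := by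
  rw [expandMul, sum_apply]
  rfl

/-- The map `a ↦ ∑ aᵢ ⊗ bᵢ a₀ ⊗ a₁ ⊗ ⋯ ⊗ aₙ`. -/
def expand {g : G} (u : UnitDecomp 𝒜 g) (n : ℕ) :
    CyclicTensor h.base n →ₗ[k] CyclicTensor h.base (n + 1) :=
  cyclicLift h.base (h.expandMul u n) fun a i b hb => by
    rw [expandMul_apply, expandMul_apply]
    refine Fin.cases ?_ (fun i' => ?_) i
    -- The relation across the seam: `b` arrives in front of `aᵢ`. Inserting `∑ aⱼ bⱼ = 1` on its
    -- left produces `bⱼ b aᵢ` in `B`, which crosses to the next slot, where `∑ aᵢ bᵢ = 1`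
    -- disappears.
    · calc _ = ∑ i, cyclicMk h.base (n + 1) (consTuple (b * u.a i) fun j =>
            Pi.mulSingle (M := fun _ => A) 0 (u.b i) j * a j) :=
          Finset.sum_congr rfl fun i _ => by
            rw [← cyclicMk_move_zero _ _ hb]
            simp only [mul_assoc]
        _ = ∑ i, ∑ j, cyclicMk h.base (n + 1) (consTuple (u.a j * (u.b j * b * u.a i)) fun l =>
            Pi.mulSingle (M := fun _ => A) 0 (u.b i) l * a l) :=
          Finset.sum_congr rfl fun i _ => by
            rw [← cyclicMk_cons_sum]
            congr 2
            simp only [← mul_assoc, ← Finset.sum_mul, u.sum_eq, one_mul]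
        _ = ∑ j, ∑ i, cyclicMk h.base (n + 1) (consTuple (u.a j) fun l =>
            Pi.mulSingle (M := fun _ => A) 0 (u.b j * b * (u.a i * u.b i)) l * a l) := by
          rw [Finset.sum_comm]
          refine Finset.sum_congr rfl fun j _ => Finset.sum_congr rfl fun i _ => ?_
          rw [cyclicMk_move_one (u.a j) _ (h.mem_base.2 (h.mul_mem
            (h.mul_mem (u.b_mem j) hb (mul_one g)) (u.a_mem i) (mul_inv_cancel g)))]
          simp only [← mul_assoc, mulSingle_mul_mulSingle]
        _ = _ := by
          refine Finset.sum_congr rfl fun j _ => ?_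
          rw [← cyclicMk_cons_sum_mul, ← Finset.mul_sum, u.sum_eq, mul_one]
          simp only [← mul_assoc, mulSingle_mul_mulSingle]
    · refine Finset.sum_congr rfl fun j _ => ?_
      simp only [← mul_assoc]
      rw [cyclicMk_move_succ _ _ i' hb]
      simp only [← mul_assoc, mulSingle_comm_of_ne (Fin.succ_ne_zero i')]

theorem expand_mk {g : G} (u : UnitDecomp 𝒜 g) (n : ℕ) (a : Fin (n + 1) → A) :
    h.expand u n (cyclicMk h.base n a) = ∑ i, cyclicMk h.base (n + 1)
      (consTuple (u.a i) fun j => Pi.mulSingle (M := fun _ => A) 0 (u.b i) j * a j) := by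
  rw [expand, cyclicLift_mk, expandMul_apply]

/-- `expand` undoes the multiplication of the first two factors: as `bᵢ` has degree `g⁻¹`, `bᵢ x`
lies in `B` and passes back to the first slot, where `∑ aᵢ bᵢ x = x`. -/
theorem expand_mk_cons {g : G} (u : UnitDecomp 𝒜 g⁻¹) (n : ℕ) (x : A) (hx : x ∈ 𝒜 g)
    (a : Fin (n + 1) → A) :
    h.expand u n (cyclicMk h.base n fun j => Pi.mulSingle (M := fun _ => A) 0 x j * a j) =
      cyclicMk h.base (n + 1) (consTuple x a) := by
  rw [expand_mk]
  calc _ = ∑ i, cyclicMk h.base (n + 1) (consTuple (u.a i * (u.b i * x)) a) :=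
        Finset.sum_congr rfl fun i _ => by
          rw [cyclicMk_move_one _ _ (h.mem_base.2 (h.mul_mem (u.b_mem i) hx (inv_mul_cancel g)))]
          simp only [← mul_assoc, mulSingle_mul_mulSingle]
    _ = _ := by
      rw [← cyclicMk_cons_sum]
      simp only [← mul_assoc, ← Finset.sum_mul, u.sum_eq, one_mul]

/-- The isomorphism `A / [A, B] → A / [A, B]_B` in degree `0`. -/
def ofBaseQuotient : BaseQuotient 𝒜 →ₗ[k] CyclicTensor h.base 0 :=
  Submodule.liftQ _ ((cyclicMk h.base 0).toLinearMap (fun _ => 0) 0) <| by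
    refine Submodule.span_le.2 ?_
    rintro _ ⟨a, b, hb, rfl⟩
    rw [SetLike.mem_coe, LinearMap.mem_ker, map_sub, sub_eq_zero]
    refine Eq.trans ?_ ((cyclicMk_move (fun _ => a) 0 (h.mem_base.2 hb)).trans ?_)
    all_goals
      refine congrArg (cyclicMk h.base 0) (funext fun j => ?_)
      obtain rfl : j = 0 := Fin.fin_one_eq_zero j
      simp

theorem ofBaseQuotient_mk (a : Fin 1 → A) :
    h.ofBaseQuotient (baseMk 𝒜 (a 0)) = cyclicMk h.base 0 a := by
  refine congrArg (cyclicMk h.base 0) (funext fun j => ?_)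
  obtain rfl : j = 0 := Fin.fin_one_eq_zero j
  simp

/-- The map `A / [A, B] → [A ⊗_B ⋯ ⊗_B A]` which sends `[a₀ ⋯ aₙ]` to `[a₀ ⊗ ⋯ ⊗ aₙ]` if the `aᵢ` are
homogeneous of degrees `gᵢ`. -/
def split : ∀ n, (Fin (n + 1) → G) → BaseQuotient 𝒜 →ₗ[k] CyclicTensor h.base n
  | 0, _ => h.ofBaseQuotient
  -- The recursion uses the degrees `(g₀ g₁, g₂, …)` obtained by merging the first two entries, then
  -- splits the first factor again.
  | n + 1, g => h.expand (h.nonempty_unitDecomp (g 0)⁻¹).some n ∘ₗ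
      split n fun j => Pi.mulSingle (M := fun _ => G) 0 (g 0) j * g j.succ

theorem split_tupleProd (n : ℕ) (g : Fin (n + 1) → G) (a : Fin (n + 1) → A)
    (ha : ∀ j, a j ∈ 𝒜 (g j)) :
    h.split n g (baseMk 𝒜 (tupleProd a)) = cyclicMk h.base n a := by
  induction n with
  | zero => rw [tupleProd_one]; exact h.ofBaseQuotient_mk a
  | succ n ih =>
    have e : tupleProd a = tupleProd fun j => Pi.mulSingle (M := fun _ => A) 0 (a 0) j * a j.succ := by
      rw [tupleProd_succ, tupleProd_succ (n := n), tupleProd_succ (n := n)]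
      simp [mul_assoc]
    rw [e, split, LinearMap.comp_apply, ih, h.expand_mk_cons _ _ _ (ha 0)]
    · exact congrArg _ (Fin.cons_self_tail a)
    · intro j
      refine Fin.cases ?_ (fun j => ?_) j
      · simp only [Pi.mulSingle_eq_same]
        exact h.mul_mem (ha 0) (ha _) rfl
      · simp only [Pi.mulSingle_eq_of_ne (Fin.succ_ne_zero j), one_mul]
        exact ha _

/-- The map `[a₀ ⊗ ⋯ ⊗ aₙ] ↦ [p₀ a₀ ⋯ pₙ aₙ]`, where `pᵢ` is the projection to the component of degree
`gᵢ`. -/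
def multiply (n : ℕ) (g : Fin (n + 1) → G) : CyclicTensor h.base n →ₗ[k] BaseQuotient 𝒜 :=
  cyclicLift h.base
    (((baseMk 𝒜).compMultilinearMap (MultilinearMap.mkPiAlgebraFin k (n + 1) A)).compLinearMap
      fun j => h.proj (g j)) fun a i b hb => by
    change baseMk 𝒜 (tupleProd fun j => h.proj (g j) (a j * _)) =
      baseMk 𝒜 (tupleProd fun j => h.proj (g j) (_ * a j))
    have hβ : ∀ j, Pi.mulSingle (M := fun _ => A) i b j ∈ 𝒜 1 := fun j => by
      by_cases hj : j = i
      · subst hj; rw [Pi.mulSingle_eq_same]; exact hb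
      · simpa [hj] using h.one_mem
    simp only [h.proj_mul_base _ _ (hβ _), h.proj_base_mul _ _ (hβ _)]
    -- The appended entry repeats the one at `0`, so the cyclic index `j + 1` becomes a plain
    -- successor. The two products then differ by moving an element of `B` around the seam.
    obtain ⟨X, h1, h2⟩ := exists_tupleProd_shift (fun j => h.proj (g j) (a j))
      (Fin.snoc (α := fun _ => A) (Pi.mulSingle (M := fun _ => A) i b)
        (Pi.mulSingle (M := fun _ => A) i b 0))
    have e : ∀ j : Fin (n + 1), Fin.snoc (α := fun _ => A) (Pi.mulSingle (M := fun _ => A) i b)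
        (Pi.mulSingle (M := fun _ => A) i b 0) j.succ = Pi.mulSingle (M := fun _ => A) i b (j + 1) := by
      intro j
      refine Fin.lastCases ?_ (fun j => ?_) j
      · rw [Fin.succ_last, Fin.snoc_last, Fin.last_add_one]
      · rw [Fin.succ_castSucc, Fin.snoc_castSucc, Fin.coeSucc_eq_succ]
    simp only [e, Fin.snoc_castSucc, Fin.snoc_last, ← Fin.castSucc_zero] at h1 h2
    rw [h1, h2]
    exact baseMk_comm _ (hβ 0)

theorem multiply_mk (n : ℕ) (g : Fin (n + 1) → G) (a : Fin (n + 1) → A) :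
    h.multiply n g (cyclicMk h.base n a) = baseMk 𝒜 (tupleProd fun j => h.proj (g j) (a j)) :=
  cyclicLift_mk _ _ _

include h in
/-- The component of degree `g₀ ⋯ gₙ` is spanned by products of elements of degrees `g₀, …, gₙ`. -/
theorem eq_of_tupleProd {N : Type*} [AddCommGroup N] [Module k N] {n : ℕ} (g : Fin (n + 1) → G)
    {f f' : A →ₗ[k] N}
    (hf : ∀ a : Fin (n + 1) → A, (∀ j, a j ∈ 𝒜 (g j)) → f (tupleProd a) = f' (tupleProd a))
    {x : A} (hx : x ∈ 𝒜 (tupleProd g)) : f x = f' x := by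
  induction n generalizing f f' x with
  | zero =>
    have := hf (fun _ => x) fun j => by
      obtain rfl : j = 0 := Fin.fin_one_eq_zero j
      rwa [tupleProd_one] at hx
    rwa [tupleProd_one] at this
  | succ n ih =>
    rw [tupleProd_succ, ← h.mul_eq] at hx
    induction hx using Submodule.mul_induction_on' with
    | mem_mul_mem y hy z hz =>
      refine ih (fun j => g j.succ) (f := f ∘ₗ LinearMap.mulLeft k y)
        (f' := f' ∘ₗ LinearMap.mulLeft k y) (fun a ha => ?_) hz
      have := hf (consTuple y a) fun j => by
        refine Fin.cases hy (fun j => ha j) j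
      rw [tupleProd_succ] at this
      exact this
    | add y _ z _ hy hz => rw [map_add, map_add, hy, hz]

include h in
/-- A multilinear map vanishes if it vanishes on homogeneous tuples. -/
theorem multilinearMap_eq_zero {N : Type*} [AddCommGroup N] [Module k N] {n : ℕ}
    (f : MultilinearMap k (fun _ : Fin n => A) N)
    (hf : ∀ (g : Fin n → G) a, (∀ j, a j ∈ 𝒜 (g j)) → f a = 0) (a : Fin n → A) : f a = 0 := by
  -- Here `S` contains all slots whose entries are possibly not homogeneous; they are treated one at
  -- a time.
  have key : ∀ (S : Finset (Fin n)) (a : Fin n → A), (∀ j ∉ S, ∃ g, a j ∈ 𝒜 g) → f a = 0 := by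
    intro S
    induction S using Finset.induction_on with
    | empty =>
      intro a ha
      choose g hg using fun j => ha j (Finset.notMem_empty j)
      exact hf g a hg
    | insert i S hi ih =>
      intro a ha
      have : f.toLinearMap a i = 0 := h.linearMap_ext fun y x hx => by
        rw [LinearMap.zero_apply]
        refine ih (Function.update a i x) fun j hj => ?_
        by_cases hji : j = i
        · subst hji; exact ⟨y, by rwa [Function.update_self]⟩
        · rw [Function.update_of_ne hji]
          exact ha j (by simp [hji, hj])
      have := LinearMap.congr_fun this (a i)
      rw [MultilinearMap.toLinearMap_apply, Function.update_eq_self] at this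
      exact this
  exact key Finset.univ a fun j hj => absurd (Finset.mem_univ j) hj

/-- Linear maps on the cyclic tensor power agree if they agree on homogeneous tensors. -/
theorem cyclicTensor_ext_homogeneous {N : Type*} [AddCommGroup N] [Module k N] {n : ℕ}
    {f f' : CyclicTensor h.base n →ₗ[k] N}
    (hf : ∀ (g : Fin (n + 1) → G) a, (∀ j, a j ∈ 𝒜 (g j)) →
      f (cyclicMk h.base n a) = f' (cyclicMk h.base n a)) : f = f' := by
  refine cyclicMk_ext fun a => ?_
  rw [← sub_eq_zero, ← LinearMap.sub_apply]
  exact h.multilinearMap_eq_zero ((f - f').compMultilinearMap (cyclicMk h.base n))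
    (fun g a ha => by
      rw [LinearMap.compMultilinearMap_apply, LinearMap.sub_apply, hf g a ha, sub_self]) a

/-- By strong grading the component of degree `g₀⋯gₙ` is spanned by products of homogeneous elements
of these degrees, so it is enough to test on such products. With `multiply_split_of_ne` this
separates the multidegrees. -/
theorem multiply_split_self {n : ℕ} (g : Fin (n + 1) → G) {x : A} (hx : x ∈ 𝒜 (tupleProd g)) :
    h.multiply n g (h.split n g (baseMk 𝒜 x)) = baseMk 𝒜 x := by
  refine h.eq_of_tupleProd g (f := h.multiply n g ∘ₗ h.split n g ∘ₗ baseMk 𝒜) (f' := baseMk 𝒜)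
    (fun a ha => ?_) hx
  rw [LinearMap.comp_apply, LinearMap.comp_apply, h.split_tupleProd n g a ha, multiply_mk]
  simp only [h.proj_of_mem (ha _)]

theorem multiply_split_of_ne {n : ℕ} {g g' : Fin (n + 1) → G} (hg : g ≠ g') {x : A}
    (hx : x ∈ 𝒜 (tupleProd g)) : h.multiply n g' (h.split n g (baseMk 𝒜 x)) = 0 := by
  obtain ⟨j, hj⟩ := Function.ne_iff.1 hg
  refine h.eq_of_tupleProd g (f := h.multiply n g' ∘ₗ h.split n g ∘ₗ baseMk 𝒜) (f' := 0)
    (fun a ha => ?_) hx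
  rw [LinearMap.comp_apply, LinearMap.comp_apply, h.split_tupleProd n g a ha, multiply_mk]
  have : (tupleProd fun j => h.proj (g' j) (a j)) = 0 := by
    refine List.prod_eq_zero ?_
    rw [List.mem_ofFn]
    exact ⟨j, h.proj_of_ne (ha j) hj⟩
  rw [this, map_zero, LinearMap.zero_apply]

end IsStronglyGraded

end HomogeneousTensors

/-! ### Degree tuples as steps of loops in `G`. -/

section Loops

variable {G : Type u} [Group G]

/-- The steps of the path from `x⁻¹ yₙ` through `y₀, …, yₙ`. -/
def loopSteps (x : G) {n : ℕ} (y : Fin (n + 1) → G) : Fin (n + 1) → G :=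
  consTuple ((x⁻¹ * y (Fin.last n))⁻¹ * y 0) fun j => (y j.castSucc)⁻¹ * y j.succ

theorem loopSteps_zero (x : G) {n : ℕ} (y : Fin (n + 1) → G) :
    loopSteps x y 0 = (x⁻¹ * y (Fin.last n))⁻¹ * y 0 := rfl

theorem loopSteps_succ (x : G) {n : ℕ} (y : Fin (n + 1) → G) (j : Fin n) :
    loopSteps x y j.succ = (y j.castSucc)⁻¹ * y j.succ := rfl

/-- The product of the steps telescopes. -/
theorem tupleProd_steps (w : G) {n : ℕ} (y : Fin (n + 1) → G) :
    tupleProd (consTuple (w⁻¹ * y 0) fun j : Fin n => (y j.castSucc)⁻¹ * y j.succ) =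
      w⁻¹ * y (Fin.last n) := by
  induction n generalizing w with
  | zero => rw [tupleProd_one]; rfl
  | succ n ih =>
    have := ih (y 0) fun j => y j.succ
    rw [tupleProd_succ]
    simp only [consTuple_zero, consTuple_succ]
    have e : (fun j : Fin (n + 1) => (y j.castSucc)⁻¹ * y j.succ) =
        consTuple ((y 0)⁻¹ * y (Fin.succ 0)) fun j : Fin n => (y j.castSucc.succ)⁻¹ * y j.succ.succ := by
      funext j
      refine Fin.cases rfl (fun j => rfl) j
    rw [e, this, Fin.succ_last]
    group

theorem tupleProd_loopSteps (x : G) {n : ℕ} (y : Fin (n + 1) → G) :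
    tupleProd (loopSteps x y) = (y (Fin.last n))⁻¹ * x * y (Fin.last n) := by
  rw [loopSteps, tupleProd_steps]
  group

/-- Left translation cancels in every difference of consecutive points; only the step across the
seam needs `g` to commute with `x`. -/
theorem loopSteps_conj (x : G) {n : ℕ} (y : Fin (n + 1) → G) {g : G} (hg : g * x = x * g) :
    loopSteps x (fun j => g * y j) = loopSteps x y := by
  funext j
  refine Fin.cases ?_ (fun j => ?_) j
  · simp only [loopSteps_zero, mul_inv_rev, inv_inv]
    have : g⁻¹ * x * g = x := by rw [mul_assoc, ← hg, inv_mul_cancel_left]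
    conv_rhs => rw [← this]
    group
  · simp only [loopSteps_succ]
    group

theorem rotateSimplex_apply_zero {x : G} (n : ℕ) (y : Fin (n + 1) → G) :
    rotateSimplex (⟨x, self_mem_cent x⟩ : Cent x) n y 0 = x⁻¹ * y (Fin.last n) := rfl

theorem rotateSimplex_apply_succ {x : G} (n : ℕ) (y : Fin (n + 1) → G) (j : Fin n) :
    rotateSimplex (⟨x, self_mem_cent x⟩ : Cent x) n y j.succ = y j.castSucc := rfl

theorem inv_rotateSimplex_last {x : G} (n : ℕ) (y : Fin (n + 1) → G) :
    (rotateSimplex (⟨x, self_mem_cent x⟩ : Cent x) n y (Fin.last n))⁻¹ =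
      loopSteps x y (Fin.last n) * (y (Fin.last n))⁻¹ := by
  cases n with
  | zero =>
    change (rotateSimplex (⟨x, self_mem_cent x⟩ : Cent x) 0 y 0)⁻¹ = loopSteps x y 0 * _
    rw [rotateSimplex_apply_zero, loopSteps_zero]
    simp
  | succ n =>
    rw [← Fin.succ_last, rotateSimplex_apply_succ, loopSteps_succ]
    group

/-- Rotation starts the same twisted loop one point earlier, so its steps are shifted cyclically. -/
theorem loopSteps_rotateSimplex {x : G} (n : ℕ) (y : Fin (n + 1) → G) (j : Fin (n + 1)) :
    loopSteps x (rotateSimplex (⟨x, self_mem_cent x⟩ : Cent x) n y) j = loopSteps x y (j - 1) := by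
  refine Fin.cases ?_ (fun j => ?_) j
  · rw [loopSteps_zero, mul_inv_rev, inv_inv, inv_rotateSimplex_last, rotateSimplex_apply_zero,
      fin_zero_sub_one]
    group
  · rw [loopSteps_succ, rotateSimplex_apply_succ, fin_succ_sub_one]
    cases n with
    | zero => exact j.elim0
    | succ n =>
      refine Fin.cases ?_ (fun j => ?_) j
      · rfl
      · rfl

/-- Skipping a point of the path multiplies the two adjacent steps. The index `i.castSucc` spares
the last vertex, which anchors the loop and determines its product. -/
theorem loopSteps_delete (x : G) {n : ℕ} (i : Fin (n + 1)) (y : Fin (n + 2) → G) (j : Fin (n + 1)) :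
    loopSteps x (fun j => y (i.castSucc.succAbove j)) j =
      if j < i then loopSteps x y j.castSucc else if j = i then
        loopSteps x y j.castSucc * loopSteps x y j.succ else loopSteps x y j.succ := by
  have hlast : i.castSucc.succAbove (Fin.last n) = Fin.last (n + 1) := by
    rw [Fin.succAbove_of_le_castSucc _ _ (by simpa using Fin.le_last i), Fin.succ_last]
  have hs : ∀ l : Fin (n + 1), l < i → i.castSucc.succAbove l = l.castSucc := fun l hl =>
    Fin.succAbove_of_castSucc_lt _ _ (by simpa using hl)
  have hs' : ∀ l : Fin (n + 1), i ≤ l → i.castSucc.succAbove l = l.succ := fun l hl =>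
    Fin.succAbove_of_le_castSucc _ _ (by simpa using hl)
  induction j using Fin.cases with
  | zero =>
    rw [loopSteps_zero, hlast, Fin.castSucc_zero, loopSteps_zero, loopSteps_succ]
    split_ifs with h1 h2
    · rw [hs _ h1]; rfl
    · rw [hs' _ h2.ge, Fin.castSucc_zero]; group
    · exact absurd (Fin.pos_iff_ne_zero.2 (Ne.symm h2)) h1
  | succ j =>
    rw [loopSteps_succ, loopSteps_succ x y j.succ, ← Fin.succ_castSucc, loopSteps_succ]
    split_ifs with h1 h2
    · rw [hs _ h1, hs _ (lt_trans Fin.castSucc_lt_succ h1)]; rfl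
    · rw [hs' _ h2.ge, hs j.castSucc (by rw [← h2]; exact Fin.castSucc_lt_succ), Fin.succ_castSucc]
      group
    · have h3 : i ≤ j.castSucc := by
        rw [Fin.le_castSucc_iff]
        exact lt_of_le_of_ne (not_lt.1 h1) (Ne.symm h2)
      rw [hs' _ h3, hs' _ (not_lt.1 h1)]

end Loops

/-! ### From simplices with coefficients to cyclic tensors. -/

section LoopTensors

variable {k : Type u} [CommRing k] {G : Type u} [Group G] {A : Type u} [Ring A] [Algebra k A]
  {𝒜 : G → Submodule k A} (h : IsStronglyGraded 𝒜)

namespace IsStronglyGraded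

/-- The map from `A_x / [A_x, B]` to the cyclic tensors whose entries have the degrees given by the
steps of a loop. -/
def loopTensor (x : G) {n : ℕ} (y : Fin (n + 1) → G) : CompBar 𝒜 x →ₗ[k] CyclicTensor h.base n :=
  h.split n (loopSteps x y) ∘ₗ h.baseRep (y (Fin.last n))⁻¹ ∘ₗ compIncl 𝒜 x

theorem exists_baseRep_compIncl (x : G) {n : ℕ} (y : Fin (n + 1) → G) (m : CompBar 𝒜 x) :
    ∃ a ∈ 𝒜 (tupleProd (loopSteps x y)),
      h.baseRep (y (Fin.last n))⁻¹ (compIncl 𝒜 x m) = baseMk 𝒜 a := by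
  obtain ⟨m, rfl⟩ := Submodule.Quotient.mk_surjective _ m
  exact h.exists_baseRep_mk_eq _ (by rw [tupleProd_loopSteps, inv_inv]) m.2

/-- The last vertex survives, so the same class in `A / [A, B]` is split on both sides; merging two
factors does not change their total product. -/
theorem loopTensor_delete (x : G) {n : ℕ} (i : Fin (n + 1)) (y : Fin (n + 2) → G)
    (m : CompBar 𝒜 x) : h.loopTensor x (fun j => y (i.castSucc.succAbove j)) m =
      face h.base n i (h.loopTensor x y m) := by
  have hlast : i.castSucc.succAbove (Fin.last n) = Fin.last (n + 1) := by
    rw [Fin.succAbove_of_le_castSucc _ _ (by simpa using Fin.le_last i), Fin.succ_last]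
  obtain ⟨a, ha, e⟩ := h.exists_baseRep_compIncl x y m
  simp only [loopTensor, LinearMap.comp_apply, hlast, e]
  refine h.eq_of_tupleProd (loopSteps x y)
    (f := h.split n (loopSteps x fun j => y (i.castSucc.succAbove j)) ∘ₗ baseMk 𝒜)
    (f' := face h.base n i ∘ₗ h.split (n + 1) (loopSteps x y) ∘ₗ baseMk 𝒜) (fun b hb => ?_) ha
  rw [LinearMap.comp_apply, LinearMap.comp_apply, LinearMap.comp_apply, h.split_tupleProd _ _ b hb,
    cyclicMk_apply, face_mk, ← tupleProd_mergeAt i b, h.split_tupleProd, cyclicMk_apply]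
  intro j
  rw [loopSteps_delete, mergeAt]
  split_ifs
  · exact hb _
  · exact h.mul_mem (hb _) (hb _) rfl
  · exact hb _

/-- The last vertex changes, and the two transports differ by the last step. By `baseRep_mk_mul` the
action of that step moves the last factor of the product to the front, which is the cyclic operator.
-/
theorem loopTensor_rotate (x : G) {n : ℕ} (y : Fin (n + 1) → G) (m : CompBar 𝒜 x) :
    h.loopTensor x (rotateSimplex (⟨x, self_mem_cent x⟩ : Cent x) n y) m =
      rot h.base n (h.loopTensor x y m) := by
  obtain ⟨a, ha, e⟩ := h.exists_baseRep_compIncl x y m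
  simp only [loopTensor, LinearMap.comp_apply, inv_rotateSimplex_last, map_mul,
    Module.End.mul_apply, e]
  refine h.eq_of_tupleProd (loopSteps x y)
    (f := h.split n (loopSteps x (rotateSimplex (⟨x, self_mem_cent x⟩ : Cent x) n y)) ∘ₗ
      h.baseRep (loopSteps x y (Fin.last n)) ∘ₗ baseMk 𝒜)
    (f' := rot h.base n ∘ₗ h.split n (loopSteps x y) ∘ₗ baseMk 𝒜) (fun b hb => ?_) ha
  simp only [LinearMap.comp_apply]
  rw [h.split_tupleProd _ _ b hb, cyclicMk_apply, rot_mk, tupleProd_castSucc,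
    h.baseRep_mk_mul _ (hb _), ← tupleProd_rot, h.split_tupleProd, cyclicMk_apply]
  intro j
  rw [loopSteps_rotateSimplex]
  exact hb _

theorem loopTensor_smul (x : G) {n : ℕ} (y : Fin (n + 1) → G) (g : Cent x) (m : CompBar 𝒜 x) :
    h.loopTensor x (fun j => g • y j) (h.action x g m) = h.loopTensor x y m := by
  have hg : (g : G) * x = x * g := Subgroup.mem_centralizer_singleton_iff.1 g.2
  change h.split n (loopSteps x fun j => (g : G) * y j)
    (h.baseRep ((g : G) * y (Fin.last n))⁻¹ (compIncl 𝒜 x (h.action x g m))) = _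
  rw [loopSteps_conj x y hg, h.compIncl_action, ← Module.End.mul_apply, ← map_mul, mul_inv_rev,
    inv_mul_cancel_right]
  rfl

end IsStronglyGraded

instance zpowers_self_normal (x : G) :
    (Subgroup.zpowers (⟨x, self_mem_cent x⟩ : Cent x)).Normal := cyc_normal x

theorem cent_commute_self (x : G) (g : Cent x) : Commute g ⟨x, self_mem_cent x⟩ :=
  Subtype.ext (Subgroup.mem_centralizer_singleton_iff.1 g.2)

variable (k) in
/-- The cyclic module with an action of `G_x / ⟨x⟩` which resolves `k`. -/
def centCyclicModule (x : G) : EquivariantCyclicModule k (CentBar x) :=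
  simplexCyclicModule k G (cent_commute_self x)

variable (k) in
/-- The class of a simplex in `centCyclicModule`. -/
def centSimplex (x : G) {n : ℕ} (y : Fin (n + 1) → G) : (centCyclicModule k x).X n :=
  simplexCyclicModule.proj (cent_commute_self x) n (Finsupp.single y 1)

theorem centCyclicModule_ext (x : G) {M : Type u} [AddCommGroup M] [Module k M]
    (σ : Representation k (CentBar x) M) {n : ℕ} {N : Type*} [AddCommGroup N] [Module k N]
    {f f' : ((centCyclicModule k x).coinv σ).X n →ₗ[k] N}
    (hf : ∀ m y, f (((centCyclicModule k x).mkHom σ m).f n (centSimplex k x y)) =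
      f' (((centCyclicModule k x).mkHom σ m).f n (centSimplex k x y))) : f = f' := by
  refine (centCyclicModule k x).coinvX_ext σ fun m v => ?_
  obtain ⟨v, rfl⟩ := simplexCyclicModule.proj_surjective (cent_commute_self x) n v
  exact LinearMap.congr_fun (f := f ∘ₗ ((centCyclicModule k x).mkHom σ m).f n ∘ₗ
      simplexCyclicModule.proj (cent_commute_self x) n)
    (g := f' ∘ₗ ((centCyclicModule k x).mkHom σ m).f n ∘ₗ
      simplexCyclicModule.proj (cent_commute_self x) n) (simplexModule_ext fun y => hf m y) v

theorem centSimplex_d (x : G) {n : ℕ} (i : Fin (n + 2)) (y : Fin (n + 2) → G) :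
    (centCyclicModule k x).d n i (centSimplex k x y) = centSimplex k x fun j => y (i.succAbove j) :=
  congrArg (simplexCyclicModule.proj (cent_commute_self x) n) (simplexMap_single _ _ _)

theorem centSimplex_t (x : G) {n : ℕ} (y : Fin (n + 1) → G) :
    (centCyclicModule k x).t n (centSimplex k x y) =
      centSimplex k x (rotateSimplex (⟨x, self_mem_cent x⟩ : Cent x) n y) :=
  congrArg (simplexCyclicModule.proj (cent_commute_self x) n) (simplexMap_single _ _ _)

theorem centSimplex_smul (x : G) (g : Cent x) {n : ℕ} (y : Fin (n + 1) → G) :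
    (centCyclicModule k x).ρ n (g : CentBar x) (centSimplex k x y) =
      centSimplex k x fun j => g • y j :=
  congrArg (simplexCyclicModule.proj (cent_commute_self x) n) (simplexMap_single _ _ _)

namespace IsStronglyGraded

/-- The underlying representation of `IsStronglyGraded.rep`. -/
def compRep (x : G) : Representation k (CentBar x) (CompBar 𝒜 x) := (h.rep x).ρ

theorem compRep_mk (x : G) (g : Cent x) (m : CompBar 𝒜 x) :
    h.compRep x (g : CentBar x) m = h.action x g m := rfl

/-- `loopTensor` as a linear map on the module of simplices. -/
def simplexTensor (x : G) (n : ℕ) :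
    SimplexModule k G n →ₗ[k] CompBar 𝒜 x →ₗ[k] CyclicTensor h.base n :=
  Finsupp.linearCombination k fun y => h.loopTensor x y

theorem simplexTensor_single (x : G) {n : ℕ} (y : Fin (n + 1) → G) :
    h.simplexTensor x n (Finsupp.single y 1) = h.loopTensor x y := by
  simp [simplexTensor]

theorem simplexTensor_smul (x : G) {n : ℕ} (g : Cent x) (v : SimplexModule k G n)
    (m : CompBar 𝒜 x) :
    h.simplexTensor x n (simplexRep k G n g v) (h.action x g m) = h.simplexTensor x n v m := by
  refine LinearMap.congr_fun
    (f := LinearMap.applyₗ (h.action x g m) ∘ₗ h.simplexTensor x n ∘ₗ simplexRep k G n g)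
    (g := LinearMap.applyₗ m ∘ₗ h.simplexTensor x n) (simplexModule_ext fun y => ?_) v
  simp only [LinearMap.comp_apply, LinearMap.applyₗ_apply_apply, simplexRep_single,
    simplexTensor_single]
  exact h.loopTensor_smul x y g m

/-- `loopTensor` as a linear map on `centCyclicModule`. -/
def centTensor (x : G) (n : ℕ) :
    (centCyclicModule k x).X n →ₗ[k] CompBar 𝒜 x →ₗ[k] CyclicTensor h.base n :=
  Submodule.liftQ _ (h.simplexTensor x n) <| by
    rintro _ ⟨v, rfl⟩
    rw [LinearMap.mem_ker]
    refine LinearMap.ext fun m => ?_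
    -- The element `x` acts trivially on `A_x / [A_x, B]`, so invariance under `G_x` permits
    -- dividing the simplices by `x` alone.
    have := h.simplexTensor_smul x ⟨x, self_mem_cent x⟩ v m
    rw [h.action_self] at this
    simpa [sub_eq_zero] using this.symm

theorem centTensor_smul (x : G) {n : ℕ} (q : CentBar x) (v : (centCyclicModule k x).X n)
    (m : CompBar 𝒜 x) :
    h.centTensor x n ((centCyclicModule k x).ρ n q v) (h.compRep x q m) = h.centTensor x n v m := by
  induction q using QuotientGroup.induction_on with | _ g
  obtain ⟨v, rfl⟩ := simplexCyclicModule.proj_surjective (cent_commute_self x) n v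
  exact h.simplexTensor_smul x g v m

/-- The map from the coinvariants to the cyclic tensor power. -/
def coinvTensor (x : G) (n : ℕ) :
    ((centCyclicModule k x).coinv (h.compRep x)).X n →ₗ[k] CyclicTensor h.base n :=
  Representation.Coinvariants.lift _ (TensorProduct.lift (h.centTensor x n).flip) fun q =>
    TensorProduct.ext' fun m v => h.centTensor_smul x q v m

theorem coinvTensor_mk (x : G) {n : ℕ} (y : Fin (n + 1) → G) (m : CompBar 𝒜 x) :
    h.coinvTensor x n (((centCyclicModule k x).mkHom (h.compRep x) m).f n (centSimplex k x y)) =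
      h.loopTensor x y m :=
  LinearMap.congr_fun (h.simplexTensor_single x y) m

/-- The morphism of cyclic modules from the coinvariants to the cyclic module of the extension. -/
def coinvHom (x : G) : CyclicModule.Hom ((centCyclicModule k x).coinv (h.compRep x))
    (relativeCyclicModule h.base) := by
  have ht : ∀ n v, h.coinvTensor x n (((centCyclicModule k x).coinv (h.compRep x)).t n v) =
      rot h.base n (h.coinvTensor x n v) := fun n v => by
    refine LinearMap.congr_fun (f := h.coinvTensor x n ∘ₗ
      ((centCyclicModule k x).coinv (h.compRep x)).t n)
      (g := rot h.base n ∘ₗ h.coinvTensor x n) (centCyclicModule_ext x _ fun m y => ?_) v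
    rw [LinearMap.comp_apply, LinearMap.comp_apply, ← CyclicModule.Hom.map_t, centSimplex_t,
      coinvTensor_mk, coinvTensor_mk, loopTensor_rotate]
  have hd : ∀ n (i : Fin (n + 1)) v, h.coinvTensor x n
      (((centCyclicModule k x).coinv (h.compRep x)).d n i.castSucc v) =
      face h.base n i (h.coinvTensor x (n + 1) v) := fun n i v => by
    refine LinearMap.congr_fun (f := h.coinvTensor x n ∘ₗ
      ((centCyclicModule k x).coinv (h.compRep x)).d n i.castSucc)
      (g := face h.base n i ∘ₗ h.coinvTensor x (n + 1)) (centCyclicModule_ext x _ fun m y => ?_) v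
    rw [LinearMap.comp_apply, LinearMap.comp_apply, ← CyclicModule.Hom.map_d, centSimplex_d,
      coinvTensor_mk, coinvTensor_mk, loopTensor_delete]
  exact
  { f := h.coinvTensor x
    map_d := fun n i v => by
      refine Fin.lastCases ?_ (fun i => ?_) i
      -- The last face is face `0` after the cyclic operator on both sides, so it follows from the
      -- cases already shown.
      · rw [← ((centCyclicModule k x).coinv (h.compRep x)).d_zero_comp_t,
          ← (relativeCyclicModule h.base).d_zero_comp_t, LinearMap.comp_apply, LinearMap.comp_apply]
        refine (hd n 0 _).trans ?_
        rw [ht]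
        exact (LinearMap.congr_fun (relFace_castSucc h.base n 0) _).symm
      · refine (hd n i v).trans ?_
        exact (LinearMap.congr_fun (relFace_castSucc h.base n i) _).symm
    map_t := ht }

end IsStronglyGraded

end LoopTensors

/-! ### Loops with prescribed steps, and the decomposition over conjugacy classes. -/

section Loops

variable {G : Type u} [Group G]

/-- If `w x w⁻¹` is the product of `g`, the partial products of `g` started at `x⁻¹ w⁻¹` end at
`w⁻¹`, so the path closes up in the twisted sense. -/
theorem exists_loopSteps_eq {x : G} {n : ℕ} (g : Fin (n + 1) → G) (hx : IsConj x (tupleProd g)) :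
    ∃ y, loopSteps x y = g := by
  obtain ⟨w, hw⟩ := isConj_iff.1 hx
  have hl : x⁻¹ * w⁻¹ * Fin.partialProd g (Fin.last n).succ = w⁻¹ := by
    have : Fin.partialProd g (Fin.last n).succ = tupleProd g := by
      rw [Fin.partialProd, tupleProd]
      congr 1
      exact List.take_of_length_le (by simp)
    rw [this, ← hw]
    group
  refine ⟨fun j => x⁻¹ * w⁻¹ * Fin.partialProd g j.succ, funext fun j => ?_⟩
  refine Fin.cases ?_ (fun j => ?_) j
  · rw [loopSteps_zero, hl, Fin.partialProd_succ, Fin.castSucc_zero, Fin.partialProd_zero, one_mul,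
      inv_mul_cancel_left]
  · rw [loopSteps_succ, Fin.partialProd_succ g j.succ, ← Fin.succ_castSucc]
    group

/-- The last vertices determine the translation `w`. It centralizes `x` because the two loops have
the same product, and equality of the steps carries the translation from vertex to vertex. -/
theorem exists_cent_of_loopSteps_eq {x : G} {n : ℕ} {y y' : Fin (n + 1) → G}
    (h : loopSteps x y = loopSteps x y') : ∃ g : Cent x, y' = fun j => g • y j := by
  let w := y' (Fin.last n) * (y (Fin.last n))⁻¹
  have hw : w * x = x * w := by
    have := congrArg tupleProd h
    rw [tupleProd_loopSteps, tupleProd_loopSteps] at this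
    have e : y' (Fin.last n) * ((y (Fin.last n))⁻¹ * x * y (Fin.last n)) * (y (Fin.last n))⁻¹ =
      w * x := by simp only [w]; group
    rw [← e, this]
    simp only [w]; group
  have hl : y' (Fin.last n) = w * y (Fin.last n) := by simp [w]
  refine ⟨⟨w, Subgroup.mem_centralizer_singleton_iff.2 hw⟩, funext fun j => ?_⟩
  change y' j = w * y j
  induction j using Fin.induction with
  | zero =>
    have := congrFun h 0
    rw [loopSteps_zero, loopSteps_zero, hl] at this
    have e : y' 0 = (x⁻¹ * (w * y (Fin.last n))) * ((x⁻¹ * (w * y (Fin.last n)))⁻¹ * y' 0) := by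
      group
    rw [e, ← this]
    have hw' : x⁻¹ * w * x = w := by rw [mul_assoc, hw, inv_mul_cancel_left]
    conv_rhs => rw [← hw']
    group
  | succ j ih =>
    have := congrFun h j.succ
    rw [loopSteps_succ, loopSteps_succ, ih] at this
    have e : y' j.succ = (w * y j.castSucc) * ((w * y j.castSucc)⁻¹ * y' j.succ) := by group
    rw [e, ← this]
    group

end Loops

section Decomposition

variable {k : Type u} [CommRing k] {G : Type u} [Group G] {A : Type u} [Ring A] [Algebra k A]
  {𝒜 : G → Submodule k A} (h : IsStronglyGraded 𝒜)

namespace IsStronglyGraded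

include h in
theorem tupleProd_mem {n : ℕ} (g : Fin (n + 1) → G) (a : Fin (n + 1) → A)
    (ha : ∀ j, a j ∈ 𝒜 (g j)) : tupleProd a ∈ 𝒜 (tupleProd g) := by
  induction n with
  | zero => rw [tupleProd_one, tupleProd_one]; exact ha 0
  | succ n ih =>
    rw [tupleProd_succ a, tupleProd_succ g]
    exact h.mul_mem (ha 0) (ih _ _ fun j => ha j.succ) rfl

/-- The map `m ↦ [m ⊗ y]`. -/
def coinvLeft (x : G) {n : ℕ} (y : Fin (n + 1) → G) :
    CompBar 𝒜 x →ₗ[k] ((centCyclicModule k x).coinv (h.compRep x)).X n :=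
  Representation.Coinvariants.mk ((h.compRep x).tprod ((centCyclicModule k x).ρ n)) ∘ₗ
    (TensorProduct.mk k (CompBar 𝒜 x) ((centCyclicModule k x).X n)).flip (centSimplex k x y)

theorem coinvLeft_apply (x : G) {n : ℕ} (y : Fin (n + 1) → G) (m : CompBar 𝒜 x) :
    h.coinvLeft x y m = ((centCyclicModule k x).mkHom (h.compRep x) m).f n (centSimplex k x y) := rfl

theorem coinvLeft_smul (x : G) {n : ℕ} (g : Cent x) (y : Fin (n + 1) → G) (m : CompBar 𝒜 x) :
    h.coinvLeft x (fun j => g • y j) (h.action x g m) = h.coinvLeft x y m := by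
  have := Representation.Coinvariants.mk_self_apply
    ((h.compRep x).tprod ((centCyclicModule k x).ρ n)) (g : CentBar x) (m ⊗ₜ centSimplex k x y)
  rw [Representation.tprod_apply, TensorProduct.map_tmul, centSimplex_smul, compRep_mk] at this
  exact this

variable (t : ConjClasses G → G)

/-- The cyclic module of the component of `c`. -/
abbrev classModule (c : ConjClasses G) : CyclicModule.{u, u} k :=
  (centCyclicModule k (t c)).coinv (h.compRep (t c))

/-- The class of `v ⊗ y`, where `y` is a loop with the given steps. -/
def fromSteps [DecidableEq (ConjClasses G)] {n : ℕ}
    (Y : (Fin (n + 1) → G) → Fin (n + 1) → G) :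
    ((Fin (n + 1) → G) →₀ BaseQuotient 𝒜) →ₗ[k] ⨁ c, (h.classModule t c).X n :=
  Finsupp.lsum k fun g =>
    DirectSum.lof k (ConjClasses G) (fun c => (h.classModule t c).X n)
        (ConjClasses.mk (tupleProd g)) ∘ₗ
      h.coinvLeft _ (Y g) ∘ₗ h.compProj _ ∘ₗ h.baseRep (Y g (Fin.last n))

theorem fromSteps_single [DecidableEq (ConjClasses G)] {n : ℕ}
    (Y : (Fin (n + 1) → G) → Fin (n + 1) → G) (g : Fin (n + 1) → G) (v : BaseQuotient 𝒜) :
    h.fromSteps t Y (Finsupp.single g v) =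
      DirectSum.lof k (ConjClasses G) (fun c => (h.classModule t c).X n)
        (ConjClasses.mk (tupleProd g)) (h.coinvLeft _ (Y g)
          (h.compProj _ (h.baseRep (Y g (Fin.last n)) v))) :=
  Finsupp.lsum_single _ _ _ _

/-- The sum of the maps `coinvTensor` over all conjugacy classes. -/
def sumTensor [DecidableEq (ConjClasses G)] (n : ℕ) :
    (⨁ c, (h.classModule t c).X n) →ₗ[k] CyclicTensor h.base n :=
  DirectSum.toModule k (ConjClasses G) _ fun c => h.coinvTensor (t c) n

section

variable [DecidableEq (ConjClasses G)] {n : ℕ} {Y : (Fin (n + 1) → G) → Fin (n + 1) → G}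
  (hY : ∀ g, loopSteps (t (ConjClasses.mk (tupleProd g))) (Y g) = g)

include hY in
-- `fromSteps` transports by the last vertex of the chosen loop and `loopTensor` transports back, so
-- only the projection to the degree of the product remains.
theorem sumTensor_fromSteps_single (g : Fin (n + 1) → G) (v : BaseQuotient 𝒜) :
    h.sumTensor t n (h.fromSteps t Y (Finsupp.single g v)) =
      h.split n g (compIncl 𝒜 (tupleProd g) (h.compProj (tupleProd g) v)) := by
  rw [fromSteps_single, sumTensor, DirectSum.toModule_lof, coinvLeft_apply, coinvTensor_mk,
    loopTensor, LinearMap.comp_apply, LinearMap.comp_apply, hY]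
  have e : Y g (Fin.last n) * tupleProd g * (Y g (Fin.last n))⁻¹ =
      t (ConjClasses.mk (tupleProd g)) := by
    conv_lhs => rw [← hY g]
    rw [tupleProd_loopSteps, hY]
    group
  rw [h.compProj_baseRep _ _ _ e, ← Module.End.mul_apply, ← map_mul, inv_mul_cancel, map_one]
  rfl

include hY in
theorem compProj_eq_zero_of_compIncl (g : Fin (n + 1) → G) (v : BaseQuotient 𝒜)
    (hv : compIncl 𝒜 (tupleProd g) (h.compProj (tupleProd g) v) = 0) :
    h.fromSteps t Y (Finsupp.single g v) = 0 := by
  have e : Y g (Fin.last n) * tupleProd g * (Y g (Fin.last n))⁻¹ =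
      t (ConjClasses.mk (tupleProd g)) := by
    conv_lhs => rw [← hY g]
    rw [tupleProd_loopSteps, hY]
    group
  rw [fromSteps_single, ← h.compProj_compIncl _ (h.compProj _ _), h.compProj_baseRep _ _ _ e, hv,
    map_zero, map_zero, map_zero, map_zero]

include hY in
-- Loops with equal steps differ by an element of `G_x`, so in the coinvariants each generator can
-- be rewritten with the chosen loop `Y g`.
theorem fromSteps_surjective (ht : ∀ c, ConjClasses.mk (t c) = c) :
    Function.Surjective (h.fromSteps t Y) := by
  have key : ∀ c (y : Fin (n + 1) → G) (m : CompBar 𝒜 (t c)),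
      DirectSum.lof k (ConjClasses G) (fun c => (h.classModule t c).X n) c
        (h.coinvLeft _ y m) ∈ LinearMap.range (h.fromSteps t Y) := by
    intro c y m
    have e : ConjClasses.mk (tupleProd (loopSteps (t c) y)) = c := by
      conv_rhs => rw [← ht c]
      rw [ConjClasses.mk_eq_mk_iff_isConj, tupleProd_loopSteps]
      exact (isConj_iff.2 ⟨(y (Fin.last n))⁻¹, by rw [inv_inv]⟩).symm
    generalize hg : loopSteps (t c) y = g at e
    subst e
    obtain ⟨γ, hγ⟩ := exists_cent_of_loopSteps_eq (hg.trans (hY g).symm)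
    refine ⟨Finsupp.single g (h.baseRep (Y g (Fin.last n))⁻¹
      (compIncl 𝒜 _ (h.action _ γ m))), ?_⟩
    rw [fromSteps_single, ← Module.End.mul_apply, ← map_mul, mul_inv_cancel, map_one,
      Module.End.one_apply, h.compProj_compIncl, ← h.coinvLeft_smul _ γ y m, ← hγ]
  intro u
  rw [← LinearMap.mem_range]
  induction u using DirectSum.induction_on with
  | zero => exact zero_mem _
  | of c u =>
    have : (LinearMap.range (h.fromSteps t Y)).mkQ ∘ₗ
        DirectSum.lof k (ConjClasses G) (fun c => (h.classModule t c).X n) c = 0 :=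
      centCyclicModule_ext _ _ fun m y => (Submodule.Quotient.mk_eq_zero _).2 (key c y m)
    exact (Submodule.Quotient.mk_eq_zero _).1 (LinearMap.congr_fun this u)
  | add u v hu hv => exact add_mem hu hv

include hY in
-- Injectivity: every element comes from coefficients indexed by degree tuples, and `multiply`
-- recovers each of them up to the part that `fromSteps` ignores. Surjectivity: homogeneous tensors
-- span, and each is the split of its product.
theorem sumTensor_bijective' (ht : ∀ c, ConjClasses.mk (t c) = c) :
    Function.Bijective (h.sumTensor t n) := by
  constructor
  · refine (injective_iff_map_eq_zero _).2 fun u hu => ?_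
    obtain ⟨f, rfl⟩ := h.fromSteps_surjective t hY ht u
    have h1 : ∀ g, compIncl 𝒜 (tupleProd g) (h.compProj (tupleProd g) (f g)) = 0 := fun g => by
      have : h.multiply n g ∘ₗ h.sumTensor t n ∘ₗ h.fromSteps t Y =
          compIncl 𝒜 (tupleProd g) ∘ₗ h.compProj (tupleProd g) ∘ₗ Finsupp.lapply g := by
        refine Finsupp.lhom_ext' fun g' => LinearMap.ext fun v => ?_
        obtain ⟨a, rfl⟩ := baseMk_surjective v
        simp only [LinearMap.comp_apply, Finsupp.lsingle_apply, Finsupp.lapply_apply,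
          h.sumTensor_fromSteps_single t hY, h.compIncl_compProj_mk]
        by_cases hg : g' = g
        · subst hg
          rw [h.multiply_split_self _ (h.proj_mem _ _), Finsupp.single_eq_same,
            h.compIncl_compProj_mk]
        · rw [h.multiply_split_of_ne hg (h.proj_mem _ _), Finsupp.single_eq_of_ne (Ne.symm hg), map_zero,
            map_zero]
      have := LinearMap.congr_fun this f
      simp only [LinearMap.comp_apply, hu, map_zero, Finsupp.lapply_apply] at this
      exact this.symm
    rw [← f.sum_single, Finsupp.sum, map_sum]
    exact Finset.sum_eq_zero fun g _ => h.compProj_eq_zero_of_compIncl t hY g _ (h1 g)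
  · rw [← LinearMap.range_eq_top, ← Submodule.ker_mkQ (LinearMap.range (h.sumTensor t n)),
      LinearMap.ker_eq_top]
    refine h.cyclicTensor_ext_homogeneous fun g a ha => ?_
    refine (Submodule.Quotient.mk_eq_zero _).2
      ⟨h.fromSteps t Y (Finsupp.single g (baseMk 𝒜 (tupleProd a))), ?_⟩
    rw [h.sumTensor_fromSteps_single t hY, h.compIncl_compProj_mk,
      h.proj_of_mem (h.tupleProd_mem g a ha), h.split_tupleProd n g a ha]

end

theorem sumTensor_bijective [DecidableEq (ConjClasses G)] (ht : ∀ c, ConjClasses.mk (t c) = c)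
    (n : ℕ) : Function.Bijective (h.sumTensor t n) := by
  have : ∀ g : Fin (n + 1) → G, ∃ y, loopSteps (t (ConjClasses.mk (tupleProd g))) y = g := fun g =>
    exists_loopSteps_eq g (ConjClasses.mk_eq_mk_iff_isConj.1 (ht _))
  choose Y hY using this
  exact h.sumTensor_bijective' t hY ht

end IsStronglyGraded

end Decomposition

/-! ### Assembling the homology of `Z(A/B)` for strongly graded algebras. -/

section StronglyGradedHomology

variable {k : Type u} [Field k] [CharZero k] {G : Type u} [Group G] {A : Type u} [Ring A]
  [Algebra k A] {𝒜 : G → Submodule k A} (h : IsStronglyGraded 𝒜)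

/-- The cyclic homology of the extension `A / A_1` for a strongly graded algebra `A`. -/
theorem IsStronglyGraded.nonempty_equiv_burgheleaSum (t : ConjClasses G → G)
    (ht : ∀ c, ConjClasses.mk (t c) = c) (n : ℕ) :
    Nonempty (LinHomology (relativeCyclicModule h.base).D n ≃ₗ[k] BurgheleaSum t h.rep n) := by
  classical
  have hfree : ∀ (x : G) (γ : Cent x) (y : G), γ • y = y → γ = 1 := fun x γ y hy =>
    Subtype.ext (mul_eq_right.1 hy)
  have hfin : ∀ x : G, IsOfFinOrder (⟨x, self_mem_cent x⟩ : Cent x) ↔ IsOfFinOrder x := fun x =>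
    Submonoid.isOfFinOrder_coe.symm
  obtain ⟨e1⟩ := CyclicModule.nonempty_directSum_homology_equiv (h.classModule t)
    (fun c => h.coinvHom (t c)) (fun n => h.sumTensor_bijective t ht n) n
  obtain ⟨e2⟩ := nonempty_directSum_split (k := k) (fun c => IsOfFinOrder (t c))
    fun c => LinHomology (h.classModule t c).D n
  have e3 : ∀ c : {c // IsOfFinOrder (t c)}, Nonempty (LinHomology (h.classModule t c).D n ≃ₗ[k]
      ⨁ i : {i : ℕ // 2 * i ≤ n}, groupHomology (h.rep (t c)) (n - 2 * i)) := fun c =>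
    simplexCyclicModule.nonempty_equiv_of_isOfFinOrder (cent_commute_self (t c))
      ((hfin _).2 c.2) (hfree _) (h.rep (t c)) n
  have e4 : ∀ c : {c // ¬ IsOfFinOrder (t c)}, Nonempty (LinHomology (h.classModule t c).D n ≃ₗ[k]
      groupHomology (h.rep (t c)) n) := fun c =>
    simplexCyclicModule.nonempty_equiv_of_not_isOfFinOrder (cent_commute_self (t c))
      (fun hc => c.2 ((hfin _).1 hc)) (hfree _) (h.rep (t c)) n
  exact ⟨e1.symm.trans (e2.trans (LinearEquiv.prodCongr
    (DFinsupp.mapRange.linearEquiv fun c => (e3 c).some)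
    (DFinsupp.mapRange.linearEquiv fun c => (e4 c).some)))⟩

end StronglyGradedHomology

/-! ### Tensor powers over `k` by first and last factor, and the bar complex. -/

section TensorPowers

variable {k : Type u} [CommRing k] {A : Type v} [Ring A] [Algebra k A]

/-- The tensor power of `A` with `n` factors. -/
abbrev TensorPow (k : Type u) [CommRing k] (A : Type v) [Ring A] [Algebra k A] (n : ℕ) :
    Type (max u v) := ⨂[k] _ : Fin n, A

/-- `x ⊗ y` for `x : A` and `y` in the `n`-th tensor power. -/
def tcons {n : ℕ} : A →ₗ[k] TensorPow k A n →ₗ[k] TensorPow k A (n + 1) :=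
  (PiTensorProduct.lift (R := k) (s := fun _ : Fin n => A)).toLinearMap ∘ₗ
    (PiTensorProduct.tprod k (s := fun _ : Fin (n + 1) => A)).curryLeft

theorem tcons_tprod {n : ℕ} (x : A) (c : Fin n → A) :
    tcons x (PiTensorProduct.tprod k c) = PiTensorProduct.tprod k (consTuple x c) :=
  PiTensorProduct.lift.tprod _

theorem tprod_eq_tcons {n : ℕ} (a : Fin (n + 1) → A) :
    PiTensorProduct.tprod k a = tcons (a 0) (PiTensorProduct.tprod k fun j => a j.succ) := by
  rw [tcons_tprod]
  exact congrArg _ (Fin.cons_self_tail (α := fun _ => A) a).symm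

theorem tcons_ext {n : ℕ} {N : Type*} [AddCommGroup N] [Module k N]
    {f g : TensorPow k A (n + 1) →ₗ[k] N} (h : ∀ x y, f (tcons x y) = g (tcons x y)) : f = g := by
  refine PiTensorProduct.ext (MultilinearMap.ext fun a => ?_)
  change f (PiTensorProduct.tprod k a) = g (PiTensorProduct.tprod k a)
  rw [tprod_eq_tcons, h]

/-- The linear map with `x ⊗ y ↦ F x y`. -/
def tconsLift {n : ℕ} {N : Type*} [AddCommGroup N] [Module k N]
    (F : A →ₗ[k] TensorPow k A n →ₗ[k] N) : TensorPow k A (n + 1) →ₗ[k] N :=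
  PiTensorProduct.lift (LinearMap.uncurryLeft (M := fun _ : Fin (n + 1) => A)
    ((PiTensorProduct.lift (R := k) (s := fun _ : Fin n => A)).symm.toLinearMap ∘ₗ F))

theorem tconsLift_tcons {n : ℕ} {N : Type*} [AddCommGroup N] [Module k N]
    (F : A →ₗ[k] TensorPow k A n →ₗ[k] N) (x : A) (y) : tconsLift F (tcons x y) = F x y := by
  suffices h : tconsLift F ∘ₗ tcons x = F x from LinearMap.congr_fun h y
  refine PiTensorProduct.ext (MultilinearMap.ext fun c => ?_)
  change tconsLift F (tcons x (PiTensorProduct.tprod k c)) = F x (PiTensorProduct.tprod k c)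
  rw [tcons_tprod, tconsLift, PiTensorProduct.lift.tprod]
  rfl

/-- Left multiplication of the first factor. -/
def firstMul {n : ℕ} : A →ₗ[k] TensorPow k A (n + 1) →ₗ[k] TensorPow k A (n + 1) where
  toFun x := tconsLift (tcons ∘ₗ LinearMap.mulLeft k x)
  map_add' x x' := tcons_ext fun z y => by
    simp only [LinearMap.add_apply, tconsLift_tcons, LinearMap.comp_apply, LinearMap.mulLeft_apply,
      add_mul, map_add]
  map_smul' c x := tcons_ext fun z y => by
    simp only [LinearMap.smul_apply, tconsLift_tcons, LinearMap.comp_apply, LinearMap.mulLeft_apply,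
      smul_mul_assoc, map_smul, RingHom.id_apply]

theorem firstMul_tcons {n : ℕ} (x z : A) (y : TensorPow k A n) :
    firstMul x (tcons z y) = tcons (x * z) y := tconsLift_tcons _ z y

theorem firstMul_tprod {n : ℕ} (x : A) (a : Fin (n + 1) → A) :
    firstMul x (PiTensorProduct.tprod k a) =
      PiTensorProduct.tprod k fun j => Pi.mulSingle (M := fun _ => A) 0 x j * a j := by
  rw [← Fin.cons_self_tail (α := fun _ => A) a]
  change firstMul x (PiTensorProduct.tprod k (consTuple _ _)) =
    PiTensorProduct.tprod k fun j => Pi.mulSingle (M := fun _ => A) 0 x j * consTuple _ _ j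
  rw [← tcons_tprod, firstMul_tcons, tcons_tprod]
  congr 1
  funext j
  refine Fin.cases ?_ (fun j => ?_) j
  · simp
  · simp

theorem firstMul_one {n : ℕ} (t : TensorPow k A (n + 1)) : firstMul 1 t = t := by
  suffices h : firstMul (k := k) (A := A) (n := n) 1 = LinearMap.id from LinearMap.congr_fun h t
  exact tcons_ext fun z y => by rw [firstMul_tcons, one_mul]; rfl

theorem firstMul_mul {n : ℕ} (x x' : A) (t : TensorPow k A (n + 1)) :
    firstMul (x * x') t = firstMul x (firstMul x' t) := by
  suffices h : firstMul (k := k) (A := A) (n := n) (x * x') = firstMul x ∘ₗ firstMul x' from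
    LinearMap.congr_fun h t
  exact tcons_ext fun z y => by
    rw [LinearMap.comp_apply, firstMul_tcons, firstMul_tcons, firstMul_tcons, mul_assoc]

/-- `w ⊗ z` for `z : A` and `w` in the `n`-th tensor power. -/
def tsnoc {n : ℕ} (z : A) : TensorPow k A n →ₗ[k] TensorPow k A (n + 1) :=
  (PiTensorProduct.reindex k (fun _ => A) (Equiv.addRight (1 : Fin (n + 1)))).symm.toLinearMap ∘ₗ
    tcons z

theorem tensorRot_tsnoc {n : ℕ} (z : A) (w : TensorPow k A n) :
    tensorRot n (tsnoc z w) = tcons z w :=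
  LinearEquiv.apply_symm_apply _ _

theorem tensorRot_injective (n : ℕ) : Function.Injective (tensorRot (k := k) (A := A) n) :=
  LinearEquiv.injective _

theorem tsnoc_tprod {n : ℕ} (z : A) (c : Fin n → A) :
    tsnoc z (PiTensorProduct.tprod k c) = PiTensorProduct.tprod k fun j => consTuple z c (j + 1) := by
  apply tensorRot_injective
  rw [tensorRot_tsnoc, tcons_tprod, tensorRot_tprod]
  simp only [sub_add_cancel]

theorem tsnoc_ext {n : ℕ} {N : Type*} [AddCommGroup N] [Module k N]
    {f g : TensorPow k A (n + 1) →ₗ[k] N} (h : ∀ z w, f (tsnoc z w) = g (tsnoc z w)) : f = g := by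
  let e := PiTensorProduct.reindex k (fun _ => A) (Equiv.addRight (1 : Fin (n + 1)))
  have : f ∘ₗ e.symm.toLinearMap = g ∘ₗ e.symm.toLinearMap := tcons_ext h
  refine LinearMap.ext fun t => ?_
  simpa using LinearMap.congr_fun this (e t)

theorem tcons_tsnoc {n : ℕ} (x z : A) (w : TensorPow k A n) :
    tcons x (tsnoc z w) = tsnoc z (tcons x w) := by
  suffices h : (tcons x : TensorPow k A (n + 1) →ₗ[k] _) ∘ₗ tsnoc z = tsnoc z ∘ₗ tcons x from
    LinearMap.congr_fun h w
  refine PiTensorProduct.ext (MultilinearMap.ext fun c => ?_)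
  change tcons x (tsnoc z (PiTensorProduct.tprod k c)) = tsnoc z (tcons x (PiTensorProduct.tprod k c))
  rw [tsnoc_tprod, tcons_tprod, tcons_tprod, tsnoc_tprod]
  congr 1
  funext j
  refine Fin.cases ?_ (fun j => ?_) j
  · rw [consTuple_zero, zero_add, ← Fin.succ_zero_eq_one]; rfl
  · rw [consTuple_succ]
    refine Fin.lastCases ?_ (fun j => ?_) j
    · rw [Fin.last_add_one, Fin.succ_last, Fin.last_add_one]; rfl
    · rw [Fin.coeSucc_eq_succ, Fin.succ_castSucc, Fin.coeSucc_eq_succ]; rfl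

theorem tsnoc_zero (z : A) (y : TensorPow k A 0) : tsnoc z y = tcons z y := by
  rw [← tensorRot_tsnoc]
  suffices h : tensorRot (k := k) (A := A) 0 = LinearMap.id by rw [h]; rfl
  refine PiTensorProduct.ext (MultilinearMap.ext fun a => ?_)
  change tensorRot 0 (PiTensorProduct.tprod k a) = PiTensorProduct.tprod k a
  rw [tensorRot_tprod]
  congr 1
  funext j
  congr 1
  exact Subsingleton.elim (α := Fin 1) _ _

theorem firstMul_tsnoc {n : ℕ} (x z : A) (w : TensorPow k A (n + 1)) :
    firstMul x (tsnoc z w) = tsnoc z (firstMul x w) := by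
  suffices h : firstMul x ∘ₗ tsnoc z = tsnoc z ∘ₗ (firstMul x : TensorPow k A (n + 1) →ₗ[k] _) from
    LinearMap.congr_fun h w
  exact tcons_ext fun a y => by
    simp only [LinearMap.comp_apply, ← tcons_tsnoc, firstMul_tcons]

/-- Right multiplication of the last factor. -/
def lastMul {n : ℕ} (b : A) : TensorPow k A (n + 1) →ₗ[k] TensorPow k A (n + 1) :=
  PiTensorProduct.map fun j => LinearMap.mulRight k (Pi.mulSingle (M := fun _ => A) 0 b (j + 1))

theorem lastMul_tprod {n : ℕ} (b : A) (a : Fin (n + 1) → A) :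
    lastMul b (PiTensorProduct.tprod k a) =
      PiTensorProduct.tprod k fun j => a j * Pi.mulSingle (M := fun _ => A) 0 b (j + 1) :=
  PiTensorProduct.map_tprod _ _

theorem lastMul_tcons {n : ℕ} (b x : A) (y : TensorPow k A (n + 1)) :
    lastMul b (tcons x y) = tcons x (lastMul b y) := by
  suffices h : lastMul b ∘ₗ tcons x = tcons x ∘ₗ (lastMul b : TensorPow k A (n + 1) →ₗ[k] _) from
    LinearMap.congr_fun h y
  refine PiTensorProduct.ext (MultilinearMap.ext fun c => ?_)
  change lastMul b (tcons x (PiTensorProduct.tprod k c)) = tcons x (lastMul b (PiTensorProduct.tprod k c))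
  rw [lastMul_tprod, tcons_tprod, tcons_tprod, lastMul_tprod, consTuple_mul_mulSingle_zero]

theorem lastMul_tsnoc {n : ℕ} (b z : A) (w : TensorPow k A n) :
    lastMul b (tsnoc z w) = tsnoc (z * b) w := by
  suffices h : lastMul b ∘ₗ tsnoc z = (tsnoc (z * b) : TensorPow k A n →ₗ[k] _) from
    LinearMap.congr_fun h w
  refine PiTensorProduct.ext (MultilinearMap.ext fun c => ?_)
  change lastMul b (tsnoc z (PiTensorProduct.tprod k c)) = tsnoc (z * b) (PiTensorProduct.tprod k c)
  rw [tsnoc_tprod, tsnoc_tprod, lastMul_tprod]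
  congr 1
  funext j
  refine Fin.cases ?_ (fun j => ?_) (j + 1)
  · simp
  · simp

theorem lastMul_tcons_zero (b x : A) (y : TensorPow k A 0) :
    lastMul b (tcons x y) = tcons (x * b) y := by
  rw [← tsnoc_zero, lastMul_tsnoc, tsnoc_zero]

theorem lastMul_firstMul {n : ℕ} (b x : A) (t : TensorPow k A (n + 1)) :
    lastMul b (firstMul x t) = firstMul x (lastMul b t) := by
  suffices h : lastMul b ∘ₗ firstMul x = firstMul x ∘ₗ (lastMul b : TensorPow k A (n + 1) →ₗ[k] _) from
    LinearMap.congr_fun h t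
  cases n with
  | zero =>
    refine tcons_ext fun a y => ?_
    change lastMul b (firstMul x (tcons a y)) = firstMul x (lastMul b (tcons a y))
    rw [firstMul_tcons, lastMul_tcons_zero, lastMul_tcons_zero, firstMul_tcons, mul_assoc]
  | succ n =>
    exact tcons_ext fun a y => by
      simp only [LinearMap.comp_apply, firstMul_tcons, lastMul_tcons]

theorem tensorMerge_zero_tcons {n : ℕ} (x : A) (y : TensorPow k A (n + 1)) :
    tensorMerge 0 (tcons x y) = firstMul x y := by
  suffices h : tensorMerge 0 ∘ₗ tcons x = (firstMul x : TensorPow k A (n + 1) →ₗ[k] _) from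
    LinearMap.congr_fun h y
  refine PiTensorProduct.ext (MultilinearMap.ext fun c => ?_)
  change tensorMerge 0 (tcons x (PiTensorProduct.tprod k c)) = firstMul x (PiTensorProduct.tprod k c)
  rw [tcons_tprod, tensorMerge_tprod, firstMul_tprod]
  congr 1
  funext j
  refine Fin.cases ?_ (fun j => ?_) j
  · simp [mergeAt]
  · simp [mergeAt]

theorem tensorMerge_succ_tcons {n : ℕ} (i : Fin (n + 1)) (x : A) (y : TensorPow k A (n + 2)) :
    tensorMerge i.succ (tcons x y) = tcons x (tensorMerge i y) := by
  suffices h : tensorMerge i.succ ∘ₗ tcons x = tcons x ∘ₗ (tensorMerge i : TensorPow k A (n + 2) →ₗ[k] _) from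
    LinearMap.congr_fun h y
  refine PiTensorProduct.ext (MultilinearMap.ext fun c => ?_)
  change tensorMerge i.succ (tcons x (PiTensorProduct.tprod k c)) =
    tcons x (tensorMerge i (PiTensorProduct.tprod k c))
  rw [tcons_tprod, tensorMerge_tprod, tensorMerge_tprod, tcons_tprod]
  congr 1
  funext j
  refine Fin.cases ?_ (fun j => ?_) j
  · simp [mergeAt]
  · simp [mergeAt]

variable (k A) in
/-- The last face, `a₀ ⊗ ⋯ ⊗ aₙ₊₁ ↦ aₙ₊₁ a₀ ⊗ a₁ ⊗ ⋯ ⊗ aₙ`. -/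
def lastFace (n : ℕ) : TPow k A (n + 1) →ₗ[k] TPow k A n := tensorMerge 0 ∘ₗ tensorRot (n + 1)

theorem lastFace_tsnoc {n : ℕ} (z : A) (w : TPow k A n) :
    lastFace k A n (tsnoc z w) = firstMul z w := by
  rw [lastFace, LinearMap.comp_apply, tensorRot_tsnoc, tensorMerge_zero_tcons]

/-- In both cases `b` ends up between the last and the first factor once these are multiplied. -/
theorem lastFace_lastMul {n : ℕ} (b : A) (t : TPow k A (n + 1)) :
    lastFace k A n (lastMul b t) = lastFace k A n (firstMul b t) := by
  suffices h : lastFace k A n ∘ₗ lastMul b = lastFace k A n ∘ₗ firstMul b from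
    LinearMap.congr_fun h t
  exact tsnoc_ext fun z w => by
    simp only [LinearMap.comp_apply, lastMul_tsnoc, firstMul_tsnoc, lastFace_tsnoc, firstMul_mul]

theorem lastFace_mem_cyclicRel {n : ℕ} (B : Subalgebra k A) {t : TPow k A (n + 1)}
    (ht : t ∈ cyclicRel B (n + 1)) : lastFace k A n t ∈ cyclicRel B n :=
  tensorMerge_rel B 0 (tensorRot_rel B (n + 1) ht)

variable (k A) in
/-- The differential of the bar complex. -/
def barDiff (n : ℕ) : TPow k A (n + 1) →ₗ[k] TPow k A n :=
  ∑ i : Fin (n + 1), (-1 : k) ^ (i : ℕ) • tensorMerge i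

theorem barDiff_zero_tcons (x : A) (y : TPow k A 0) : barDiff k A 0 (tcons x y) = firstMul x y := by
  simp [barDiff, tensorMerge_zero_tcons]

/-- The bar differential is recursive in the first factor. Every homotopy below is built by the same
recursion, which reduces the identities to one factor at a time. -/
theorem barDiff_succ_tcons {n : ℕ} (x : A) (y : TPow k A (n + 1)) :
    barDiff k A (n + 1) (tcons x y) = firstMul x y - tcons x (barDiff k A n y) := by
  rw [barDiff, Fin.sum_univ_succ, LinearMap.add_apply, LinearMap.sum_apply, barDiff,
    LinearMap.sum_apply, map_sum, sub_eq_add_neg, ← Finset.sum_neg_distrib]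
  congr 1
  · simp [tensorMerge_zero_tcons]
  · refine Finset.sum_congr rfl fun i _ => ?_
    simp [tensorMerge_succ_tcons, pow_succ]

theorem barDiff_firstMul {n : ℕ} (x : A) (t : TPow k A (n + 1)) :
    barDiff k A n (firstMul x t) = firstMul x (barDiff k A n t) := by
  suffices h : barDiff k A n ∘ₗ firstMul x = firstMul x ∘ₗ barDiff k A n from
    LinearMap.congr_fun h t
  cases n with
  | zero =>
    refine tcons_ext fun a y => ?_
    change barDiff k A 0 (firstMul x (tcons a y)) = firstMul x (barDiff k A 0 (tcons a y))
    rw [firstMul_tcons, barDiff_zero_tcons, barDiff_zero_tcons, firstMul_mul]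
  | succ n =>
    exact tcons_ext fun a y => by
      simp only [LinearMap.comp_apply, firstMul_tcons, barDiff_succ_tcons, firstMul_mul, map_sub]

variable (k A) in
/-- The Hochschild differential on the tensor powers of `A`. -/
def hochDiff (n : ℕ) : TPow k A (n + 1) →ₗ[k] TPow k A n :=
  barDiff k A n + (-1 : k) ^ (n + 1) • lastFace k A n

end TensorPowers

/-! ### Separability idempotents and the homotopy they induce. -/

section Separable

variable {k : Type u} [CommRing k] {A : Type v} [Ring A] [Algebra k A]

/-- A separability idempotent `∑ lᵢ ⊗ rᵢ` of a subalgebra `B`, viewed in `A ⊗ A`. -/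
structure SeparabilityIdempotent (B : Subalgebra k A) where
  ι : Type v
  [fintype : Fintype ι]
  l : ι → A
  r : ι → A
  r_mem : ∀ i, r i ∈ B
  sum_eq : ∑ i, l i * r i = 1
  move : ∀ b ∈ B, ∑ i, (b * l i) ⊗ₜ[k] r i = ∑ i, l i ⊗ₜ[k] (r i * b)

attribute [instance] SeparabilityIdempotent.fintype

theorem IsSeparableAlgebra.nonempty_separabilityIdempotent {B : Subalgebra k A}
    (hB : IsSeparableAlgebra k B) : Nonempty (SeparabilityIdempotent B) := by
  obtain ⟨s, hs, hbi⟩ := hB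
  obtain ⟨S, hS⟩ := TensorProduct.exists_finset (s 1)
  have h1 : ∑ i ∈ S, (i.1 : A) * i.2 = 1 := by
    have := LinearMap.congr_fun hs 1
    rw [LinearMap.comp_apply, hS, map_sum] at this
    simpa using congrArg (Subtype.val) this
  let ψ := TensorProduct.map B.val.toLinearMap B.val.toLinearMap
  have h2 : ∀ b : B, ∑ i ∈ S, ((b : A) * i.1) ⊗ₜ[k] (i.2 : A) =
      ∑ i ∈ S, (i.1 : A) ⊗ₜ[k] (i.2 * b : A) := by
    intro b
    -- The element `s 1` is the idempotent: multiplying it by `b` on either side gives `s b`.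
    have e : TensorProduct.map (LinearMap.mulLeft k b) (LinearMap.mulRight k 1) (s 1) =
        TensorProduct.map (LinearMap.mulLeft k 1) (LinearMap.mulRight k b) (s 1) := by
      rw [← hbi, ← hbi, mul_one, mul_one, mul_one, one_mul]
    rw [hS, map_sum, map_sum] at e
    simpa [ψ] using congrArg ψ e
  refine ⟨⟨S, fun i => i.1.1, fun i => i.1.2, fun i => i.1.2.2, ?_, ?_⟩⟩
  · rw [Finset.sum_coe_sort S (fun i => (i.1 : A) * i.2), h1]
  · intro b hb
    rw [Finset.sum_coe_sort S (fun i => (b * i.1 : A) ⊗ₜ[k] (i.2 : A)),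
      Finset.sum_coe_sort S (fun i => (i.1 : A) ⊗ₜ[k] (i.2 * b : A))]
    exact h2 ⟨b, hb⟩

namespace SeparabilityIdempotent

variable {B : Subalgebra k A} (e : SeparabilityIdempotent B)

theorem move_apply {N : Type*} [AddCommGroup N] [Module k N] (F : A →ₗ[k] A →ₗ[k] N) {b : A}
    (hb : b ∈ B) : ∑ i, F (b * e.l i) (e.r i) = ∑ i, F (e.l i) (e.r i * b) := by
  have := congrArg (TensorProduct.lift F) (e.move b hb)
  simpa using this

/-- `x ⊗ y ↦ ∑ x lᵢ ⊗ f i y`. -/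
def sumCons {n : ℕ} {M : Type*} [AddCommGroup M] [Module k M] (f : e.ι → M →ₗ[k] TensorPow k A n) :
    A →ₗ[k] M →ₗ[k] TensorPow k A (n + 1) :=
  ∑ i, (tcons ∘ₗ LinearMap.mulRight k (e.l i)).compl₂ (f i)

theorem sumCons_apply {n : ℕ} {M : Type*} [AddCommGroup M] [Module k M]
    (f : e.ι → M →ₗ[k] TensorPow k A n) (x : A) (y : M) :
    e.sumCons f x y = ∑ i, tcons (x * e.l i) (f i y) := by
  simp [sumCons, LinearMap.sum_apply]

/-- The contracting homotopy of the bar complex of `A` which is compatible with its projection to the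
bar complex of `A` over `B`. -/
def homotopy : ∀ n : ℕ, TPow k A n →ₗ[k] TPow k A (n + 1)
  | 0 => tconsLift (e.sumCons fun i => tcons (e.r i))
  | n + 1 => tconsLift (e.sumCons fun i => tcons (e.r i) - homotopy n ∘ₗ firstMul (e.r i))

theorem homotopy_zero_tcons (x : A) (y : TensorPow k A 0) :
    e.homotopy 0 (tcons x y) = ∑ i, tcons (x * e.l i) (tcons (e.r i) y) := by
  rw [homotopy, tconsLift_tcons, sumCons_apply]

theorem homotopy_succ_tcons {n : ℕ} (x : A) (y : TPow k A n) :
    e.homotopy (n + 1) (tcons x y) =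
      ∑ i, tcons (x * e.l i) (tcons (e.r i) y - e.homotopy n (firstMul (e.r i) y)) := by
  rw [homotopy, tconsLift_tcons, sumCons_apply]
  rfl

/-- `a₀ ⊗ ⋯ ⊗ aₙ ↦ ∑ a₀ l ⊗ r a₁ l' ⊗ r' a₂ l'' ⊗ ⋯ ⊗ r''' aₙ l'''' ⊗ r''''`. -/
def spread : ∀ n : ℕ, TPow k A n →ₗ[k] TPow k A (n + 1)
  | 0 => tconsLift (e.sumCons fun i => tcons (e.r i))
  | n + 1 => tconsLift (e.sumCons fun i => firstMul (e.r i) ∘ₗ spread n)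

theorem spread_zero_tcons (x : A) (y : TensorPow k A 0) :
    e.spread 0 (tcons x y) = ∑ i, tcons (x * e.l i) (tcons (e.r i) y) := by
  rw [spread, tconsLift_tcons, sumCons_apply]

theorem spread_succ_tcons {n : ℕ} (x : A) (y : TPow k A n) :
    e.spread (n + 1) (tcons x y) =
      ∑ i, tcons (x * e.l i) (firstMul (e.r i) (e.spread n y)) := by
  rw [spread, tconsLift_tcons, sumCons_apply]
  rfl

theorem homotopy_firstMul {n : ℕ} (z : A) (t : TPow k A n) :
    e.homotopy n (firstMul z t) = firstMul z (e.homotopy n t) := by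
  suffices h : e.homotopy n ∘ₗ firstMul z = firstMul z ∘ₗ e.homotopy n from LinearMap.congr_fun h t
  refine tcons_ext fun x y => ?_
  change e.homotopy n (firstMul z (tcons x y)) = firstMul z (e.homotopy n (tcons x y))
  cases n with
  | zero => simp only [firstMul_tcons, homotopy_zero_tcons, map_sum, mul_assoc]
  | succ n => simp only [firstMul_tcons, homotopy_succ_tcons, map_sum, mul_assoc]

theorem spread_firstMul {n : ℕ} (z : A) (t : TPow k A n) :
    e.spread n (firstMul z t) = firstMul z (e.spread n t) := by
  suffices h : e.spread n ∘ₗ firstMul z = firstMul z ∘ₗ e.spread n from LinearMap.congr_fun h t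
  refine tcons_ext fun x y => ?_
  change e.spread n (firstMul z (tcons x y)) = firstMul z (e.spread n (tcons x y))
  cases n with
  | zero => simp only [firstMul_tcons, spread_zero_tcons, map_sum, mul_assoc]
  | succ n => simp only [firstMul_tcons, spread_succ_tcons, map_sum, mul_assoc]

theorem sum_tcons_mul {n : ℕ} (x : A) (y : TensorPow k A n) :
    ∑ i, tcons (x * e.l i * e.r i) y = tcons x y := by
  rw [← LinearMap.sum_apply, ← map_sum]
  simp only [mul_assoc]
  rw [← Finset.mul_sum, e.sum_eq, mul_one]

theorem sum_firstMul {n : ℕ} (x : A) (t : TPow k A n) :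
    ∑ i, firstMul (x * e.l i) (firstMul (e.r i) t) = firstMul x t := by
  simp only [← firstMul_mul, mul_assoc]
  rw [← LinearMap.sum_apply, ← map_sum, ← Finset.mul_sum, e.sum_eq, mul_one]

theorem barDiff_homotopy_zero (t : TPow k A 0) : barDiff k A 0 (e.homotopy 0 t) = t := by
  suffices h : barDiff k A 0 ∘ₗ e.homotopy 0 = LinearMap.id from LinearMap.congr_fun h t
  refine tcons_ext fun x y => ?_
  change barDiff k A 0 (e.homotopy 0 (tcons x y)) = tcons x y
  rw [homotopy_zero_tcons, map_sum, ← e.sum_tcons_mul x y]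
  exact Finset.sum_congr rfl fun i _ => by rw [barDiff_zero_tcons, firstMul_tcons]

/-- The recursion of `homotopy` mirrors that of the bar differential; after `∑ lᵢ rᵢ = 1` the terms
cancel against those of the preceding degree. -/
theorem barDiff_homotopy_succ {n : ℕ} (t : TPow k A (n + 1)) :
    barDiff k A (n + 1) (e.homotopy (n + 1) t) + e.homotopy n (barDiff k A n t) = t := by
  induction n with
  | zero =>
    suffices h : barDiff k A 1 ∘ₗ e.homotopy 1 + e.homotopy 0 ∘ₗ barDiff k A 0 = LinearMap.id from
      LinearMap.congr_fun h t
    refine tcons_ext fun x y => ?_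
    change barDiff k A 1 (e.homotopy 1 (tcons x y)) + e.homotopy 0 (barDiff k A 0 (tcons x y)) =
      tcons x y
    have h1 : ∀ i, barDiff k A 1
        (tcons (x * e.l i) (tcons (e.r i) y - e.homotopy 0 (firstMul (e.r i) y))) =
          tcons (x * e.l i * e.r i) y -
            firstMul (x * e.l i) (firstMul (e.r i) (e.homotopy 0 y)) := fun i => by
      rw [barDiff_succ_tcons, map_sub, map_sub, barDiff_zero_tcons, barDiff_homotopy_zero, sub_self,
        map_zero, sub_zero, firstMul_tcons, homotopy_firstMul]
    rw [homotopy_succ_tcons, map_sum, barDiff_zero_tcons, Finset.sum_congr rfl fun i _ => h1 i,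
      Finset.sum_sub_distrib, e.sum_tcons_mul, e.sum_firstMul, homotopy_firstMul, sub_add_cancel]
  | succ n ih =>
    suffices h : barDiff k A (n + 2) ∘ₗ e.homotopy (n + 2) +
        e.homotopy (n + 1) ∘ₗ barDiff k A (n + 1) = LinearMap.id from LinearMap.congr_fun h t
    refine tcons_ext fun x y => ?_
    change barDiff k A (n + 2) (e.homotopy (n + 2) (tcons x y)) +
      e.homotopy (n + 1) (barDiff k A (n + 1) (tcons x y)) = tcons x y
    have ih' : ∀ t, barDiff k A (n + 1) (e.homotopy (n + 1) t) =
      t - e.homotopy n (barDiff k A n t) := fun t => eq_sub_of_add_eq (ih t)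
    rw [homotopy_succ_tcons, map_sum, barDiff_succ_tcons x y, map_sub, e.homotopy_succ_tcons x]
    simp only [barDiff_succ_tcons, map_sub, ih', barDiff_firstMul, firstMul_tcons, homotopy_firstMul]
    simp only [Finset.sum_sub_distrib, e.sum_tcons_mul, e.sum_firstMul]
    abel

/-- Unrolled, `homotopy` is an alternating sum over `j` of tensors with the idempotent inserted
behind `a₀, …, aⱼ`. All terms but the last leave the final factor alone, and the last one is
`spread`. -/
theorem homotopy_tsnoc {n : ℕ} (z : A) (w : TPow k A n) :
    e.homotopy (n + 1) (tsnoc z w) =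
      tsnoc z (e.homotopy n w) + (-1 : k) ^ (n + 1) • e.spread (n + 1) (tsnoc z w) := by
  suffices h : e.homotopy (n + 1) ∘ₗ tsnoc z =
      tsnoc z ∘ₗ e.homotopy n + (-1 : k) ^ (n + 1) • (e.spread (n + 1) ∘ₗ tsnoc z) from
    LinearMap.congr_fun h w
  refine tcons_ext fun x y => ?_
  change e.homotopy (n + 1) (tsnoc z (tcons x y)) = tsnoc z (e.homotopy n (tcons x y)) +
    (-1 : k) ^ (n + 1) • e.spread (n + 1) (tsnoc z (tcons x y))
  rw [← tcons_tsnoc, homotopy_succ_tcons, spread_succ_tcons]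
  clear w
  induction n generalizing x with
  | zero =>
    have h1 : (-1 : k) ^ (0 + 1) = -1 := by simp
    rw [homotopy_zero_tcons, map_sum, h1, Finset.smul_sum, ← Finset.sum_add_distrib]
    refine Finset.sum_congr rfl fun i _ => ?_
    have h0 : e.homotopy 0 (tsnoc z y) = e.spread 0 (tsnoc z y) := rfl
    rw [map_sub, homotopy_firstMul, h0, ← tcons_tsnoc, ← tcons_tsnoc, neg_one_smul,
      sub_eq_add_neg]
  | succ n ih =>
    have ih' : e.homotopy (n + 1) (tsnoc z y) =
        tsnoc z (e.homotopy n y) + (-1 : k) ^ (n + 1) • e.spread (n + 1) (tsnoc z y) := by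
      suffices h : e.homotopy (n + 1) ∘ₗ tsnoc z =
          tsnoc z ∘ₗ e.homotopy n + (-1 : k) ^ (n + 1) • (e.spread (n + 1) ∘ₗ tsnoc z) from
        LinearMap.congr_fun h y
      refine tcons_ext fun x y => ?_
      have := ih x y
      rw [← homotopy_succ_tcons, ← spread_succ_tcons, tcons_tsnoc] at this
      exact this
    rw [homotopy_succ_tcons, map_sum, Finset.smul_sum, ← Finset.sum_add_distrib]
    refine Finset.sum_congr rfl fun i _ => ?_
    rw [homotopy_firstMul, ih', homotopy_firstMul, ← tcons_tsnoc, pow_succ (-1 : k) (n + 1)]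
    simp only [map_sub, map_add, map_smul, ← tcons_tsnoc, ← firstMul_tsnoc, mul_neg_one, neg_smul]
    abel

/-- The projection of `A ⊗ ⋯ ⊗ A` whose image is isomorphic to the cyclic tensor power over `B`. -/
def retract (n : ℕ) : Module.End k (TPow k A n) := lastFace k A n ∘ₗ e.spread n

theorem hochDiff_homotopy_zero (t : TPow k A 0) :
    hochDiff k A 0 (e.homotopy 0 t) = t - e.retract 0 t := by
  change barDiff k A 0 (e.homotopy 0 t) + (-1 : k) ^ (0 + 1) • lastFace k A 0 (e.spread 0 t) = _
  have h1 : (-1 : k) ^ (0 + 1) = -1 := by simp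
  rw [barDiff_homotopy_zero, h1, neg_one_smul, sub_eq_add_neg]
  rfl

/-- On the bar part `homotopy` is a contraction. By `homotopy_tsnoc` it commutes with the last face
up to a signed `retract`; the commuting terms cancel, as the last face has opposite signs in
consecutive degrees. -/
theorem hochDiff_homotopy_succ {n : ℕ} (t : TPow k A (n + 1)) :
    hochDiff k A (n + 1) (e.homotopy (n + 1) t) + e.homotopy n (hochDiff k A n t) =
      t - e.retract (n + 1) t := by
  have h1 : lastFace k A (n + 1) (e.homotopy (n + 1) t) = e.homotopy n (lastFace k A n t) +
      (-1 : k) ^ (n + 1) • e.retract (n + 1) t := by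
    suffices h : lastFace k A (n + 1) ∘ₗ e.homotopy (n + 1) = e.homotopy n ∘ₗ lastFace k A n +
      (-1 : k) ^ (n + 1) • e.retract (n + 1) from LinearMap.congr_fun h t
    refine tsnoc_ext fun z w => ?_
    change lastFace k A (n + 1) (e.homotopy (n + 1) (tsnoc z w)) =
      e.homotopy n (lastFace k A n (tsnoc z w)) +
        (-1 : k) ^ (n + 1) • lastFace k A (n + 1) (e.spread (n + 1) (tsnoc z w))
    rw [homotopy_tsnoc, map_add, map_smul, lastFace_tsnoc, lastFace_tsnoc, homotopy_firstMul]
  have h2 := e.barDiff_homotopy_succ t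
  have h3 : (-1 : k) ^ (n + 1 + 1) * (-1 : k) ^ (n + 1) = -1 := by
    rw [pow_succ, mul_right_comm, ← mul_pow]; simp
  rw [hochDiff, hochDiff, LinearMap.add_apply, LinearMap.add_apply, LinearMap.smul_apply,
    LinearMap.smul_apply, h1, map_add, map_smul, smul_add, smul_smul, h3, pow_succ _ (n + 1),
    mul_neg_one, neg_smul, neg_one_smul]
  rw [← sub_eq_zero, ← sub_eq_zero.2 h2]
  abel

end SeparabilityIdempotent

end Separable

/-! ### Comparison of `Z(A/k)` with `Z(A/B)` for separable `B`. -/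

section SeparableReduction

variable {k : Type u} [CommRing k] {A : Type v} [Ring A] [Algebra k A]

variable (k) in
/-- The relation which moves `b` into slot `i`. -/
def relator {n : ℕ} (a : Fin (n + 1) → A) (i : Fin (n + 1)) (b : A) : TPow k A n :=
  PiTensorProduct.tprod k (fun j => a j * Pi.mulSingle (M := fun _ => A) i b (j + 1)) -
    PiTensorProduct.tprod k (fun j => Pi.mulSingle (M := fun _ => A) i b j * a j)

theorem relator_mem {B : Subalgebra k A} {n : ℕ} (a : Fin (n + 1) → A) (i : Fin (n + 1)) {b : A}
    (hb : b ∈ B) : relator k a i b ∈ cyclicRel B n :=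
  Submodule.subset_span ⟨a, i, ⟨b, hb⟩, rfl⟩

theorem relator_zero {n : ℕ} (a : Fin (n + 1) → A) (b : A) :
    relator k a 0 b =
      lastMul b (PiTensorProduct.tprod k a) - firstMul b (PiTensorProduct.tprod k a) := by
  rw [lastMul_tprod, firstMul_tprod]; rfl

theorem relator_one {n : ℕ} (x : A) (c : Fin (n + 1) → A) (b : A) :
    relator k (consTuple x c) (Fin.succ 0) b =
      tcons (x * b) (PiTensorProduct.tprod k c) -
        tcons x (firstMul b (PiTensorProduct.tprod k c)) := by
  rw [Fin.succ_zero_eq_one, relator, consTuple_mul_mulSingle_one, mulSingle_one_mul_consTuple,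
    firstMul_tprod, tcons_tprod, tcons_tprod]

theorem relator_succ_succ {n : ℕ} (x : A) (c : Fin (n + 1) → A) (i : Fin n) (b : A) :
    relator k (consTuple x c) i.succ.succ b = tcons x (relator k c i.succ b) := by
  rw [relator, consTuple_mul_mulSingle_succ, mulSingle_succ_mul_consTuple, relator, map_sub,
    tcons_tprod, tcons_tprod]

/-- The relations of `A ⊗_B ⋯ ⊗_B A`. -/
def barRel (B : Subalgebra k A) (n : ℕ) : Submodule k (TPow k A n) :=
  Submodule.span k {z | ∃ (a : Fin (n + 1) → A) (i : Fin n) (b : A), b ∈ B ∧ z = relator k a i.succ b}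

theorem barRel_le (B : Subalgebra k A) (n : ℕ) : barRel B n ≤ cyclicRel B n :=
  Submodule.span_le.2 fun _ ⟨a, i, _, hb, e⟩ => e ▸ relator_mem a i.succ hb

theorem tcons_mem_barRel {B : Subalgebra k A} {n : ℕ} (x : A) {t : TPow k A n}
    (ht : t ∈ barRel B n) : tcons x t ∈ barRel B (n + 1) := by
  suffices h : barRel B n ≤ (barRel B (n + 1)).comap (tcons x) from h ht
  refine Submodule.span_le.2 ?_
  rintro _ ⟨a, i, b, hb, rfl⟩
  exact Submodule.subset_span ⟨consTuple x a, i.succ, b, hb, (relator_succ_succ x a i b).symm⟩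

theorem tcons_sub_mem_barRel {B : Subalgebra k A} {n : ℕ} (x : A) {b : A} (hb : b ∈ B)
    (t : TPow k A n) : tcons (x * b) t - tcons x (firstMul b t) ∈ barRel B (n + 1) := by
  have h : (barRel B (n + 1)).mkQ ∘ₗ (tcons (x * b) - tcons x ∘ₗ firstMul b) = 0 := by
    refine PiTensorProduct.ext (MultilinearMap.ext fun c => ?_)
    refine (Submodule.Quotient.mk_eq_zero _).2 ?_
    exact Submodule.subset_span ⟨consTuple x c, 0, b, hb, (relator_one x c b).symm⟩
  exact (Submodule.Quotient.mk_eq_zero _).1 (LinearMap.congr_fun h t)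

theorem tcons_one_mem_cyclicRel {B : Subalgebra k A} {n : ℕ} {t : TPow k A n}
    (ht : t ∈ cyclicRel B n) : tcons 1 t ∈ cyclicRel B (n + 1) := by
  suffices h : cyclicRel B n ≤ (cyclicRel B (n + 1)).comap (tcons 1) from h ht
  refine Submodule.span_le.2 ?_
  rintro _ ⟨a, i, b, rfl⟩
  change tcons 1 (relator k a i b) ∈ cyclicRel B (n + 1)
  refine Fin.cases ?_ (fun i => ?_) i
  · have h1 := relator_mem (consTuple 1 a) 0 b.2
    have h2 := relator_mem (consTuple 1 a) (Fin.succ 0) b.2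
    rw [relator_zero, ← tcons_tprod, lastMul_tcons, firstMul_tcons] at h1
    rw [relator_one] at h2
    rw [relator_zero, map_sub]
    convert! add_mem h1 h2 using 1
    rw [mul_one, one_mul, sub_add_sub_cancel]
  · exact barRel_le B (n + 1) (tcons_mem_barRel 1 (Submodule.subset_span ⟨a, i, b, b.2, rfl⟩))

namespace SeparabilityIdempotent

variable {B : Subalgebra k A} (e : SeparabilityIdempotent B)

/-- The idempotent inserted behind the last factor lets `b` pass through it to the far right. -/
theorem spread_lastMul {n : ℕ} {b : A} (hb : b ∈ B) (t : TPow k A n) :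
    e.spread n (lastMul b t) = lastMul b (e.spread n t) := by
  induction n with
  | zero =>
    suffices h : e.spread 0 ∘ₗ lastMul b = lastMul b ∘ₗ e.spread 0 from LinearMap.congr_fun h t
    refine tcons_ext fun x y => ?_
    change e.spread 0 (lastMul b (tcons x y)) = lastMul b (e.spread 0 (tcons x y))
    rw [lastMul_tcons_zero, spread_zero_tcons, spread_zero_tcons, map_sum]
    have := e.move_apply ((tcons ∘ₗ LinearMap.mulLeft k x).compl₂ (tcons.flip y)) hb
    simp only [LinearMap.compl₂_apply, LinearMap.comp_apply, LinearMap.mulLeft_apply,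
      LinearMap.flip_apply, ← mul_assoc] at this
    rw [this]
    exact Finset.sum_congr rfl fun i _ => by rw [lastMul_tcons, lastMul_tcons_zero]
  | succ n ih =>
    suffices h : e.spread (n + 1) ∘ₗ lastMul b = lastMul b ∘ₗ e.spread (n + 1) from
      LinearMap.congr_fun h t
    refine tcons_ext fun x y => ?_
    change e.spread (n + 1) (lastMul b (tcons x y)) = lastMul b (e.spread (n + 1) (tcons x y))
    rw [lastMul_tcons, spread_succ_tcons, spread_succ_tcons, map_sum, ih]
    exact Finset.sum_congr rfl fun i _ => by rw [lastMul_tcons, lastMul_firstMul]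

/-- Each interior gap carries an idempotent, and `∑ b lᵢ ⊗ rᵢ = ∑ lᵢ ⊗ rᵢ b` identifies the two
sides of a relation there. -/
theorem spread_eq_zero {n : ℕ} {t : TPow k A n} (ht : t ∈ barRel B n) : e.spread n t = 0 := by
  suffices h : barRel B n ≤ LinearMap.ker (e.spread n) from h ht
  clear ht t
  induction n with
  | zero => exact Submodule.span_le.2 fun _ ⟨_, i, _⟩ => i.elim0
  | succ n ih =>
    refine Submodule.span_le.2 ?_
    rintro _ ⟨a, i, b, hb, rfl⟩
    rw [SetLike.mem_coe, LinearMap.mem_ker, ← Fin.cons_self_tail (α := fun _ => A) a]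
    change e.spread (n + 1) (relator k (consTuple _ _) i.succ b) = 0
    refine Fin.cases ?_ (fun i => ?_) i
    · rw [relator_one, map_sub, spread_succ_tcons, spread_succ_tcons, sub_eq_zero]
      have := e.move_apply ((tcons ∘ₗ LinearMap.mulLeft k (a 0)).compl₂
        (firstMul.flip (e.spread n (PiTensorProduct.tprod k (Fin.tail a))))) hb
      simp only [LinearMap.compl₂_apply, LinearMap.comp_apply, LinearMap.mulLeft_apply,
        LinearMap.flip_apply, ← mul_assoc, firstMul_mul] at this
      simp only [spread_firstMul]
      exact this
    · rw [relator_succ_succ, spread_succ_tcons]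
      have h0 := ih (Submodule.subset_span ⟨Fin.tail a, i, b, hb, rfl⟩)
      rw [LinearMap.mem_ker] at h0
      simp only [h0, map_zero, Finset.sum_const_zero]

theorem retract_eq_zero {n : ℕ} {t : TPow k A n} (ht : t ∈ cyclicRel B n) : e.retract n t = 0 := by
  suffices h : cyclicRel B n ≤ LinearMap.ker (e.retract n) from h ht
  refine Submodule.span_le.2 ?_
  rintro _ ⟨a, i, b, rfl⟩
  change lastFace k A n (e.spread n (relator k a i b)) = 0
  refine Fin.cases ?_ (fun i => ?_) i
  · rw [relator_zero, map_sub, e.spread_lastMul b.2, spread_firstMul, map_sub, lastFace_lastMul, sub_self]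
  · rw [e.spread_eq_zero (Submodule.subset_span ⟨a, i, b, b.2, rfl⟩), map_zero]

theorem sum_tcons_firstMul_sub_mem {n : ℕ} (x : A) (t : TPow k A n) :
    ∑ i, tcons (x * e.l i) (firstMul (e.r i) t) - tcons x t ∈ barRel B (n + 1) := by
  rw [← e.sum_tcons_mul x t, ← Finset.sum_sub_distrib]
  refine sum_mem fun i _ => ?_
  rw [← neg_sub]
  exact neg_mem (tcons_sub_mem_barRel (x * e.l i) (e.r_mem i) t)

/-- Modulo the relations each `rᵢ` in `B` moves back across its gap and `∑ lᵢ rᵢ = 1`; only a final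
factor `1` is left. Joining that factor to the front gives `retract_sub_mem`. -/
theorem spread_sub_mem {n : ℕ} (t : TPow k A n) : e.spread n t - tsnoc 1 t ∈ barRel B (n + 1) := by
  suffices h : (barRel B (n + 1)).mkQ ∘ₗ (e.spread n - tsnoc 1) = 0 from
    (Submodule.Quotient.mk_eq_zero _).1 (LinearMap.congr_fun h t)
  refine tcons_ext fun x y => (Submodule.Quotient.mk_eq_zero _).2 ?_
  change e.spread n (tcons x y) - tsnoc 1 (tcons x y) ∈ barRel B (n + 1)
  clear t
  induction n generalizing x with
  | zero =>
    rw [spread_zero_tcons, ← tcons_tsnoc, tsnoc_zero]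
    have := e.sum_tcons_firstMul_sub_mem x (tcons 1 y)
    simpa only [firstMul_tcons, mul_one] using this
  | succ n ih =>
    have h1 : e.spread n y - tsnoc 1 y ∈ barRel B (n + 1) := by
      suffices h : (barRel B (n + 1)).mkQ ∘ₗ (e.spread n - tsnoc 1) = 0 from
        (Submodule.Quotient.mk_eq_zero _).1 (LinearMap.congr_fun h y)
      exact tcons_ext fun x y => (Submodule.Quotient.mk_eq_zero _).2 (ih x y)
    rw [spread_succ_tcons, ← tcons_tsnoc]
    have h2 := add_mem (e.sum_tcons_firstMul_sub_mem x (e.spread n y)) (tcons_mem_barRel x h1)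
    rwa [map_sub, sub_add_sub_cancel] at h2

theorem retract_sub_mem {n : ℕ} (t : TPow k A n) : e.retract n t - t ∈ cyclicRel B n := by
  have := lastFace_mem_cyclicRel B (barRel_le B (n + 1) (e.spread_sub_mem t))
  rwa [map_sub, lastFace_tsnoc, firstMul_one] at this

end SeparabilityIdempotent

theorem b_mk (B : Subalgebra k A) {n : ℕ} (t : TPow k A (n + 1)) :
    (relativeCyclicModule B).b n (Submodule.Quotient.mk t) =
      (Submodule.Quotient.mk (hochDiff k A n t) : CyclicTensor B n) := by
  have h : (relativeCyclicModule B).b n = ∑ i : Fin (n + 1), (-1 : k) ^ (i : ℕ) • face B n i +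
      (-1 : k) ^ (n + 1) • (face B n 0 ∘ₗ rot B (n + 1)) := by
    rw [CyclicModule.b, Fin.sum_univ_castSucc]
    change ∑ i : Fin (n + 1), (-1 : k) ^ (i : ℕ) • relFace B n i.castSucc +
      (-1 : k) ^ (n + 1) • relFace B n (Fin.last (n + 1)) = _
    simp only [relFace_castSucc, relFace_last]
  refine (LinearMap.congr_fun h _).trans ?_
  change (∑ i : Fin (n + 1), (-1 : k) ^ (i : ℕ) • face B n i +
    (-1 : k) ^ (n + 1) • (face B n 0 ∘ₗ rot B (n + 1)) : CyclicTensor B (n + 1) →ₗ[k]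
      CyclicTensor B n) ((cyclicRel B (n + 1)).mkQ t) = (cyclicRel B n).mkQ (hochDiff k A n t)
  rw [hochDiff, barDiff, LinearMap.add_apply, LinearMap.add_apply, LinearMap.sum_apply,
    LinearMap.sum_apply, map_add, map_sum]
  rfl

theorem b'_mk (B : Subalgebra k A) {n : ℕ} (t : TPow k A (n + 1)) :
    (relativeCyclicModule B).b' n (Submodule.Quotient.mk t) =
      (Submodule.Quotient.mk (barDiff k A n t) : CyclicTensor B n) := by
  have h : (relativeCyclicModule B).b' n = ∑ i : Fin (n + 1), (-1 : k) ^ (i : ℕ) • face B n i := by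
    rw [CyclicModule.b']
    change ∑ i : Fin (n + 1), (-1 : k) ^ (i : ℕ) • relFace B n i.castSucc = _
    simp only [relFace_castSucc]
  refine (LinearMap.congr_fun h _).trans ?_
  change (∑ i : Fin (n + 1), (-1 : k) ^ (i : ℕ) • face B n i : CyclicTensor B (n + 1) →ₗ[k]
    CyclicTensor B n) ((cyclicRel B (n + 1)).mkQ t) = (cyclicRel B n).mkQ (barDiff k A n t)
  rw [barDiff, LinearMap.sum_apply, LinearMap.sum_apply, map_sum]
  rfl

/-- Scalars move freely in a tensor product over `k`, so `Z(A/k)` consists of the plain tensor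
powers. -/
theorem cyclicRel_bot (n : ℕ) : cyclicRel (⊥ : Subalgebra k A) n = ⊥ := by
  rw [eq_bot_iff]
  refine Submodule.span_le.2 ?_
  rintro _ ⟨a, i, ⟨b, hb⟩, rfl⟩
  obtain ⟨c, rfl⟩ := Algebra.mem_bot.1 hb
  have h1 : (fun j => a j * Pi.mulSingle (M := fun _ => A) i (algebraMap k A c) (j + 1)) =
      Function.update a (i - 1) (c • a (i - 1)) := by
    funext j
    by_cases hj : j = i - 1
    · subst hj
      rw [sub_add_cancel, Pi.mulSingle_eq_same, Function.update_self, Algebra.smul_def,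
        Algebra.commutes]
    · rw [Function.update_of_ne hj, Pi.mulSingle_eq_of_ne (fun h => hj (eq_sub_of_add_eq h)), mul_one]
  have h2 : (fun j => Pi.mulSingle (M := fun _ => A) i (algebraMap k A c) j * a j) =
      Function.update a i (c • a i) := by
    funext j
    by_cases hj : j = i
    · subst hj
      rw [Pi.mulSingle_eq_same, Function.update_self, Algebra.smul_def]
    · rw [Function.update_of_ne hj, Pi.mulSingle_eq_of_ne hj, one_mul]
  rw [h1, h2, MultilinearMap.map_update_smul, MultilinearMap.map_update_smul,
    Function.update_eq_self, Function.update_eq_self, sub_self]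
  exact zero_mem _

theorem mk_bot_injective (n : ℕ) : Function.Injective
    (Submodule.Quotient.mk : TPow k A n → CyclicTensor (⊥ : Subalgebra k A) n) := by
  intro t t' h
  have := (Submodule.Quotient.eq _).1 h
  rw [cyclicRel_bot, Submodule.mem_bot] at this
  exact sub_eq_zero.1 this

theorem hochDiff_hochDiff {n : ℕ} (t : TPow k A (n + 2)) :
    hochDiff k A n (hochDiff k A (n + 1) t) = 0 := by
  apply mk_bot_injective
  rw [← b_mk, ← b_mk]
  exact LinearMap.congr_fun ((relativeCyclicModule (⊥ : Subalgebra k A)).b_comp_b n) _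

theorem exists_relFace_mk {n : ℕ} (i : Fin (n + 2)) : ∃ g : TPow k A (n + 1) →ₗ[k] TPow k A n,
    ∀ (B : Subalgebra k A) t, relFace B n i (Submodule.Quotient.mk t) =
      (Submodule.Quotient.mk (g t) : CyclicTensor B n) := by
  refine Fin.lastCases ⟨lastFace k A n, fun B t => ?_⟩ (fun i => ⟨tensorMerge i, fun B t => ?_⟩) i
  · rw [relFace_last]; rfl
  · rw [relFace_castSucc]; rfl

/-- The projection `Z(A/k) → Z(A/B)`. -/
def cyclicModuleProj (B : Subalgebra k A) :
    CyclicModule.Hom (relativeCyclicModule (⊥ : Subalgebra k A)) (relativeCyclicModule B) where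
  f n := (cyclicRel (⊥ : Subalgebra k A) n).mapQ (cyclicRel B n) LinearMap.id
    ((cyclicRel_bot n).le.trans bot_le)
  map_d n i x := by
    obtain ⟨t, rfl⟩ := Submodule.Quotient.mk_surjective _ x
    obtain ⟨g, hg⟩ := exists_relFace_mk (k := k) (A := A) i
    exact (congrArg (Submodule.mapQ _ _ _ _) (hg ⊥ t)).trans (hg B t).symm
  map_t n x := by
    obtain ⟨t, rfl⟩ := Submodule.Quotient.mk_surjective _ x
    rfl

/-- The primitive `homotopy t` may lie outside the relations. Subtracting its image under `retract`
brings it inside, and differentiating the homotopy formula at `homotopy t` shows that the boundary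
is still `t`. -/
theorem SeparabilityIdempotent.exists_hochDiff_eq {B : Subalgebra k A}
    (e : SeparabilityIdempotent B) {n : ℕ} {t : TPow k A n}
    (h : hochDiff k A n (e.homotopy n t) = t) :
    ∃ v ∈ cyclicRel B (n + 1), hochDiff k A n v = t := by
  refine ⟨e.homotopy n t - e.retract (n + 1) (e.homotopy n t), ?_, ?_⟩
  · rw [← neg_sub]; exact neg_mem (e.retract_sub_mem _)
  · have h1 := congrArg (hochDiff k A n) (e.hochDiff_homotopy_succ (e.homotopy n t))
    rw [map_add, hochDiff_hochDiff, zero_add, h, h] at h1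
    exact h1.symm

/-- The kernel of `Z(A/k) → Z(A/B)` is the module of relations, which `retract` annihilates. So the
homotopy makes its `b`-columns exact, and prefixing `1`, which preserves the relations, contracts
its `b'`-columns. -/
theorem IsSeparableAlgebra.nonempty_equiv {B : Subalgebra k A} (hB : IsSeparableAlgebra k B)
    (n : ℕ) : Nonempty (LinHomology (relativeCyclicModule (⊥ : Subalgebra k A)).D n ≃ₗ[k]
      LinHomology (relativeCyclicModule B).D n) := by
  obtain ⟨e⟩ := hB.nonempty_separabilityIdempotent
  refine (cyclicModuleProj B).nonempty_equiv_of_surjective ?_ ?_ ?_ n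
  · intro n x
    obtain ⟨t, rfl⟩ := Submodule.Quotient.mk_surjective _ x
    exact ⟨Submodule.Quotient.mk t, rfl⟩
  · intro n x hx h
    obtain ⟨t, rfl⟩ := Submodule.Quotient.mk_surjective _ x
    have ht : t ∈ cyclicRel B n := (Submodule.Quotient.mk_eq_zero _).1 hx
    obtain ⟨v, hv, hvt⟩ := e.exists_hochDiff_eq (t := t) (by
      cases n with
      | zero => rw [e.hochDiff_homotopy_zero, e.retract_eq_zero ht, sub_zero]
      | succ n =>
        have h0 : hochDiff k A n t = 0 := by
          apply mk_bot_injective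
          rw [← b_mk]
          exact h
        have := e.hochDiff_homotopy_succ t
        rwa [h0, map_zero, add_zero, e.retract_eq_zero ht, sub_zero] at this)
    exact ⟨Submodule.Quotient.mk v, (Submodule.Quotient.mk_eq_zero _).2 hv, by rw [b_mk, hvt]⟩
  · intro n x hx h
    obtain ⟨t, rfl⟩ := Submodule.Quotient.mk_surjective _ x
    have ht : t ∈ cyclicRel B n := (Submodule.Quotient.mk_eq_zero _).1 hx
    refine ⟨Submodule.Quotient.mk (tcons 1 t),
      (Submodule.Quotient.mk_eq_zero _).2 (tcons_one_mem_cyclicRel ht), ?_⟩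
    rw [b'_mk]
    cases n with
    | zero => rw [barDiff_zero_tcons, firstMul_one]
    | succ n =>
      have h0 : barDiff k A n t = 0 := by
        apply mk_bot_injective
        rw [← b'_mk]
        exact h
      rw [barDiff_succ_tcons, firstMul_one, h0, map_zero, sub_zero]

end SeparableReduction

theorem IsSeparableAlgebra.of_algEquiv {k : Type u} [CommRing k] {B : Type v} [Ring B] [Algebra k B]
    {C : Type w} [Ring C] [Algebra k C] (e : B ≃ₐ[k] C) (hB : IsSeparableAlgebra k B) :
    IsSeparableAlgebra k C := by
  obtain ⟨s, hs, hbi⟩ := hB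
  let ψ := TensorProduct.map e.toLinearMap e.toLinearMap
  refine ⟨ψ ∘ₗ s ∘ₗ e.symm.toLinearMap, LinearMap.ext fun c => ?_, fun b x c => ?_⟩
  · have h1 : LinearMap.mul' k C ∘ₗ ψ = e.toLinearMap ∘ₗ LinearMap.mul' k B :=
      TensorProduct.ext' fun x y => by simp [ψ]
    have h2 := LinearMap.congr_fun h1 (s (e.symm c))
    have h3 : LinearMap.mul' k B (s (e.symm c)) = e.symm c := LinearMap.congr_fun hs _
    simp only [LinearMap.comp_apply, h3] at h2
    exact h2.trans (e.apply_symm_apply c)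
  · have h1 : ψ ∘ₗ TensorProduct.map (LinearMap.mulLeft k (e.symm b)) (LinearMap.mulRight k (e.symm c)) =
        TensorProduct.map (LinearMap.mulLeft k b) (LinearMap.mulRight k c) ∘ₗ ψ :=
      TensorProduct.ext' fun x y => by simp [ψ]
    have h2 := LinearMap.congr_fun h1 (s (e.symm x))
    rw [LinearMap.comp_apply, ← hbi, ← map_mul, ← map_mul] at h2
    exact h2

theorem nonempty_burgheleaSum_equiv {k : Type u} [CommRing k] {G : Type u} [Group G]
    (t : ConjClasses G → G) {M N : ∀ x : G, Rep.{u} k (CentBar x)} (e : ∀ x, Nonempty (M x ≅ N x))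
    (n : ℕ) : Nonempty (BurgheleaSum t M n ≃ₗ[k] BurgheleaSum t N n) := by
  have f : ∀ x n, Nonempty (groupHomology (M x) n ≃ₗ[k] groupHomology (N x) n) := fun x n =>
    ⟨((groupHomology.functor k (CentBar x) n).mapIso (e x).some).toLinearEquiv⟩
  exact ⟨LinearEquiv.prodCongr
    (DFinsupp.mapRange.linearEquiv fun c => DFinsupp.mapRange.linearEquiv fun i =>
      (f (t c.1) (n - 2 * i.1)).some)
    (DFinsupp.mapRange.linearEquiv fun c => (f (t c.1) n).some)⟩

/-! ### The smash product as a strongly graded algebra. -/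

section Smash

variable (k : Type u) [CommRing k] {G : Type u} (B : Type u) [Ring B] [Algebra k B]

/-- The component `B e_x` of the smash product. -/
def smashComponent (x : G) : Submodule k (SkewMonoidAlgebra B G) :=
  LinearMap.range (SkewMonoidAlgebra.lsingle k (M := B) x)

variable {k B} in
theorem single_mem_smashComponent (x : G) (b : B) :
    SkewMonoidAlgebra.single x b ∈ smashComponent k B x := ⟨b, rfl⟩

/-- The isomorphism of `B` with the component `B e_x`. -/
def smashComponentEquiv (x : G) : B ≃ₗ[k] smashComponent k B x :=
  LinearEquiv.ofInjective (SkewMonoidAlgebra.lsingle k x) (SkewMonoidAlgebra.single_injective x)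

variable [Group G] [MulSemiringAction G B] [SMulCommClass G k B]

theorem isStronglyGraded_smash : IsStronglyGraded (smashComponent k (G := G) B) where
  iSupIndep := by
    rw [iSupIndep_def]
    intro x
    let c : SkewMonoidAlgebra B G →ₗ[k] B :=
      Finsupp.lapply x ∘ₗ (SkewMonoidAlgebra.coeffLinearEquiv (S := k)).toLinearMap
    have hc : ∀ y b, c (SkewMonoidAlgebra.single y b) = Finsupp.single y b x := fun _ _ => rfl
    rw [Submodule.disjoint_def]
    rintro _ ⟨b, rfl⟩ h
    have hle : (⨆ (y : G) (_ : y ≠ x), smashComponent k B y) ≤ LinearMap.ker c := by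
      refine iSup₂_le fun y hy => ?_
      rintro _ ⟨b, rfl⟩
      exact (hc y b).trans (Finsupp.single_eq_of_ne hy.symm)
    have hb : c (SkewMonoidAlgebra.single x b) = 0 := hle h
    rw [hc, Finsupp.single_eq_same] at hb
    rw [hb, map_zero]
  iSup_eq_top := by
    rw [eq_top_iff]
    intro f _
    induction f using SkewMonoidAlgebra.induction_on with
    | zero => exact zero_mem _
    | single x b => exact Submodule.mem_iSup_of_mem x (single_mem_smashComponent x b)
    | add f g hf hg => exact add_mem (hf trivial) (hg trivial)
  mul_eq x y := by
    refine le_antisymm (Submodule.mul_le.2 ?_) ?_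
    · rintro _ ⟨b, rfl⟩ _ ⟨c, rfl⟩
      rw [SkewMonoidAlgebra.lsingle_apply, SkewMonoidAlgebra.lsingle_apply,
        SkewMonoidAlgebra.single_mul_single]
      exact single_mem_smashComponent _ _
    · rintro _ ⟨b, rfl⟩
      -- Strong grading holds because `b e_{xy} = (b e_x)(1 e_y)`, the action fixing `1`.
      have : SkewMonoidAlgebra.lsingle k (x * y) b =
          SkewMonoidAlgebra.single x b * SkewMonoidAlgebra.single y (1 : B) := by
        rw [SkewMonoidAlgebra.single_mul_single, smul_one, mul_one]; rfl
      rw [this]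
      exact Submodule.mul_mem_mul (single_mem_smashComponent x b) (single_mem_smashComponent y 1)

theorem base_smash : (isStronglyGraded_smash k (G := G) B).base = smashBase k B := by
  ext a
  exact Iff.rfl

/-- The isomorphism of `B` with the subalgebra `B e_1`. -/
def smashBaseEquiv : B ≃ₐ[k] (isStronglyGraded_smash k (G := G) B).base :=
  AlgEquiv.ofLinearEquiv (smashComponentEquiv k B 1)
    rfl
    (fun b c => Subtype.ext <| by
      change SkewMonoidAlgebra.single (1 : G) (b * c) =
        SkewMonoidAlgebra.single 1 b * SkewMonoidAlgebra.single 1 c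
      rw [SkewMonoidAlgebra.single_mul_single, one_smul, one_mul])

theorem map_twistedCommutators (x : G) :
    (twistedCommutators k B x).map (smashComponentEquiv k B x).toLinearMap =
      commutators (smashComponent k B) x := by
  have key : ∀ b b' : B, (smashComponentEquiv k B x (b * b' - b' * x • b) : SkewMonoidAlgebra B G) =
      SkewMonoidAlgebra.single 1 b * SkewMonoidAlgebra.single x b' -
        SkewMonoidAlgebra.single x b' * SkewMonoidAlgebra.single 1 b := fun b b' => by
    rw [SkewMonoidAlgebra.single_mul_single, SkewMonoidAlgebra.single_mul_single, one_smul, one_mul,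
      mul_one, map_sub]
    rfl
  refine le_antisymm (Submodule.map_le_iff_le_comap.2 (Submodule.span_le.2 ?_))
    (Submodule.span_le.2 ?_)
  · rintro _ ⟨b, b', rfl⟩
    change smashComponentEquiv k B x _ ∈ commutators (smashComponent k B) x
    -- The generator `b b' - b' (x • b)` corresponds to minus the commutator of `b' e_x` with `b
    -- e_1`.
    rw [← neg_mem_iff]
    refine Submodule.subset_span ⟨⟨_, single_mem_smashComponent x b'⟩,
      ⟨_, single_mem_smashComponent 1 b⟩, ?_⟩
    rw [Submodule.coe_neg, key, neg_sub]
  · rintro m ⟨⟨_, b', rfl⟩, ⟨_, b, rfl⟩, hm⟩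
    rw [SetLike.mem_coe, ← neg_mem_iff]
    refine ⟨_, Submodule.subset_span ⟨b, b', rfl⟩, Subtype.ext ?_⟩
    refine (key b b').trans ?_
    rw [Submodule.coe_neg, hm, neg_sub]
    rfl

/-- The isomorphism of `B / [B, B]_x` with `A_x / [A_x, B]` for `A = B # kG`. -/
def compBarEquiv (x : G) :
    (B ⧸ twistedCommutators k B x) ≃ₗ[k] CompBar (smashComponent k B) x :=
  Submodule.Quotient.equiv _ _ (smashComponentEquiv k B x) (map_twistedCommutators k B x)

variable (G) in
/-- The presentation `1 = e_{g⁻¹} e_g`. -/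
def smashUnitDecomp (g : G) : UnitDecomp (smashComponent k B) g where
  ι := Unit
  a _ := SkewMonoidAlgebra.single g⁻¹ 1
  b _ := SkewMonoidAlgebra.single g 1
  a_mem _ := single_mem_smashComponent _ _
  b_mem _ := single_mem_smashComponent _ _
  sum_eq := by
    rw [Finset.sum_const, Finset.card_univ, Fintype.card_unit, one_smul,
      SkewMonoidAlgebra.single_mul_single, smul_one, mul_one, inv_mul_cancel,
      SkewMonoidAlgebra.single_one_one]

theorem compBarEquiv_action (x : G) (g : Cent x) (v : B ⧸ twistedCommutators k B x) :
    compBarEquiv k B x (twistedAction k B x g v) =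
      (isStronglyGraded_smash k B).action x g (compBarEquiv k B x v) := by
  obtain ⟨b, rfl⟩ := Submodule.Quotient.mk_surjective _ v
  -- Independence of the presentation permits `1 = e_{g⁻¹} e_g`, for which conjugation is just the
  -- action of `g` on coefficients.
  have h : (isStronglyGraded_smash k B).action x g =
      (smashUnitDecomp k G B g).act (isStronglyGraded_smash k B) (cent_conj g) :=
    UnitDecomp.act_eq _ _ _ _
  rw [h]
  refine congrArg Submodule.Quotient.mk (Subtype.ext ?_)
  change SkewMonoidAlgebra.single x ((g : G) • b) =
    (smashUnitDecomp k G B g).conj (SkewMonoidAlgebra.single x b)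
  rw [UnitDecomp.conj_apply]
  refine Eq.trans ?_ (Fintype.sum_unique (fun _ : Unit => SkewMonoidAlgebra.single (g : G) (1 : B) *
    (SkewMonoidAlgebra.single x b * SkewMonoidAlgebra.single (g : G)⁻¹ 1))).symm
  rw [SkewMonoidAlgebra.single_mul_single, SkewMonoidAlgebra.single_mul_single, smul_one, mul_one,
    one_mul, ← mul_assoc, cent_conj]

theorem nonempty_rep_iso (x : G) :
    Nonempty ((isStronglyGraded_smash k B).rep x ≅ twistedRep k B x) := by
  refine ⟨(Rep.mkIso (Representation.Equiv.mk (compBarEquiv k B x) fun g => ?_)).symm⟩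
  obtain ⟨g, rfl⟩ := QuotientGroup.mk_surjective g
  exact LinearMap.ext fun v => compBarEquiv_action k B x g v

end Smash

/-! ### The isomorphisms for strongly graded algebras and for smash products. -/

section Main

variable {k : Type u} [Field k] [CharZero k] {G : Type u} [Group G] (t : ConjClasses G → G)
  (ht : ∀ c, ConjClasses.mk (t c) = c)

include ht

theorem IsStronglyGraded.nonempty_relativeHC_equiv {A : Type u} [Ring A] [Algebra k A]
    {𝒜 : G → Submodule k A} (h : IsStronglyGraded 𝒜) (n : ℕ) :
    Nonempty (relativeHC h.base n ≃ₗ[k] BurgheleaSum t h.rep n) := by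
  obtain ⟨e1⟩ := (relativeCyclicModule h.base).nonempty_HC_equiv n
  obtain ⟨e2⟩ := h.nonempty_equiv_burgheleaSum t ht n
  exact ⟨e1.trans e2⟩

theorem IsStronglyGraded.nonempty_HC_equiv {A : Type u} [Ring A] [Algebra k A]
    {𝒜 : G → Submodule k A} (h : IsStronglyGraded 𝒜) (hB : IsSeparableAlgebra k h.base) (n : ℕ) :
    Nonempty (relativeHC (⊥ : Subalgebra k A) n ≃ₗ[k] BurgheleaSum t h.rep n) := by
  obtain ⟨e1⟩ := (relativeCyclicModule (⊥ : Subalgebra k A)).nonempty_HC_equiv n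
  obtain ⟨e2⟩ := hB.nonempty_equiv n
  obtain ⟨e3⟩ := h.nonempty_equiv_burgheleaSum t ht n
  exact ⟨e1.trans (e2.trans e3)⟩

variable (B : Type u) [Ring B] [Algebra k B] [MulSemiringAction G B] [SMulCommClass G k B]

theorem nonempty_smash_relativeHC_equiv (n : ℕ) :
    Nonempty (relativeHC (smashBase k (G := G) B) n ≃ₗ[k]
      BurgheleaSum t (twistedRep k (G := G) B) n) := by
  obtain ⟨e1⟩ := (isStronglyGraded_smash k (G := G) B).nonempty_relativeHC_equiv t ht n
  obtain ⟨e2⟩ := nonempty_burgheleaSum_equiv t (nonempty_rep_iso k (G := G) B) n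
  rw [← base_smash]
  exact ⟨e1.trans e2⟩

theorem nonempty_smash_HC_equiv (hB : IsSeparableAlgebra k B) (n : ℕ) :
    Nonempty (relativeHC (⊥ : Subalgebra k (SkewMonoidAlgebra B G)) n ≃ₗ[k]
      BurgheleaSum t (twistedRep k (G := G) B) n) := by
  obtain ⟨e1⟩ := (isStronglyGraded_smash k (G := G) B).nonempty_HC_equiv t ht
    (hB.of_algEquiv (smashBaseEquiv k B)) n
  obtain ⟨e2⟩ := nonempty_burgheleaSum_equiv t (nonempty_rep_iso k (G := G) B) n
  exact ⟨e1.trans e2⟩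

end Main

end RelCyclic

end

theorem mainTheorem5 {k G : Type u} [Field k] [CharZero k] [Group G]
    (t : ConjClasses G → G) (ht : ∀ c, ConjClasses.mk (t c) = c) :
    (∀ (A : Type u) [Ring A] [Algebra k A] (𝒜 : G → Submodule k A)
        (h : RelCyclic.IsStronglyGraded 𝒜),
      (∀ n : ℕ, Nonempty
        (RelCyclic.relativeHC h.base n ≃ₗ[k] RelCyclic.BurgheleaSum t h.rep n)) ∧
      (RelCyclic.IsSeparableAlgebra k h.base → ∀ n : ℕ, Nonempty
        (RelCyclic.relativeHC (⊥ : Subalgebra k A) n ≃ₗ[k]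
          RelCyclic.BurgheleaSum t h.rep n))) ∧
    (∀ (B : Type u) [Ring B] [Algebra k B] [MulSemiringAction G B] [SMulCommClass G k B],
      (∀ n : ℕ, Nonempty
        (RelCyclic.relativeHC (RelCyclic.smashBase k (G := G) B) n ≃ₗ[k]
          RelCyclic.BurgheleaSum t (RelCyclic.twistedRep k (G := G) B) n)) ∧
      (RelCyclic.IsSeparableAlgebra k B → ∀ n : ℕ, Nonempty
        (RelCyclic.relativeHC (⊥ : Subalgebra k (SkewMonoidAlgebra B G)) n ≃ₗ[k]
          RelCyclic.BurgheleaSum t (RelCyclic.twistedRep k (G := G) B) n))) := by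
  exact ⟨fun A _ _ 𝒜 h => ⟨fun n => h.nonempty_relativeHC_equiv t ht n,
      fun hB n => h.nonempty_HC_equiv t ht hB n⟩,
    fun B _ _ _ _ => ⟨fun n => RelCyclic.nonempty_smash_relativeHC_equiv t ht B n,
      fun hB n => RelCyclic.nonempty_smash_HC_equiv t ht B hB n⟩⟩
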